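/- Let $H$ be a complex Hilbert space, and let $\mathbb A=\{A_k\}_{k\in K}$ and $\mathbb B=\{B_k\}_{k\in K}$ be two families of bounded normal operators on $H$ such that the $A_k$ commute with each other, the $B_k$ commute with each other, and $\sum_k\|A_k\|^2<\infty$, $\sum_k\|B_k\|^2<\infty$. Let $\sigma(\mathbb A)\subset\ell_2(K)$ be the joint spectrum of $\mathbb A$, i.e. the set of points $(t(A_k))_{k\in K}$, where $t$ runs over the characters of the unital $C^*$-algebra generated by $\mathbb A$; let $E_{\mathbb A}$ be the spectral measure of $\mathbb A$ on $\sigma(\mathbb A)$, and for a bounded Borel function $f$ on $\sigma(\mathbb A)$ let $f(\mathbb A)=\int f\,dE_{\mathbb A}$. Use the same notation for $\mathbb B$. Write $\|X\|_2\in[0,\infty]$ for the Hilbert–Schmidt norm of a bounded operator $X$ on $H$, with $\|X\|_2=\infty$ if $X$ is not Hilbert–Schmidt. Assume that the essential dimension of $\mathbb A$ is at most $2$: there are a Borel set $D\subset\sigma(\mathbb A)$ with $E_{\mathbb A}(\sigma(\mathbb A)\setminus D)=0$ and a constant $C$ such that for every $\varepsilon>0$ the set $D$ has a countable covering by pairwise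 disjoint Borel sets $\beta_1,\beta_2,\dots$ with $\operatorname{diam}\beta_n<\varepsilon$ and $\big(\sum_n(\operatorname{diam}\beta_n)^2\big)^{1/2}\le C$. Then the following hold. (1) For every bounded operator $X$ on $H$, the series below converge in operator norm and $$\Big\|\sum_{k\in K}B_kXA_k\Big\|_2=\Big\|\sum_{k\in K}B_k^*XA_k^*\Big\|_2 .$$ (2) Let $J$ be an index set, and for each $j\in J$ let $f_j,u_j$ be bounded Borel functions on $\sigma(\mathbb A)$ and $g_j,v_j$ bounded Borel functions on $\sigma(\mathbb B)$. Suppose that every $f_j$ is Lipschitz, that $\sum_j\|f_j\|_{\mathrm{Lip}_1}^2<\infty$ (where $\|f\|_{\mathrm{Lip}_1}$ is the supremum norm of $f$ plus its least Lipschitz constant), that $\sum_j\|g_j\|_\infty^2<\infty$ and $\sum_j\|u_j\|_\infty\|v_j\|_\infty<\infty$ (supremum norms), and that $$\Big|\sum_{j\in J}f_j(x)g_j(y)\Big|\le\Big|\sum_{j\in J}u_j(x)v_j(y)\Big|\qquad\text{for all }x\in\sigma(\mathbb A),\ y\in\sigma(\mathbb B).$$ Then, for every bounded operator $X$ on $H$,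 the series below converge in operator norm and $$\Big\|\sum_{j\in J}g_j(\mathbb B)\,X\,f_j(\mathbb A)\Big\|_2\le\Big\|\sum_{j\in J}v_j(\mathbb B)\,X\,u_j(\mathbb A)\Big\|_2 .$$ -/

import Mathlib

open MeasureTheory Filter Topology
open scoped ENNReal NNReal

universe u v w

set_option linter.unusedSectionVars false

noncomputable section


/-- A square-summable commuting family of bounded normal operators on `H`. -/
structure NormalFamily (K : Type w) (H : Type u) [NormedAddCommGroup H] [InnerProductSpace ℂ H]
    [CompleteSpace H] where
  /-- the operators of the family -/
  op : K → H →L[ℂ] H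
  normal : ∀ k, IsStarNormal (op k)
  commute : ∀ i j, Commute (op i) (op j)
  summable_sq : Summable fun k => ‖op k‖ ^ 2

/-- The Hilbert space `ℓ²(K)`. -/
abbrev EllTwo (K : Type w) : Type w := lp (fun _ : K => ℂ) 2

instance EllTwo.instMeasurableSpace (K : Type w) : MeasurableSpace (EllTwo K) :=
  borel (EllTwo K)

instance EllTwo.instBorelSpace (K : Type w) : BorelSpace (EllTwo K) := ⟨rfl⟩

namespace NormalFamily

variable {K : Type w} {H : Type u} [NormedAddCommGroup H] [InnerProductSpace ℂ H]
  [CompleteSpace H]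

/-- The unital C⋆-algebra generated by the family. -/
def cstar (A : NormalFamily K H) : StarSubalgebra ℂ (H →L[ℂ] H) :=
  (StarAlgebra.adjoin ℂ (Set.range A.op)).topologicalClosure

theorem op_mem_cstar (A : NormalFamily K H) (k : K) : A.op k ∈ A.cstar :=
  StarSubalgebra.le_topologicalClosure _ (StarAlgebra.subset_adjoin ℂ _ ⟨k, rfl⟩)

/-- The operator `A_k` as an element of the generated C⋆-algebra. -/
def gen (A : NormalFamily K H) (k : K) : A.cstar := ⟨A.op k, A.op_mem_cstar k⟩

theorem cstar_mul_comm (A : NormalFamily K H) (a b : A.cstar) : a * b = b * a := by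
  have h1 := StarAlgebra.isMulCommutative_adjoin ℂ (s := Set.range A.op)
    (by rintro _ ⟨i, rfl⟩ _ ⟨j, rfl⟩; exact A.commute i j)
    (by rintro _ ⟨i, rfl⟩ _ ⟨j, rfl⟩; exact (A.normal j).commute_star_right (A.commute i j))
  exact (StarSubalgebra.commRingTopologicalClosure
    (StarAlgebra.adjoin ℂ (Set.range A.op)) (fun x y => h1.is_comm.comm x y)).mul_comm a b

instance instCStar (A : NormalFamily K H) : CommCStarAlgebra A.cstar :=
  { StarSubalgebra.cstarAlgebra A.cstar
      (h_closed := StarSubalgebra.isClosed_topologicalClosure _) with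
    mul_comm := A.cstar_mul_comm }

/-- The maximal ideal space of the generated C⋆-algebra. -/
abbrev MaxSpace (A : NormalFamily K H) : Type u := WeakDual.characterSpace ℂ A.cstar

/-- The Borel σ-algebra of the maximal ideal space. -/
instance instMeasurableSpaceMaxSpace (A : NormalFamily K H) : MeasurableSpace A.MaxSpace :=
  borel A.MaxSpace

instance instBorelSpaceMaxSpace (A : NormalFamily K H) : BorelSpace A.MaxSpace := ⟨rfl⟩

theorem norm_char_le (A : NormalFamily K H) (t : A.MaxSpace) (k : K) :
    ‖t (A.gen k)‖ ≤ ‖A.op k‖ :=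
  NonUnitalStarAlgHom.norm_apply_le t (A.gen k)

theorem memlp_char (A : NormalFamily K H) (t : A.MaxSpace) :
    Memℓp (fun k => t (A.gen k)) 2 := by
  refine memℓp_gen ?_
  refine Summable.of_nonneg_of_le (fun _ => by positivity) (fun k => ?_) A.summable_sq
  simpa using pow_le_pow_left₀ (norm_nonneg _) (A.norm_char_le t k) 2

/-- The map `t ↦ (t(A_k))_k` from the maximal ideal space to `ℓ²(K)`. -/
def coord (A : NormalFamily K H) (t : A.MaxSpace) : EllTwo K :=
  ⟨fun k => t (A.gen k), A.memlp_char t⟩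

theorem continuous_coord (A : NormalFamily K H) : Continuous A.coord := by
  rw [continuous_iff_continuousAt]
  intro s
  rw [ContinuousAt, tendsto_iff_norm_sub_tendsto_zero]
  have h : Tendsto (fun t : A.MaxSpace => ∑' k, ‖t (A.gen k) - s (A.gen k)‖ ^ 2) (𝓝 s)
      (𝓝 (∑' _ : K, (0 : ℝ))) := by
    refine tendsto_tsum_of_dominated_convergence (bound := fun k => 4 * ‖A.op k‖ ^ 2)
      (A.summable_sq.mul_left 4) (fun k => ?_) (Eventually.of_forall fun t k => ?_)
    · have hc : Continuous fun t : A.MaxSpace => ‖t (A.gen k) - s (A.gen k)‖ ^ 2 := by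
        have : Continuous fun t : A.MaxSpace => t (A.gen k) :=
          (WeakDual.eval_continuous (A.gen k)).comp continuous_subtype_val
        exact (this.sub continuous_const).norm.pow 2
      simpa using hc.tendsto s
    · have h1 := A.norm_char_le t k
      have h2 := A.norm_char_le s k
      have h3 := norm_sub_le (t (A.gen k)) (s (A.gen k))
      rw [Real.norm_of_nonneg (by positivity)]
      have : ‖t (A.gen k) - s (A.gen k)‖ ≤ 2 * ‖A.op k‖ := by linarith
      calc _ ≤ (2 * ‖A.op k‖) ^ 2 := pow_le_pow_left₀ (norm_nonneg _) this 2
        _ = _ := by ring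
  rw [tsum_zero] at h
  have h4 : ∀ t : A.MaxSpace, ‖A.coord t - A.coord s‖
      = Real.sqrt (∑' k, ‖t (A.gen k) - s (A.gen k)‖ ^ 2) := by
    intro t
    have := lp.norm_rpow_eq_tsum (p := 2) (by norm_num) (A.coord t - A.coord s)
    simp only [ENNReal.toReal_ofNat, Real.rpow_two] at this
    rw [← Real.sqrt_sq (norm_nonneg (A.coord t - A.coord s)), this]
    rfl
  simp_rw [h4]
  have h5 := (Real.continuous_sqrt.tendsto 0).comp h
  rw [Real.sqrt_zero] at h5
  exact h5

/-- The joint spectrum `σ(A) ⊆ ℓ²(K)`: the image of the maximal ideal space. -/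
def jointSpectrum (A : NormalFamily K H) : Set (EllTwo K) := Set.range A.coord

/-- The map `t ↦ (t(A_k))_k` as a map onto the joint spectrum. -/
def toSpectrum (A : NormalFamily K H) (t : A.MaxSpace) : A.jointSpectrum :=
  ⟨A.coord t, t, rfl⟩

theorem continuous_toSpectrum (A : NormalFamily K H) : Continuous A.toSpectrum :=
  A.continuous_coord.subtype_mk _

/-- The element `f(A)` of the generated C⋆-algebra with Gelfand transform `f`, as an operator. -/
def contCalc (A : NormalFamily K H) (f : C(A.MaxSpace, ℂ)) : H →L[ℂ] H :=
  ((gelfandStarTransform A.cstar).symm f : A.cstar)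

theorem contCalc_mul_star (A : NormalFamily K H) (f : C(A.MaxSpace, ℂ)) (x : H) :
    inner ℂ x (A.contCalc (star f * f) x) = (‖A.contCalc f x‖ ^ 2 : ℝ) := by
  have : A.contCalc (star f * f) = star (A.contCalc f) * A.contCalc f := by
    simp only [contCalc, map_mul, map_star]; rfl
  rw [this, ContinuousLinearMap.star_eq_adjoint, mul_apply_eq_comp,
    ContinuousLinearMap.adjoint_inner_right, inner_self_eq_norm_sq_to_K]
  push_cast; rfl

/-- A real continuous function as a complex one. -/
def toCplx (A : NormalFamily K H) (f : CompactlySupportedContinuousMap A.MaxSpace ℝ) :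
    C(A.MaxSpace, ℂ) := ⟨fun t => (f t : ℂ), by fun_prop⟩

/-- The positive functional `f ↦ ⟨f(A)x, x⟩` on real continuous functions. -/
def vecFunctional (A : NormalFamily K H) (x : H) :
    CompactlySupportedContinuousMap A.MaxSpace ℝ →ₚ[ℝ] ℝ :=
  PositiveLinearMap.mk₀
    { toFun := fun f => (inner ℂ x (A.contCalc (A.toCplx f) x)).re
      map_add' := fun f g => by
        have : A.toCplx (f + g) = A.toCplx f + A.toCplx g := by ext; simp [toCplx]
        simp [this, contCalc, map_add]
      map_smul' := fun c f => by
        have : A.toCplx (c • f) = (c : ℂ) • A.toCplx f := by ext; simp [toCplx]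
        simp [this, contCalc, map_smul] }
    (fun f hf => by
      let g : C(A.MaxSpace, ℂ) := ⟨fun t => (Real.sqrt (f t) : ℂ), by fun_prop⟩
      have : A.toCplx f = star g * g := by
        ext t
        have ht : 0 ≤ f t := hf t
        simp only [toCplx, ContinuousMap.coe_mk, ContinuousMap.mul_apply, ContinuousMap.star_apply,
          g, RCLike.star_def, Complex.conj_ofReal]
        rw [← Complex.ofReal_mul, Real.mul_self_sqrt ht]
      simp only [LinearMap.coe_mk, AddHom.coe_mk, this, contCalc_mul_star, Complex.ofReal_re]
      positivity)

/-- The measure on the maximal ideal space with `∫ f dμ_x = ⟨f(A)x, x⟩` for continuous `f`. -/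
def vecMeasureMax (A : NormalFamily K H) (x : H) : Measure A.MaxSpace :=
  RealRMK.rieszMeasure (A.vecFunctional x)

instance (A : NormalFamily K H) (x : H) : IsFiniteMeasure (A.vecMeasureMax x) := by
  unfold vecMeasureMax; infer_instance

instance (A : NormalFamily K H) (x : H) : (A.vecMeasureMax x).Regular := by
  unfold vecMeasureMax; infer_instance

/-- The scalar spectral measure `μ_x = ⟨E_A(·)x, x⟩` on the joint spectrum. -/
def vecMeasure (A : NormalFamily K H) (x : H) : Measure A.jointSpectrum :=
  (A.vecMeasureMax x).map A.toSpectrum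

theorem integral_vecMeasureMax (A : NormalFamily K H) (f : C(A.MaxSpace, ℂ)) (x : H) :
    ∫ t, f t ∂(A.vecMeasureMax x) = inner ℂ x (A.contCalc f x) := by
  have key : ∀ g : C(A.MaxSpace, ℝ), ∫ t, (g t : ℂ) ∂(A.vecMeasureMax x)
      = inner ℂ x (A.contCalc ⟨fun t => (g t : ℂ), by fun_prop⟩ x) := by
    intro g
    let g' : CompactlySupportedContinuousMap A.MaxSpace ℝ :=
      ⟨g, HasCompactSupport.of_compactSpace _⟩
    have h1 : ∫ t, g t ∂(A.vecMeasureMax x) = (inner ℂ x (A.contCalc (A.toCplx g') x)).re :=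
      RealRMK.integral_rieszMeasure (A.vecFunctional x) g'
    rw [integral_complex_ofReal, h1]
    have h2 : star (A.contCalc (A.toCplx g')) = A.contCalc (A.toCplx g') := by
      have : star (A.toCplx g') = A.toCplx g' := by
        ext t; simp [toCplx]
      have h3 : A.contCalc (star (A.toCplx g')) = star (A.contCalc (A.toCplx g')) := by
        simp only [contCalc, map_star]; rfl
      rw [← h3, this]
    rw [ContinuousLinearMap.star_eq_adjoint] at h2
    have h4 : (starRingEnd ℂ) (inner ℂ x (A.contCalc (A.toCplx g') x))
        = inner ℂ x (A.contCalc (A.toCplx g') x) := by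
      rw [inner_conj_symm, ← ContinuousLinearMap.adjoint_inner_right, h2]
    exact Complex.conj_eq_iff_re.mp h4
  have hint : ∀ g : C(A.MaxSpace, ℂ), Integrable g (A.vecMeasureMax x) := fun g =>
    g.continuous.integrable_of_hasCompactSupport (HasCompactSupport.of_compactSpace _)
  let fr : C(A.MaxSpace, ℝ) := ⟨fun t => (f t).re, by fun_prop⟩
  let fi : C(A.MaxSpace, ℝ) := ⟨fun t => (f t).im, by fun_prop⟩
  let cr : C(A.MaxSpace, ℂ) := ⟨fun t => (fr t : ℂ), by fun_prop⟩
  let ci : C(A.MaxSpace, ℂ) := ⟨fun t => (fi t : ℂ), by fun_prop⟩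
  have hf : f = cr + Complex.I • ci := by
    ext t
    simp only [ContinuousMap.add_apply, ContinuousMap.smul_apply, cr, ci, fr, fi,
      ContinuousMap.coe_mk, smul_eq_mul]
    rw [mul_comm, Complex.re_add_im]
  have h1 : A.contCalc f = A.contCalc cr + Complex.I • A.contCalc ci := by
    rw [hf]; simp [contCalc, map_add, map_smul]
  rw [h1]
  have h2 : ∀ t, f t = cr t + Complex.I * ci t := fun t => by
    conv_lhs => rw [hf]
    rfl
  simp_rw [h2]
  rw [integral_add (hint cr) ((hint ci).const_mul _), integral_const_mul]
  rw [show ∫ t, cr t ∂(A.vecMeasureMax x) = _ from key fr,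
    show ∫ t, ci t ∂(A.vecMeasureMax x) = _ from key fi]
  rw [add_apply, smul_apply, inner_add_right, inner_smul_right]

theorem vecMeasureMax_univ (A : NormalFamily K H) (x : H) :
    (A.vecMeasureMax x).real Set.univ = ‖x‖ ^ 2 := by
  have h := A.integral_vecMeasureMax 1 x
  have h1 : A.contCalc 1 = 1 := by simp [contCalc]
  rw [h1] at h
  simp only [ContinuousMap.one_apply, integral_const, one_apply_eq_self,
    inner_self_eq_norm_sq_to_K] at h
  rw [Complex.real_smul, mul_one] at h
  have h2 : (((A.vecMeasureMax x).real Set.univ : ℝ) : ℂ) = ((‖x‖ ^ 2 : ℝ) : ℂ) := by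
    rw [h]; push_cast; rfl
  exact Complex.ofReal_injective h2

/-- Linear relations between the quadratic forms of all operators pass to `x ↦ ∫ f dμ_x`. -/
theorem linearCombination_eq_zero (A : NormalFamily K H) {f : A.MaxSpace → ℂ}
    (hf : ∀ x, Integrable f (A.vecMeasureMax x)) (l : H →₀ ℂ)
    (hl : ∀ T : H →L[ℂ] H, Finsupp.linearCombination ℂ (fun z => inner ℂ z (T z)) l = 0) :
    Finsupp.linearCombination ℂ (fun z => ∫ t, f t ∂(A.vecMeasureMax z)) l = 0 := by
  let ν : Measure A.MaxSpace := ∑ z ∈ l.support, A.vecMeasureMax z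
  have hle : ∀ z ∈ l.support, A.vecMeasureMax z ≤ ν := fun z hz =>
    Finset.single_le_sum (f := fun z => A.vecMeasureMax z) (fun _ _ => Measure.zero_le _) hz
  have hν : Integrable f ν := integrable_finsetSum_measure.mpr fun z _ => hf z
  have hreg : ν.Regular := by
    have : ∀ z, (A.vecMeasureMax z).InnerRegular := fun z => inferInstance
    have : IsFiniteMeasure ν := by unfold ν; infer_instance
    have : ν.InnerRegular := by unfold ν; infer_instance
    infer_instance
  set C : ℝ := ∑ z ∈ l.support, ‖l z‖ with hC
  have hC0 : 0 ≤ C := Finset.sum_nonneg fun _ _ => norm_nonneg _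
  rw [← norm_eq_zero]
  refine le_antisymm (le_of_forall_pos_le_add fun ε hε => ?_) (norm_nonneg _)
  obtain ⟨g, -, hg, hgc, hgi⟩ := hν.exists_hasCompactSupport_integral_sub_le
    (ε := ε / (C + 1)) (by positivity)
  have h0 := hl (A.contCalc ⟨g, hgc⟩)
  simp_rw [← integral_vecMeasureMax] at h0
  rw [zero_add, ← sub_zero (Finsupp.linearCombination ℂ _ l), ← h0,
    Finsupp.linearCombination_apply, Finsupp.linearCombination_apply, Finsupp.sum, Finsupp.sum,
    ← Finset.sum_sub_distrib]
  calc _ ≤ ∑ z ∈ l.support, ‖l z‖ * (ε / (C + 1)) := by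
        refine norm_sum_le_of_le _ fun z hz => ?_
        rw [← smul_sub, norm_smul]
        refine mul_le_mul_of_nonneg_left ?_ (norm_nonneg _)
        have hgz : Integrable g (A.vecMeasureMax z) := hgi.mono_measure (hle z hz)
        simp only [ContinuousMap.coe_mk]
        rw [← integral_sub (hf z) hgz]
        refine (norm_integral_le_integral_norm _).trans (le_trans ?_ hg)
        exact integral_mono_measure (hle z hz) (Eventually.of_forall fun _ => norm_nonneg _)
          (hν.sub hgi).norm
    _ = C * (ε / (C + 1)) := by rw [← Finset.sum_mul]
    _ ≤ ε := by
        rw [mul_div_assoc', div_le_iff₀ (by positivity)]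
        nlinarith

/-- Polarization as a formal combination of vectors. -/
def pol (y x : H) : H →₀ ℂ :=
  Finsupp.single (y + x) (1 / 4) - Finsupp.single (y - x) (1 / 4)
    - Finsupp.single (y + Complex.I • x) (Complex.I / 4)
    + Finsupp.single (y - Complex.I • x) (Complex.I / 4)

theorem linearCombination_pol (T : H →L[ℂ] H) (y x : H) :
    Finsupp.linearCombination ℂ (fun z => inner ℂ z (T z)) (pol y x) = inner ℂ y (T x) := by
  simp only [pol, map_add, map_sub, Finsupp.linearCombination_single, map_smul, inner_add_left,
    inner_add_right, inner_sub_left, inner_sub_right, inner_smul_left, inner_smul_right,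
    smul_eq_mul, Complex.conj_I]
  ring_nf
  simp only [Complex.I_sq]
  ring

/-- Bounded Borel functions of the family exist as operators. -/
theorem exists_borelCalc (A : NormalFamily K H) {f : A.jointSpectrum → ℂ} (hf : Measurable f)
    {C : ℝ} (hC : ∀ l, ‖f l‖ ≤ C) :
    ∃ T : H →L[ℂ] H, ∀ x, inner ℂ x (T x) = ∫ l, f l ∂(A.vecMeasure x) := by
  have hmeas : Measurable A.toSpectrum := A.continuous_toSpectrum.measurable
  let g : A.MaxSpace → ℂ := fun t => f (A.toSpectrum t)
  have hg : Measurable g := hf.comp hmeas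
  have hgi : ∀ x, Integrable g (A.vecMeasureMax x) := fun x =>
    Integrable.of_bound hg.aestronglyMeasurable C (Eventually.of_forall fun t => hC _)
  let q : H → ℂ := fun x => ∫ t, g t ∂(A.vecMeasureMax x)
  have hq : ∀ x, ∫ l, f l ∂(A.vecMeasure x) = q x := fun x =>
    integral_map hmeas.aemeasurable hf.aestronglyMeasurable
  have hqb : ∀ x, ‖q x‖ ≤ C * ‖x‖ ^ 2 := fun x => by
    rw [← A.vecMeasureMax_univ x]
    exact norm_integral_le_of_norm_le_const (Eventually.of_forall fun t => hC _)
  let S : H → H → ℂ := fun y x => Finsupp.linearCombination ℂ q (pol y x)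
  have hrel := fun l hl => A.linearCombination_eq_zero hgi l hl
  have hSadd1 : ∀ y₁ y₂ x, S (y₁ + y₂) x = S y₁ x + S y₂ x := fun y₁ y₂ x => by
    have := hrel (pol (y₁ + y₂) x - (pol y₁ x + pol y₂ x)) fun T => by
      rw [map_sub, map_add]; simp only [linearCombination_pol, inner_add_left, sub_self]
    rwa [map_sub, map_add, sub_eq_zero] at this
  have hSadd2 : ∀ y x₁ x₂, S y (x₁ + x₂) = S y x₁ + S y x₂ := fun y x₁ x₂ => by
    have := hrel (pol y (x₁ + x₂) - (pol y x₁ + pol y x₂)) fun T => by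
      rw [map_sub, map_add]; simp only [linearCombination_pol, map_add, inner_add_right, sub_self]
    rwa [map_sub, map_add, sub_eq_zero] at this
  have hSsmul1 : ∀ (c : ℂ) y x, S (c • y) x = starRingEnd ℂ c • S y x := fun c y x => by
    have := hrel (pol (c • y) x - starRingEnd ℂ c • pol y x) fun T => by
      rw [map_sub, map_smul]
      simp only [linearCombination_pol, inner_smul_left, smul_eq_mul, sub_self]
    rwa [map_sub, map_smul, sub_eq_zero] at this
  have hSsmul2 : ∀ (c : ℂ) y x, S y (c • x) = c • S y x := fun c y x => by
    have := hrel (pol y (c • x) - c • pol y x) fun T => by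
      rw [map_sub, map_smul]
      simp only [linearCombination_pol, map_smul, inner_smul_right, smul_eq_mul, sub_self]
    rwa [map_sub, map_smul, sub_eq_zero] at this
  have hSdiag : ∀ x, S x x = q x := fun x => by
    have := hrel (pol x x - Finsupp.single x 1) fun T => by
      rw [map_sub, linearCombination_pol, Finsupp.linearCombination_single, one_smul, sub_self]
    rwa [map_sub, Finsupp.linearCombination_single, one_smul, sub_eq_zero] at this
  have hunit : ∀ y x, ‖y‖ = 1 → ‖x‖ = 1 → ‖S y x‖ ≤ 4 * |C| := fun y x hy hx => by
    have hb : ∀ z : H, ‖z‖ ≤ 2 → ‖q z‖ ≤ 4 * |C| := fun z hz => by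
      refine (hqb z).trans ?_
      have h1 : ‖z‖ ^ 2 ≤ 4 := by nlinarith [norm_nonneg z]
      nlinarith [le_abs_self C, abs_nonneg C, sq_nonneg ‖z‖]
    have hI : ‖Complex.I • x‖ = 1 := by rw [norm_smul, Complex.norm_I, hx, one_mul]
    have b1 := hb (y + x) ((norm_add_le _ _).trans (by linarith))
    have b2 := hb (y - x) ((norm_sub_le _ _).trans (by linarith))
    have b3 := hb (y + Complex.I • x) ((norm_add_le _ _).trans (by linarith))
    have b4 := hb (y - Complex.I • x) ((norm_sub_le _ _).trans (by linarith))
    have e : S y x = (1 / 4 : ℂ) * q (y + x) - (1 / 4 : ℂ) * q (y - x)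
        - (Complex.I / 4) * q (y + Complex.I • x) + (Complex.I / 4) * q (y - Complex.I • x) := by
      simp only [S, pol, map_add, map_sub, Finsupp.linearCombination_single, smul_eq_mul]
    rw [e]
    refine (norm_add_le _ _).trans ?_
    refine (add_le_add_left ((norm_sub_le _ _).trans
      (add_le_add_left (norm_sub_le _ _) _)) _).trans ?_
    have n1 : ‖(1 / 4 : ℂ)‖ = 1 / 4 := by norm_num
    have n2 : ‖(Complex.I / 4 : ℂ)‖ = 1 / 4 := by
      rw [norm_div, Complex.norm_I]; norm_num
    simp only [norm_mul, n1, n2]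
    linarith
  have hbound : ∀ y x, ‖S y x‖ ≤ 4 * |C| * ‖y‖ * ‖x‖ := fun y x => by
    rcases eq_or_ne y 0 with rfl | hy
    · have := hSsmul1 0 0 x
      rw [zero_smul, map_zero, zero_smul] at this
      simp [this]
    rcases eq_or_ne x 0 with rfl | hx
    · have := hSsmul2 0 y 0
      rw [zero_smul, zero_smul] at this
      simp [this]
    have hy0 : ‖y‖ ≠ 0 := norm_ne_zero_iff.mpr hy
    have hx0 : ‖x‖ ≠ 0 := norm_ne_zero_iff.mpr hx
    have hn : ∀ z : H, ‖z‖ ≠ 0 → ‖(((‖z‖)⁻¹ : ℝ) : ℂ) • z‖ = 1 := fun z hz => by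
      rw [norm_smul, Complex.norm_real, norm_inv, norm_norm, inv_mul_cancel₀ hz]
    have h1 := hunit _ _ (hn y hy0) (hn x hx0)
    rw [hSsmul1, hSsmul2, norm_smul, norm_smul, Complex.conj_ofReal, Complex.norm_real,
      Complex.norm_real, norm_inv, norm_inv, norm_norm, norm_norm] at h1
    have hy1 := norm_pos_iff.mpr hy
    have hx1 := norm_pos_iff.mpr hx
    have h2 : ‖S y x‖ = ‖y‖ * ‖x‖ * (‖y‖⁻¹ * (‖x‖⁻¹ * ‖S y x‖)) := by field_simp
    rw [h2]
    nlinarith [mul_le_mul_of_nonneg_left h1 (mul_pos hy1 hx1).le]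
  let B : H →L⋆[ℂ] H →L[ℂ] ℂ :=
    (LinearMap.mk₂'ₛₗ (starRingEnd ℂ) (RingHom.id ℂ) S hSadd1 hSsmul1 hSadd2 hSsmul2).mkContinuous₂
      (4 * |C|) hbound
  refine ⟨ContinuousLinearMap.adjoint (InnerProductSpace.continuousLinearMapOfBilin B), fun x => ?_⟩
  rw [ContinuousLinearMap.adjoint_inner_right,
    InnerProductSpace.continuousLinearMapOfBilin_apply, hq x, ← hSdiag x]
  rfl

open Classical in
/-- The operator `f(A)` for a bounded Borel function `f` on the joint spectrum: the unique
bounded operator with `⟨f(A)x, x⟩ = ∫ f dμ_x` for all `x`. -/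
def borelCalc (A : NormalFamily K H) (f : A.jointSpectrum → ℂ) : H →L[ℂ] H :=
  if h : ∃ T : H →L[ℂ] H, ∀ x, inner ℂ x (T x) = ∫ l, f l ∂(A.vecMeasure x) then h.choose else 0

theorem inner_borelCalc (A : NormalFamily K H) {f : A.jointSpectrum → ℂ} (hf : Measurable f)
    {C : ℝ} (hC : ∀ l, ‖f l‖ ≤ C) (x : H) :
    inner ℂ x (A.borelCalc f x) = ∫ l, f l ∂(A.vecMeasure x) := by
  have h := A.exists_borelCalc hf hC
  rw [borelCalc, dif_pos h]
  exact h.choose_spec x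

theorem borelCalc_eq (A : NormalFamily K H) {f : A.jointSpectrum → ℂ} {T : H →L[ℂ] H}
    (hT : ∀ x, inner ℂ x (T x) = ∫ l, f l ∂(A.vecMeasure x)) : A.borelCalc f = T := by
  have h : ∃ T : H →L[ℂ] H, ∀ x, inner ℂ x (T x) = ∫ l, f l ∂(A.vecMeasure x) := ⟨T, hT⟩
  rw [borelCalc, dif_pos h]
  refine ContinuousLinearMap.coe_injective ((ext_inner_map _ _).mp fun x => ?_)
  have := (h.choose_spec x).trans (hT x).symm
  have h2 := congrArg (starRingEnd ℂ) this
  rwa [inner_conj_symm, inner_conj_symm] at h2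

/-- The spectral measure `E_A` of the family: `E_A(S) = 1_S(A)` for Borel `S ⊆ σ(A)`. -/
def spectralProj (A : NormalFamily K H) (S : Set A.jointSpectrum) : H →L[ℂ] H :=
  A.borelCalc (S.indicator fun _ => 1)

/-- `dim D ≤ r`: for some `C` and every `ε > 0`, the set `D` has a countable
cover by pairwise disjoint Borel sets `β₀, β₁, …` of diameter less than `ε` with
`(∑ₙ (diam βₙ)^r)^(1/r) ≤ C`. -/
def DimLE {M : Type*} [PseudoEMetricSpace M] [MeasurableSpace M] (D : Set M) (r : ℝ) : Prop :=
  ∃ C : ℝ≥0, ∀ ε : ℝ≥0∞, 0 < ε → ∃ β : ℕ → Set M,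
    (∀ n, MeasurableSet (β n)) ∧ Pairwise (Function.onFun Disjoint β) ∧ D ⊆ ⋃ n, β n ∧
    (∀ n, Metric.ediam (β n) < ε) ∧ (∑' n, Metric.ediam (β n) ^ r) ^ (1 / r) ≤ C

/-- `ess-dim A ≤ r`: some Borel subset `D` of `σ(A)` has `E_A(σ(A) \ D) = 0` and `dim D ≤ r`. -/
def EssDimLE (A : NormalFamily K H) (r : ℝ) : Prop :=
  ∃ D : Set A.jointSpectrum, MeasurableSet D ∧ A.spectralProj Dᶜ = 0 ∧ DimLE D r

end NormalFamily

/-- An orthonormal basis of `H`. -/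
def stdBasis (H : Type u) [NormedAddCommGroup H] [InnerProductSpace ℂ H] [CompleteSpace H] :
    HilbertBasis (exists_hilbertBasis ℂ H).choose ℂ H :=
  (exists_hilbertBasis ℂ H).choose_spec.choose

/-- The Hilbert–Schmidt norm `(∑ᵢ ‖X eᵢ‖²)^(1/2)`, with value `∞` when `X` is not
Hilbert–Schmidt. -/
def hsNorm {H : Type u} [NormedAddCommGroup H] [InnerProductSpace ℂ H] [CompleteSpace H]
    (X : H →L[ℂ] H) : ℝ≥0∞ :=
  (∑' i, ‖X (stdBasis H i)‖ₑ ^ 2) ^ (1 / 2 : ℝ)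

theorem tsum_enorm_sq_basis {H : Type u} [NormedAddCommGroup H] [InnerProductSpace ℂ H]
    {ι : Type*} (b : HilbertBasis ι ℂ H) (x : H) :
    ∑' i, ‖(inner ℂ (b i) x : ℂ)‖ₑ ^ 2 = ‖x‖ₑ ^ 2 := by
  have h := (b.hasSum_inner_mul_inner x x).mapL Complex.reCLM
  have h1 : HasSum (fun i => ‖(inner ℂ (b i) x : ℂ)‖ ^ 2) (‖x‖ ^ 2) := by
    have e : ∀ i, Complex.reCLM (inner ℂ x (b i) * inner ℂ (b i) x)
        = ‖(inner ℂ (b i) x : ℂ)‖ ^ 2 := fun i => by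
      rw [← inner_conj_symm x (b i), ← Complex.normSq_eq_conj_mul_self, Complex.reCLM_apply,
        Complex.ofReal_re, Complex.normSq_eq_norm_sq]
    have e2 : Complex.reCLM (inner ℂ x x) = ‖x‖ ^ 2 := (norm_sq_eq_re_inner (𝕜 := ℂ) x).symm
    simp_rw [e, e2] at h
    exact h
  have h2 := ENNReal.ofReal_tsum_of_nonneg (fun i => by positivity) h1.summable
  rw [h1.tsum_eq] at h2
  simpa [ENNReal.ofReal_pow] using h2.symm

theorem tsum_enorm_sq_adjoint {H : Type u} [NormedAddCommGroup H] [InnerProductSpace ℂ H]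
    [CompleteSpace H] {ι₁ ι₂ : Type*} (b : HilbertBasis ι₁ ℂ H) (c : HilbertBasis ι₂ ℂ H)
    (Y : H →L[ℂ] H) :
    ∑' i, ‖Y (b i)‖ₑ ^ 2 = ∑' j, ‖ContinuousLinearMap.adjoint Y (c j)‖ₑ ^ 2 := by
  simp_rw [← tsum_enorm_sq_basis c (Y _),
    ← tsum_enorm_sq_basis b (ContinuousLinearMap.adjoint Y _)]
  rw [ENNReal.tsum_comm]
  refine tsum_congr fun j => tsum_congr fun i => ?_
  rw [ContinuousLinearMap.adjoint_inner_right, ← inner_conj_symm, RCLike.enorm_conj]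

/-- The Hilbert–Schmidt norm may be computed in any orthonormal basis. -/
theorem hsNorm_eq {H : Type u} [NormedAddCommGroup H] [InnerProductSpace ℂ H] [CompleteSpace H]
    {ι : Type*} (b : HilbertBasis ι ℂ H) (X : H →L[ℂ] H) :
    hsNorm X = (∑' i, ‖X (b i)‖ₑ ^ 2) ^ (1 / 2 : ℝ) := by
  rw [hsNorm, tsum_enorm_sq_adjoint (stdBasis H) b, ← tsum_enorm_sq_adjoint b b]

/-- The multiplication operator `X ↦ ∑ⱼ Bⱼ X Aⱼ`, the series converging in operator norm. -/
def multOp {H : Type u} [NormedAddCommGroup H] [InnerProductSpace ℂ H] {J : Type*}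
    (B A : J → H →L[ℂ] H) (X : H →L[ℂ] H) : H →L[ℂ] H :=
  ∑' j, B j ∘L X ∘L A j

/-- The supremum norm of a function, with value `∞` for unbounded functions. -/
def supNorm {M : Type*} (f : M → ℂ) : ℝ≥0∞ := ⨆ x, ‖f x‖ₑ

/-- The norm of the space `Lip₁` of bounded Lipschitz functions: supremum norm plus the least
Lipschitz constant, with value `∞` outside `Lip₁`. -/
def lipNorm {M : Type*} [PseudoEMetricSpace M] (f : M → ℂ) : ℝ≥0∞ :=
  supNorm f + ⨆ x, ⨆ y, edist (f x) (f y) / edist x y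

end

/-!
# Hilbert–Schmidt norms of multiplication operators

Decompose `H` into cyclic subspaces for each of the two families. A cyclic subspace of `A` is
`L²(μ_x)`, one of `B` is `L²(ν_y)`, and on them the functional calculus acts by multiplication, so
that the block of `∑ⱼ gⱼ(B) X fⱼ(A)` is obtained from the block `R : L²(μ_x) → L²(ν_y)` of `X` by the
multiplier `R ↦ ∑ⱼ gⱼ R fⱼ` (`cyclicBlock_multOp`). The square of the Hilbert–Schmidt norm is the sum
over the blocks, and a block is Hilbert–Schmidt exactly when it has a kernel in `L²(μ_x × ν_y)`. Write
`S` and `U` for the symbols `∑ⱼ fⱼ(x) gⱼ(y)` and `∑ⱼ uⱼ(x) vⱼ(y)`. A multiplier multiplies kernels by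
its symbol, but `R` itself need not have a kernel. What has to be shown is that if `|S| ≤ |U|` and
the image of `R` under the multiplier of `U` has a kernel `k`, then the image under that of `S` has
a kernel `k'` with `‖k'‖ ≤ ‖k‖` (`ProjSymbol.exists_hasKernel_mult`).

On a rectangle where `|U|` is bounded away from zero, the multiplier of `U` is injective: partition
the rectangle into pieces on which the symbol hardly varies, where the multiplier is a perturbation
of a nonzero scalar (`ProjSymbol.mulL_ind_apply_eq_zero`). Hence there `S.mult R` is the operator
with kernel `(S / U) k`. The dimension enters in order to exclude a contribution from the zeros
of `U`. Take finitely many disjoint cells `βₙ` of small diameters `rₙ` with `∑ rₙ²` bounded, the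
normalized indicators `eₙ`, and the projection `P = ∑ |eₙ⟩⟨eₙ|`. The kernel of `R P` is a finite sum of
tensors, and `S.mult (R P)` has the kernel `∑ₙ S · (eₙ ⊗ R eₙ)` with orthogonal terms. In the `n`-th
term, consider separately the `y` for which `U` becomes small on `βₙ × {y}`, where `S` is small at one
point and by the Lipschitz condition of size `rₙ` on all of `βₙ × {y}`, and the other `y`, where
`S.mult R` has the kernel `(S / U) k`. Replacing `S(x, y)` by its value at a fixed `x` in the cell costs
another `O(rₙ)` in operator norm, by the row-column estimate (`ProjSymbol.norm_mult_apply_le`).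
Since `∑ rₙ²` is bounded, so are the kernels of `S.mult (R P)` in `L²`
(`ProjSymbol.norm_sq_mulL_eval_sum_le`). As the cells shrink, `P` tends strongly to the identity,
and a weak limit `k'` of the kernels is a kernel of `S.mult R`. Like each of the kernels, it
vanishes where `U`, and therefore `S`, vanishes; from `U k' = S k` it follows that `|k'| ≤ |k|`.

The first part is the case of the symbol `∑ₖ xₖ yₖ` and its complex conjugate, which have the same
modulus and are both Lipschitz, so that the inequality holds in both directions.
-/

noncomputable section

/-! ### Multiplication operators on `L²` -/

/-- Bounded measurable complex functions. -/
def BddMeas {α : Type*} [MeasurableSpace α] (f : α → ℂ) : Prop :=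
  Measurable f ∧ ∃ C : ℝ, ∀ x, ‖f x‖ ≤ C

namespace BddMeas

variable {α β : Type*} [MeasurableSpace α] [MeasurableSpace β] {f g : α → ℂ}

theorem mul (hf : BddMeas f) (hg : BddMeas g) : BddMeas fun x => f x * g x := by
  obtain ⟨hf, C, hC⟩ := hf
  obtain ⟨hg, D, hD⟩ := hg
  refine ⟨hf.mul hg, C * D, fun x => ?_⟩
  rw [norm_mul]
  exact mul_le_mul (hC x) (hD x) (norm_nonneg _) ((norm_nonneg _).trans (hC x))

theorem sub (hf : BddMeas f) (hg : BddMeas g) : BddMeas fun x => f x - g x := by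
  obtain ⟨hf, C, hC⟩ := hf
  obtain ⟨hg, D, hD⟩ := hg
  exact ⟨hf.sub hg, C + D, fun x => (norm_sub_le _ _).trans (add_le_add (hC x) (hD x))⟩

theorem conj (hf : BddMeas f) : BddMeas fun x => starRingEnd ℂ (f x) := by
  obtain ⟨hf, C, hC⟩ := hf
  exact ⟨Complex.continuous_conj.measurable.comp hf, C, fun x => by simpa using hC x⟩

theorem const (c : ℂ) : BddMeas fun _ : α => c := ⟨measurable_const, ‖c‖, fun _ => le_rfl⟩

theorem comp (hf : BddMeas f) {φ : β → α} (hφ : Measurable φ) : BddMeas fun x => f (φ x) := by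
  obtain ⟨hf, C, hC⟩ := hf
  exact ⟨hf.comp hφ, C, fun x => hC _⟩

end BddMeas

/-- The indicator of a set as a complex function. -/
def ind {α : Type*} (s : Set α) : α → ℂ := s.indicator fun _ => 1

section ind

variable {α : Type*} {s t : Set α} {x : α}

theorem ind_of_mem (h : x ∈ s) : ind s x = 1 := Set.indicator_of_mem h _

theorem ind_of_notMem (h : x ∉ s) : ind s x = 0 := Set.indicator_of_notMem h _

theorem norm_ind_le (s : Set α) (x : α) : ‖ind s x‖ ≤ 1 := by
  by_cases h : x ∈ s <;> simp [ind, h]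

theorem conj_ind (s : Set α) (x : α) : starRingEnd ℂ (ind s x) = ind s x := by
  by_cases h : x ∈ s <;> simp [ind, h]

theorem ind_mul_self (s : Set α) (x : α) : ind s x * ind s x = ind s x := by
  by_cases h : x ∈ s <;> simp [ind, h]

theorem ind_add_ind_compl (s : Set α) (x : α) : ind s x + ind sᶜ x = 1 := by
  by_cases h : x ∈ s <;> simp [ind, h]

theorem bddMeas_ind [MeasurableSpace α] (hs : MeasurableSet s) : BddMeas (ind s) :=
  ⟨measurable_const.indicator hs, 1, norm_ind_le s⟩

end ind

section mulL

variable {α : Type*} [MeasurableSpace α] {μ : Measure α}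

theorem BddMeas.memLp_mul {f : α → ℂ} (hf : BddMeas f) (p : Lp ℂ 2 μ) :
    MemLp (fun x => f x * p x) 2 μ := by
  obtain ⟨hf, C, hC⟩ := hf
  exact MemLp.of_le_mul (Lp.memLp p) (hf.aestronglyMeasurable.mul (Lp.aestronglyMeasurable p))
    (Eventually.of_forall fun x => by
      rw [norm_mul]; exact mul_le_mul_of_nonneg_right (hC x) (norm_nonneg _))

open Classical in
/-- Multiplication by `f` on `L²(μ)`; it is `0` unless `f` is bounded and measurable. -/
def mulL (f : α → ℂ) : Lp ℂ 2 μ →L[ℂ] Lp ℂ 2 μ :=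
  if hf : BddMeas f then
    LinearMap.mkContinuous
      { toFun := fun p => (hf.memLp_mul p).toLp
        map_add' := fun p q => by
          rw [← MemLp.toLp_add]
          refine MemLp.toLp_congr _ _ ?_
          filter_upwards [Lp.coeFn_add p q] with x hx
          simp only [hx, Pi.add_apply, mul_add]
        map_smul' := fun c p => by
          rw [RingHom.id_apply, ← MemLp.toLp_const_smul]
          refine MemLp.toLp_congr _ _ ?_
          filter_upwards [Lp.coeFn_smul c p] with x hx
          simp only [hx, Pi.smul_apply, smul_eq_mul]
          ring }
      hf.2.choose
      (fun p => by
        refine Lp.norm_le_mul_norm_of_ae_le_mul ?_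
        filter_upwards [(hf.memLp_mul p).coeFn_toLp] with x hx
        simp only [LinearMap.coe_mk, AddHom.coe_mk, hx, norm_mul]
        exact mul_le_mul_of_nonneg_right (hf.2.choose_spec x) (norm_nonneg _))
  else 0

theorem coeFn_mulL {f : α → ℂ} (hf : BddMeas f) (p : Lp ℂ 2 μ) :
    mulL f p =ᵐ[μ] fun x => f x * p x := by
  rw [mulL, dif_pos hf]
  exact (hf.memLp_mul p).coeFn_toLp

theorem norm_mulL_apply_le_of_forall {f : α → ℂ} (hf : Measurable f) {C : ℝ}
    (hC : ∀ x, ‖f x‖ ≤ C) (p : Lp ℂ 2 μ) : ‖mulL f p‖ ≤ C * ‖p‖ := by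
  refine Lp.norm_le_mul_norm_of_ae_le_mul ?_
  filter_upwards [coeFn_mulL ⟨hf, C, hC⟩ p] with x hx
  rw [hx, norm_mul]
  exact mul_le_mul_of_nonneg_right (hC x) (norm_nonneg _)

theorem norm_mulL_le {f : α → ℂ} (hf : Measurable f) {C : ℝ} (hC0 : 0 ≤ C)
    (hC : ∀ x, ‖f x‖ ≤ C) : ‖(mulL f : Lp ℂ 2 μ →L[ℂ] Lp ℂ 2 μ)‖ ≤ C :=
  ContinuousLinearMap.opNorm_le_bound _ hC0 (norm_mulL_apply_le_of_forall hf hC)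

theorem norm_mulL_ind_apply_le {s : Set α} (hs : MeasurableSet s) (p : Lp ℂ 2 μ) :
    ‖mulL (ind s) p‖ ≤ ‖p‖ := by
  simpa using norm_mulL_apply_le_of_forall (bddMeas_ind hs).1 (norm_ind_le s) p

theorem mulL_mulL {f g : α → ℂ} (hf : BddMeas f) (hg : BddMeas g) (p : Lp ℂ 2 μ) :
    mulL f (mulL g p) = mulL (fun x => f x * g x) p := by
  refine Lp.ext ?_
  filter_upwards [coeFn_mulL hf (mulL g p), coeFn_mulL hg p, coeFn_mulL (hf.mul hg) p]
    with x h1 h2 h3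
  rw [h1, h2, h3, mul_assoc]

theorem mulL_comm {f g : α → ℂ} (hf : BddMeas f) (hg : BddMeas g) (p : Lp ℂ 2 μ) :
    mulL f (mulL g p) = mulL g (mulL f p) := by
  rw [mulL_mulL hf hg, mulL_mulL hg hf]
  simp_rw [mul_comm]

theorem mulL_sub {f g : α → ℂ} (hf : BddMeas f) (hg : BddMeas g) (p : Lp ℂ 2 μ) :
    mulL (fun x => f x - g x) p = mulL f p - mulL g p := by
  refine Lp.ext ?_
  filter_upwards [coeFn_mulL (hf.sub hg) p, coeFn_mulL hf p, coeFn_mulL hg p,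
    Lp.coeFn_sub (mulL f p) (mulL g p)] with x h1 h2 h3 h4
  rw [h1, h4, Pi.sub_apply, h2, h3, sub_mul]

theorem mulL_const (c : ℂ) (p : Lp ℂ 2 μ) : mulL (fun _ => c) p = c • p := by
  refine Lp.ext ?_
  filter_upwards [coeFn_mulL (BddMeas.const c) p, Lp.coeFn_smul c p] with x h1 h2
  rw [h1, h2, Pi.smul_apply, smul_eq_mul]

theorem mulL_ind_add_compl {s : Set α} (hs : MeasurableSet s) (p : Lp ℂ 2 μ) :
    mulL (ind s) p + mulL (ind sᶜ) p = p := by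
  refine Lp.ext ?_
  filter_upwards [coeFn_mulL (bddMeas_ind hs) p, coeFn_mulL (bddMeas_ind hs.compl) p,
    Lp.coeFn_add (mulL (ind s) p) (mulL (ind sᶜ) p)] with x h1 h2 h3
  rw [h3, Pi.add_apply, h1, h2, ← add_mul, ind_add_ind_compl, one_mul]

theorem inner_mulL_right {f : α → ℂ} (hf : BddMeas f) (p q : Lp ℂ 2 μ) :
    inner ℂ q (mulL f p) = inner ℂ (mulL (fun x => starRingEnd ℂ (f x)) q) p := by
  rw [L2.inner_def, L2.inner_def]
  refine integral_congr_ae ?_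
  filter_upwards [coeFn_mulL hf p, coeFn_mulL hf.conj q] with x h1 h2
  rw [h1, h2]
  simp only [RCLike.inner_apply, map_mul, Complex.conj_conj]
  ring

theorem inner_mulL_left {f : α → ℂ} (hf : BddMeas f) (p q : Lp ℂ 2 μ) :
    inner ℂ (mulL f q) p = inner ℂ q (mulL (fun x => starRingEnd ℂ (f x)) p) := by
  rw [inner_mulL_right hf.conj]
  simp

/-- `L²` norms computed by integrating the square. -/
theorem norm_sq_eq_integral (p : Lp ℂ 2 μ) : ‖p‖ ^ 2 = ∫ x, ‖p x‖ ^ 2 ∂μ := by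
  have h := inner_self_eq_norm_sq_to_K (𝕜 := ℂ) p
  rw [L2.inner_def] at h
  have h2 : ∀ x, inner ℂ (p x) (p x) = ((‖p x‖ ^ 2 : ℝ) : ℂ) := fun x => by
    rw [inner_self_eq_norm_sq_to_K]; push_cast; rfl
  simp_rw [h2] at h
  rw [integral_complex_ofReal] at h
  have h3 : ((∫ x, ‖p x‖ ^ 2 ∂μ : ℝ) : ℂ) = ((‖p‖ ^ 2 : ℝ) : ℂ) := by
    rw [h]; push_cast; rfl
  exact (Complex.ofReal_injective h3).symm

theorem integrable_norm_sq (p : Lp ℂ 2 μ) : Integrable (fun x => ‖p x‖ ^ 2) μ :=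
  (memLp_two_iff_integrable_sq_norm (Lp.aestronglyMeasurable p)).mp (Lp.memLp p)

/-- If `∑ⱼ |aⱼ|² ≤ C²` pointwise, then `∑ⱼ ‖aⱼ p‖² ≤ C² ‖p‖²`. -/
theorem sum_norm_sq_mulL_le {J : Type*} (F : Finset J) {a : J → α → ℂ}
    (ha : ∀ j, BddMeas (a j)) {C : ℝ} (p : Lp ℂ 2 μ)
    (hC : ∀ᵐ x ∂μ, p x ≠ 0 → ∑ j ∈ F, ‖a j x‖ ^ 2 ≤ C ^ 2) :
    ∑ j ∈ F, ‖mulL (a j) p‖ ^ 2 ≤ C ^ 2 * ‖p‖ ^ 2 := by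
  simp_rw [norm_sq_eq_integral]
  rw [← integral_finsetSum _ fun j _ => integrable_norm_sq _, ← integral_const_mul]
  refine integral_mono_ae (integrable_finsetSum _ fun j _ => integrable_norm_sq _)
    ((integrable_norm_sq p).const_mul _) ?_
  have h : ∀ᵐ x ∂μ, ∀ j ∈ F, mulL (a j) p x = a j x * p x :=
    (ae_ball_iff F.countable_toSet).mpr fun j _ => coeFn_mulL (ha j) p
  filter_upwards [h, hC] with x hx hCx
  rw [Finset.sum_congr rfl fun j hj => by rw [hx j hj, norm_mul, mul_pow], ← Finset.sum_mul]
  by_cases hp : p x = 0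
  · simp [hp]
  · exact mul_le_mul_of_nonneg_right (hCx hp) (by positivity)

end mulL

/-! ### Kernels of operators between `L²` spaces -/

section tens

variable {α β : Type*} [MeasurableSpace α] [MeasurableSpace β] {μ : Measure α} {ν : Measure β}
  [IsFiniteMeasure μ] [IsFiniteMeasure ν]

theorem memLp_tens (p : Lp ℂ 2 μ) (q : Lp ℂ 2 ν) :
    MemLp (fun z : α × β => starRingEnd ℂ (p z.1) * q z.2) 2 (μ.prod ν) := by
  have hm : AEStronglyMeasurable (fun z : α × β => starRingEnd ℂ (p z.1) * q z.2) (μ.prod ν) :=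
    (Complex.continuous_conj.comp_aestronglyMeasurable (Lp.aestronglyMeasurable p).comp_fst).mul
      (Lp.aestronglyMeasurable q).comp_snd
  rw [memLp_two_iff_integrable_sq_norm hm]
  simp_rw [norm_mul, mul_pow, RCLike.norm_conj]
  exact (integrable_norm_sq p).mul_prod (integrable_norm_sq q)

/-- The elementary tensor `(x, y) ↦ conj (p x) * q y`. -/
def tens (p : Lp ℂ 2 μ) (q : Lp ℂ 2 ν) : Lp ℂ 2 (μ.prod ν) := (memLp_tens p q).toLp

theorem coeFn_tens (p : Lp ℂ 2 μ) (q : Lp ℂ 2 ν) :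
    tens p q =ᵐ[μ.prod ν] fun z => starRingEnd ℂ (p z.1) * q z.2 :=
  (memLp_tens p q).coeFn_toLp

theorem ae_fst {P : α → Prop} (h : ∀ᵐ x ∂μ, P x) : ∀ᵐ z ∂(μ.prod ν), P z.1 :=
  Measure.quasiMeasurePreserving_fst.ae h

theorem ae_snd {P : β → Prop} (h : ∀ᵐ y ∂ν, P y) : ∀ᵐ z ∂(μ.prod ν), P z.2 :=
  Measure.quasiMeasurePreserving_snd.ae h

theorem inner_tens_tens (p p' : Lp ℂ 2 μ) (q q' : Lp ℂ 2 ν) :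
    inner ℂ (tens p q) (tens p' q') = inner ℂ p' p * inner ℂ q q' := by
  rw [L2.inner_def, L2.inner_def, L2.inner_def, ← integral_prod_mul]
  refine integral_congr_ae ?_
  filter_upwards [coeFn_tens p q, coeFn_tens p' q'] with z h1 h2
  rw [h1, h2]
  simp only [RCLike.inner_apply, map_mul, Complex.conj_conj]
  ring

theorem norm_tens (p : Lp ℂ 2 μ) (q : Lp ℂ 2 ν) : ‖tens p q‖ = ‖p‖ * ‖q‖ := by
  have h := inner_tens_tens p p q q
  simp only [inner_self_eq_norm_sq_to_K] at h
  have h2 : ‖tens p q‖ ^ 2 = (‖p‖ * ‖q‖) ^ 2 := by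
    rw [mul_pow]; exact_mod_cast h
  exact (pow_left_inj₀ (norm_nonneg _) (by positivity) two_ne_zero).mp h2

theorem tens_add_left (p p' : Lp ℂ 2 μ) (q : Lp ℂ 2 ν) :
    tens (p + p') q = tens p q + tens p' q := by
  refine Lp.ext ?_
  filter_upwards [coeFn_tens (p + p') q, coeFn_tens p q, coeFn_tens p' q,
    Lp.coeFn_add (tens p q) (tens p' q), ae_fst (ν := ν) (Lp.coeFn_add p p')] with z h1 h2 h3 h4 h5
  rw [h1, h4, Pi.add_apply, h2, h3, h5, Pi.add_apply, map_add, add_mul]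

theorem tens_add_right (p : Lp ℂ 2 μ) (q q' : Lp ℂ 2 ν) :
    tens p (q + q') = tens p q + tens p q' := by
  refine Lp.ext ?_
  filter_upwards [coeFn_tens p (q + q'), coeFn_tens p q, coeFn_tens p q',
    Lp.coeFn_add (tens p q) (tens p q'), ae_snd (μ := μ) (Lp.coeFn_add q q')] with z h1 h2 h3 h4 h5
  rw [h1, h4, Pi.add_apply, h2, h3, h5, Pi.add_apply, mul_add]

theorem tens_smul_left (c : ℂ) (p : Lp ℂ 2 μ) (q : Lp ℂ 2 ν) :
    tens (c • p) q = starRingEnd ℂ c • tens p q := by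
  refine Lp.ext ?_
  filter_upwards [coeFn_tens (c • p) q, coeFn_tens p q,
    Lp.coeFn_smul (starRingEnd ℂ c) (tens p q), ae_fst (ν := ν) (Lp.coeFn_smul c p)]
    with z h1 h2 h3 h4
  rw [h1, h3, Pi.smul_apply, h2, h4, Pi.smul_apply, smul_eq_mul, smul_eq_mul, map_mul, mul_assoc]

theorem tens_smul_right (c : ℂ) (p : Lp ℂ 2 μ) (q : Lp ℂ 2 ν) :
    tens p (c • q) = c • tens p q := by
  refine Lp.ext ?_
  filter_upwards [coeFn_tens p (c • q), coeFn_tens p q,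
    Lp.coeFn_smul c (tens p q), ae_snd (μ := μ) (Lp.coeFn_smul c q)] with z h1 h2 h3 h4
  rw [h1, h3, Pi.smul_apply, h2, h4, Pi.smul_apply, smul_eq_mul, smul_eq_mul]
  ring

/-- `tens p q` as a bounded linear map of `q`. -/
def tensL (p : Lp ℂ 2 μ) : Lp ℂ 2 ν →L[ℂ] Lp ℂ 2 (μ.prod ν) :=
  LinearMap.mkContinuous
    { toFun := fun q => tens p q
      map_add' := fun q q' => tens_add_right p q q'
      map_smul' := fun c q => tens_smul_right c p q } ‖p‖ fun q => (norm_tens p q).le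

@[simp]
theorem tensL_apply (p : Lp ℂ 2 μ) (q : Lp ℂ 2 ν) : tensL p q = tens p q := rfl

/-- `k ∈ L²(μ × ν)` is the kernel of `T : L²(μ) → L²(ν)`, that is, `T p (y) = ∫ k(x, y) p(x) dμ(x)`
in the weak sense: the identity is tested on elementary tensors. Inner products are conjugate
linear in the first variable, which is why `tens p q` conjugates `p`. -/
def HasKernel (T : Lp ℂ 2 μ →L[ℂ] Lp ℂ 2 ν) (k : Lp ℂ 2 (μ.prod ν)) : Prop :=
  ∀ p q, inner ℂ q (T p) = inner ℂ (tens p q) k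

/-- Every square-integrable function is the kernel of a bounded operator. -/
theorem exists_hasKernel (k : Lp ℂ 2 (μ.prod ν)) :
    ∃ T : Lp ℂ 2 μ →L[ℂ] Lp ℂ 2 ν, HasKernel T k := by
  have key : ∀ p q, inner ℂ q (ContinuousLinearMap.adjoint (tensL (ν := ν) p) k)
      = inner ℂ (tens p q) k := fun p q => by
    rw [ContinuousLinearMap.adjoint_inner_right, tensL_apply]
  refine ⟨LinearMap.mkContinuous
    { toFun := fun p => ContinuousLinearMap.adjoint (tensL (ν := ν) p) k
      map_add' := fun p p' => ext_inner_left ℂ fun q => by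
        rw [inner_add_right, key, key, key, tens_add_left, inner_add_left]
      map_smul' := fun c p => ext_inner_left ℂ fun q => by
        rw [RingHom.id_apply, inner_smul_right, key, key, tens_smul_left, inner_smul_left,
          Complex.conj_conj] } ‖k‖ (fun p => ?_), key⟩
  refine ((ContinuousLinearMap.adjoint (tensL (ν := ν) p)).le_opNorm k).trans ?_
  rw [mul_comm]
  refine mul_le_mul_of_nonneg_left ?_ (norm_nonneg _)
  rw [LinearIsometryEquiv.norm_map]
  refine ContinuousLinearMap.opNorm_le_bound _ (norm_nonneg _) fun q => ?_
  rw [tensL_apply, norm_tens]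

theorem inner_indicatorConstLp_prod {s : Set α} {t : Set β} (hs : MeasurableSet s)
    (ht : MeasurableSet t) (k : Lp ℂ 2 (μ.prod ν)) :
    inner ℂ (tens (indicatorConstLp 2 hs (measure_ne_top μ s) 1)
      (indicatorConstLp 2 ht (measure_ne_top ν t) 1)) k = ∫ z in s ×ˢ t, k z ∂(μ.prod ν) := by
  rw [← L2.inner_indicatorConstLp_one (𝕜 := ℂ) (hs.prod ht) (measure_ne_top _ _)]
  congr 1
  refine Lp.ext ?_
  filter_upwards [coeFn_tens (indicatorConstLp 2 hs (measure_ne_top μ s) (1 : ℂ))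
    (indicatorConstLp 2 ht (measure_ne_top ν t) (1 : ℂ)),
    ae_fst (ν := ν) (indicatorConstLp_coeFn (p := 2) (hs := hs) (hμs := measure_ne_top μ s)
      (c := (1 : ℂ))),
    ae_snd (μ := μ) (indicatorConstLp_coeFn (p := 2) (hs := ht) (hμs := measure_ne_top ν t)
      (c := (1 : ℂ))),
    indicatorConstLp_coeFn (p := 2) (hs := hs.prod ht) (hμs := measure_ne_top (μ.prod ν) _)
      (c := (1 : ℂ))] with z h1 h2 h3 h4
  rw [h1, h2, h3, h4]
  by_cases hz1 : z.1 ∈ s <;> by_cases hz2 : z.2 ∈ t <;> simp [Set.indicator, hz1, hz2]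

/-- Elementary tensors are total in `L²(μ × ν)`. -/
theorem eq_zero_of_inner_tens {k : Lp ℂ 2 (μ.prod ν)}
    (hk : ∀ (p : Lp ℂ 2 μ) (q : Lp ℂ 2 ν), inner ℂ (tens p q) k = 0) : k = 0 := by
  have hint : Integrable k (μ.prod ν) :=
    (Lp.memLp k).integrable (by norm_num)
  have h : ∀ s : Set (α × β), MeasurableSet s → ∫ z in s, k z ∂(μ.prod ν) = 0 := by
    intro s hs
    induction s, hs using MeasurableSpace.induction_on_inter generateFrom_prod.symm
      isPiSystem_prod with
    | empty => simp
    | basic s hs =>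
      obtain ⟨a, ha, b, hb, rfl⟩ := hs
      rw [← inner_indicatorConstLp_prod ha hb, hk]
    | compl s hs ih =>
      have huniv : ∫ z, k z ∂(μ.prod ν) = 0 := by
        have := inner_indicatorConstLp_prod MeasurableSet.univ MeasurableSet.univ k
        rw [hk, Set.univ_prod_univ, setIntegral_univ] at this
        exact this.symm
      rw [setIntegral_compl hs hint, ih, huniv, sub_zero]
    | iUnion f hd hm ih =>
      rw [integral_iUnion hm hd hint.integrableOn]
      simp [ih]
  refine Lp.ext ?_
  refine (Lp.ae_eq_zero_of_forall_setIntegral_eq_zero k two_ne_zero (by norm_num)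
    (fun s _ _ => hint.integrableOn) fun s hs _ => h s hs).trans (Lp.coeFn_zero _ _ _).symm

theorem HasKernel.unique {T : Lp ℂ 2 μ →L[ℂ] Lp ℂ 2 ν} {k k' : Lp ℂ 2 (μ.prod ν)}
    (h : HasKernel T k) (h' : HasKernel T k') : k = k' := by
  rw [← sub_eq_zero]
  refine eq_zero_of_inner_tens fun p q => ?_
  rw [inner_sub_right, ← h p q, ← h' p q, sub_self]

theorem HasKernel.sub {T T' : Lp ℂ 2 μ →L[ℂ] Lp ℂ 2 ν} {k k' : Lp ℂ 2 (μ.prod ν)}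
    (h : HasKernel T k) (h' : HasKernel T' k') : HasKernel (T - T') (k - k') := fun p q => by
  rw [sub_apply, inner_sub_right, inner_sub_right, h, h']

theorem HasKernel.eq_zero {T : Lp ℂ 2 μ →L[ℂ] Lp ℂ 2 ν} (h : HasKernel T 0) : T = 0 :=
  ContinuousLinearMap.ext fun p => ext_inner_left ℂ fun q => by rw [h]; simp

theorem tens_mulL {f : α → ℂ} {g : β → ℂ} (hf : BddMeas f) (hg : BddMeas g) (p : Lp ℂ 2 μ)
    (q : Lp ℂ 2 ν) : tens (mulL f p) (mulL g q)
      = mulL (fun z : α × β => starRingEnd ℂ (f z.1) * g z.2) (tens p q) := by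
  refine Lp.ext ?_
  filter_upwards [coeFn_tens (mulL f p) (mulL g q), coeFn_tens p q,
    coeFn_mulL ((hf.conj.comp measurable_fst).mul (hg.comp measurable_snd)) (tens p q),
    ae_fst (ν := ν) (coeFn_mulL hf p), ae_snd (μ := μ) (coeFn_mulL hg q)] with z h1 h2 h3 h4 h5
  rw [h1, h3, h2, h4, h5, map_mul]
  ring

/-- Multiplying an operator on both sides multiplies its kernel. -/
theorem HasKernel.mulL_comp {T : Lp ℂ 2 μ →L[ℂ] Lp ℂ 2 ν} {k : Lp ℂ 2 (μ.prod ν)}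
    (h : HasKernel T k) {f : α → ℂ} {g : β → ℂ} (hf : BddMeas f) (hg : BddMeas g) :
    HasKernel (mulL g ∘L T ∘L mulL f) (mulL (fun z : α × β => f z.1 * g z.2) k) := fun p q => by
  rw [ContinuousLinearMap.comp_apply, ContinuousLinearMap.comp_apply, inner_mulL_right hg, h,
    tens_mulL hf hg.conj, inner_mulL_left ((hf.conj.comp measurable_fst).mul
      (hg.conj.comp measurable_snd))]
  simp

theorem HasKernel.norm_apply_le {T : Lp ℂ 2 μ →L[ℂ] Lp ℂ 2 ν} {k : Lp ℂ 2 (μ.prod ν)}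
    (h : HasKernel T k) (p : Lp ℂ 2 μ) : ‖T p‖ ≤ ‖k‖ * ‖p‖ := by
  rcases eq_or_ne (T p) 0 with h0 | h0
  · rw [h0, norm_zero]; positivity
  have h1 : ‖T p‖ ^ 2 ≤ ‖p‖ * ‖T p‖ * ‖k‖ := by
    have h2 := norm_inner_le_norm (𝕜 := ℂ) (tens p (T p)) k
    rw [← h, inner_self_eq_norm_sq_to_K, norm_tens, norm_pow, RCLike.norm_ofReal,
      abs_norm] at h2
    exact h2
  have h3 := norm_pos_iff.mpr h0
  nlinarith

end tens
end

noncomputable section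

/-! ### Symbols and their multipliers -/

section sandwich

variable {E F : Type*} [NormedAddCommGroup E] [NormedSpace ℂ E] [NormedAddCommGroup F]
  [NormedSpace ℂ F]

/-- The map `X ↦ G X T` on operators, as a bounded linear map. -/
def sandwich (G : F →L[ℂ] F) (T : E →L[ℂ] E) : (E →L[ℂ] F) →L[ℂ] (E →L[ℂ] F) :=
  LinearMap.mkContinuous
    { toFun := fun X => G ∘L X ∘L T
      map_add' := fun X Y => by ext; simp
      map_smul' := fun c X => by ext; simp } (‖G‖ * ‖T‖) fun X => by
    refine (ContinuousLinearMap.opNorm_comp_le _ _).trans ?_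
    rw [mul_assoc, mul_comm ‖T‖]
    exact mul_le_mul_of_nonneg_left (ContinuousLinearMap.opNorm_comp_le _ _) (norm_nonneg _)

@[simp]
theorem sandwich_apply (G : F →L[ℂ] F) (T : E →L[ℂ] E) (X : E →L[ℂ] F) :
    sandwich G T X = G ∘L X ∘L T := rfl

theorem norm_sandwich_le (G : F →L[ℂ] F) (T : E →L[ℂ] E) : ‖sandwich G T‖ ≤ ‖G‖ * ‖T‖ :=
  LinearMap.mkContinuous_norm_le _ (by positivity) _

theorem hasSum_clm_apply {J : Type*} {T : J → E →L[ℂ] F} {L : E →L[ℂ] F} (h : HasSum T L)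
    (x : E) : HasSum (fun j => T j x) (L x) :=
  h.mapL (ContinuousLinearMap.apply ℂ F x)

theorem hasSum_sandwich [CompleteSpace F] {J : Type*} {G : J → F →L[ℂ] F} {T : J → E →L[ℂ] E}
    {c : J → ℝ} (hc : Summable c) (hle : ∀ j, ‖sandwich (G j) (T j)‖ ≤ c j) (R : E →L[ℂ] F) :
    HasSum (fun j => G j ∘L R ∘L T j) ((∑' j, sandwich (G j) (T j)) R) :=
  hasSum_clm_apply (Summable.of_norm_bounded hc hle).hasSum R

end sandwich

/-- A series dominated by a summable family has a measurable sum, for any index type. -/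
theorem measurable_tsum_of_le {J α : Type*} [MeasurableSpace α] {F : J → α → ℂ}
    (hF : ∀ j, Measurable (F j)) {c : J → ℝ} (hc : Summable c) (hle : ∀ j x, ‖F j x‖ ≤ c j) :
    Measurable fun x => ∑' j, F j x := by
  have hcount := hc.countable_support
  have : Countable (Function.support c) := hcount.to_subtype
  have h : (fun x => ∑' j, F j x) = fun x => ∑' j : Function.support c, F j x := by
    funext x
    refine (tsum_subtype_eq_of_support_subset (f := fun j => F j x) fun j hj => ?_).symm
    intro h0
    have := hle j x
    rw [h0] at this
    exact hj (norm_le_zero_iff.mp this)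
  rw [h]
  exact Measurable.tsum fun j => hF j

theorem norm_sub_sum_le_of_summable {J E : Type*} [NormedAddCommGroup E] [CompleteSpace E]
    {F : J → E} {c : J → ℝ} (hc : Summable c) (hle : ∀ j, ‖F j‖ ≤ c j) (s : Finset J) :
    ‖∑' j, F j - ∑ j ∈ s, F j‖ ≤ ∑' j, c j - ∑ j ∈ s, c j := by
  have hF : Summable F := Summable.of_norm_bounded hc hle
  rw [← hF.sum_add_tsum_compl (s := s), ← hc.sum_add_tsum_compl (s := s), add_sub_cancel_left,
    add_sub_cancel_left]
  exact tsum_of_norm_bounded (hc.subtype _).hasSum fun j => hle j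

/-- A dominated series of multipliers converges strongly to the multiplier of the sum. -/
theorem hasSum_mulL {J α : Type*} [MeasurableSpace α] {μ : Measure α} {F : J → α → ℂ}
    (hF : ∀ j, Measurable (F j)) {c : J → ℝ} (hc : Summable c) (hle : ∀ j x, ‖F j x‖ ≤ c j)
    (p : Lp ℂ 2 μ) : HasSum (fun j => mulL (F j) p) (mulL (fun x => ∑' j, F j x) p) := by
  have hbE : BddMeas fun x => ∑' j, F j x :=
    ⟨measurable_tsum_of_le hF hc hle, ∑' j, c j, fun x =>
      tsum_of_norm_bounded hc.hasSum fun j => hle j x⟩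
  have hbF : ∀ j, BddMeas (F j) := fun j => ⟨hF j, c j, hle j⟩
  have hbS : ∀ s : Finset J, BddMeas fun x => ∑ j ∈ s, F j x := fun s =>
    ⟨Finset.measurable_sum _ fun j _ => hF j, ∑ j ∈ s, c j, fun x =>
      norm_sum_le_of_le _ fun j _ => hle j x⟩
  have hsum : ∀ s : Finset J, ∑ j ∈ s, mulL (F j) p = mulL (fun x => ∑ j ∈ s, F j x) p := by
    intro s
    refine Lp.ext ?_
    have h : ∀ᵐ x ∂μ, ∀ j ∈ s, mulL (F j) p x = F j x * p x :=
      (ae_ball_iff s.countable_toSet).mpr fun j _ => coeFn_mulL (hbF j) p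
    filter_upwards [h, coeFn_mulL (hbS s) p, Lp.coeFn_finsetSum s fun j => mulL (F j) p]
      with x h1 h2 h3
    rw [h2, h3, Finset.sum_apply, Finset.sum_congr rfl h1, Finset.sum_mul]
  rw [HasSum, SummationFilter.unconditional_filter, tendsto_iff_norm_sub_tendsto_zero]
  have h0 : Tendsto (fun s : Finset J => (∑' j, c j - ∑ j ∈ s, c j) * ‖p‖) atTop (𝓝 0) := by
    have := hc.hasSum
    rw [HasSum, SummationFilter.unconditional_filter] at this
    simpa using (this.const_sub (∑' j, c j)).mul_const ‖p‖
  refine squeeze_zero (fun _ => norm_nonneg _) (fun s => ?_) h0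
  rw [hsum, norm_sub_rev, ← mulL_sub hbE (hbS s)]
  exact norm_mulL_apply_le_of_forall (hbE.sub (hbS s)).1
    (fun x => norm_sub_sum_le_of_summable hc (fun j => hle j x) s) p

/-- Terms of a function `∑ⱼ leftⱼ(x) rightⱼ(y)` whose supremum norms `blⱼ`, `brⱼ` satisfy
`∑ⱼ blⱼ brⱼ < ∞`. -/
structure ProjSymbol (J α β : Type*) [MeasurableSpace α] [MeasurableSpace β] where
  /-- the factors in the first variable -/
  left : J → α → ℂ
  /-- the factors in the second variable -/
  right : J → β → ℂ
  /-- bounds for the factors in the first variable -/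
  bl : J → ℝ
  /-- bounds for the factors in the second variable -/
  br : J → ℝ
  bl_nonneg : ∀ j, 0 ≤ bl j
  br_nonneg : ∀ j, 0 ≤ br j
  measurable_left : ∀ j, Measurable (left j)
  measurable_right : ∀ j, Measurable (right j)
  norm_left_le : ∀ j x, ‖left j x‖ ≤ bl j
  norm_right_le : ∀ j y, ‖right j y‖ ≤ br j
  summable : Summable fun j => bl j * br j

namespace ProjSymbol

variable {J J' α β : Type*} [MeasurableSpace α] [MeasurableSpace β] (S : ProjSymbol J α β)

theorem bddMeas_left (j : J) : BddMeas (S.left j) :=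
  ⟨S.measurable_left j, S.bl j, S.norm_left_le j⟩

theorem bddMeas_right (j : J) : BddMeas (S.right j) :=
  ⟨S.measurable_right j, S.br j, S.norm_right_le j⟩

/-- The symbol with the variables exchanged. -/
def swap : ProjSymbol J β α where
  left := S.right
  right := S.left
  bl := S.br
  br := S.bl
  bl_nonneg := S.br_nonneg
  br_nonneg := S.bl_nonneg
  measurable_left := S.measurable_right
  measurable_right := S.measurable_left
  norm_left_le := S.norm_right_le
  norm_right_le := S.norm_left_le
  summable := by simpa only [mul_comm] using S.summable

/-- The function `(x, y) ↦ ∑ⱼ leftⱼ(x) rightⱼ(y)`. -/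
def eval (z : α × β) : ℂ := ∑' j, S.left j z.1 * S.right j z.2

theorem norm_term_le (j : J) (z : α × β) : ‖S.left j z.1 * S.right j z.2‖ ≤ S.bl j * S.br j := by
  rw [norm_mul]
  exact mul_le_mul (S.norm_left_le j _) (S.norm_right_le j _) (norm_nonneg _) (S.bl_nonneg j)

theorem hasSum_eval (z : α × β) : HasSum (fun j => S.left j z.1 * S.right j z.2) (S.eval z) :=
  (Summable.of_norm_bounded S.summable fun j => S.norm_term_le j z).hasSum

theorem measurable_term (j : J) : Measurable fun z : α × β => S.left j z.1 * S.right j z.2 :=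
  ((S.measurable_left j).comp measurable_fst).mul ((S.measurable_right j).comp measurable_snd)

theorem bddMeas_eval : BddMeas S.eval :=
  ⟨measurable_tsum_of_le S.measurable_term S.summable S.norm_term_le, ∑' j, S.bl j * S.br j,
    fun z => tsum_of_norm_bounded S.summable.hasSum fun j => S.norm_term_le j z⟩

/-- A countable measurable partition of `α` on whose cells the symbol oscillates by at most `η` in
the first variable, uniformly in the second and in the sense of the projective norm. -/
theorem exists_partition {η : ℝ} (hη : 0 < η) :
    ∃ π : α → ℕ, Measurable π ∧ ∃ w : J → ℝ, (∀ j, 0 ≤ w j) ∧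
      (∀ x x', π x = π x' → ∀ j, ‖S.left j x - S.left j x'‖ ≤ w j) ∧
      Summable (fun j => w j * S.br j) ∧ ∑' j, w j * S.br j ≤ η := by
  classical
  have ht := S.summable.hasSum
  rw [HasSum, SummationFilter.unconditional_filter] at ht
  obtain ⟨F, hF⟩ := (ht.eventually
    (lt_mem_nhds (show ∑' j, S.bl j * S.br j - η / 4 < ∑' j, S.bl j * S.br j by linarith))).exists
  set b : ℝ := ∑ j ∈ F, S.br j with hb
  have hb0 : 0 ≤ b := Finset.sum_nonneg fun j _ => S.br_nonneg j
  set s : ℝ := η / (4 * (b + 1)) with hs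
  have hs0 : 0 < s := by positivity
  let cell : α → F → ℤ × ℤ := fun x j => (⌊(S.left j x).re / s⌋, ⌊(S.left j x).im / s⌋)
  obtain ⟨enc, henc⟩ := exists_injective_nat (F → ℤ × ℤ)
  have hcell : Measurable cell := by
    refine measurable_pi_iff.mpr fun j => Measurable.prodMk ?_ ?_
    · exact Int.measurable_floor.comp
        ((Complex.measurable_re.comp (S.measurable_left j)).div_const s)
    · exact Int.measurable_floor.comp
        ((Complex.measurable_im.comp (S.measurable_left j)).div_const s)
  refine ⟨fun x => enc (cell x), (measurable_of_countable enc).comp hcell,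
    fun j => if j ∈ F then 2 * s else 2 * S.bl j, fun j => ?_, fun x x' hx j => ?_, ?_⟩
  · have := S.bl_nonneg j
    dsimp only; split_ifs <;> positivity
  · have hfl : ∀ a a' : ℝ, ⌊a / s⌋ = ⌊a' / s⌋ → |a - a'| ≤ s := fun a a' h => by
      have := Int.abs_sub_lt_one_of_floor_eq_floor h
      rw [← sub_div, abs_div, abs_of_pos hs0, div_lt_one hs0] at this
      exact this.le
    dsimp only
    split_ifs with hj
    · have h1 := congrFun (henc hx) ⟨j, hj⟩
      have h2 := hfl _ _ (congrArg Prod.fst h1)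
      have h3 := hfl _ _ (congrArg Prod.snd h1)
      have h4 := Complex.norm_le_abs_re_add_abs_im (S.left j x - S.left j x')
      rw [Complex.sub_re, Complex.sub_im] at h4
      linarith
    · have := norm_sub_le (S.left j x) (S.left j x')
      have h2 := S.norm_left_le j x
      have h3 := S.norm_left_le j x'
      linarith
  · have h2 : Summable fun j => 2 * (S.bl j * S.br j) := S.summable.mul_left 2
    let g : J → ℝ := fun j => if j ∈ F then (2 * s - 2 * S.bl j) * S.br j else 0
    have hg : HasSum g (∑ j ∈ F, (2 * s - 2 * S.bl j) * S.br j) := by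
      rw [← Finset.sum_congr rfl fun j hj => show g j = _ from if_pos hj]
      exact hasSum_sum_of_ne_finset_zero fun j hj => if_neg hj
    have hsplit : ∀ j, (if j ∈ F then 2 * s else 2 * S.bl j) * S.br j
        = g j + 2 * (S.bl j * S.br j) := fun j => by
      simp only [g]; split_ifs <;> ring
    simp_rw [hsplit]
    have hsum := hg.add h2.hasSum
    refine ⟨hsum.summable, ?_⟩
    rw [hsum.tsum_eq, tsum_mul_left]
    have e : ∑ j ∈ F, (2 * s - 2 * S.bl j) * S.br j = 2 * s * b - 2 * ∑ j ∈ F, S.bl j * S.br j := by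
      rw [hb, Finset.mul_sum, Finset.mul_sum, ← Finset.sum_sub_distrib]
      exact Finset.sum_congr rfl fun j _ => by ring
    have e2 : 2 * s * b ≤ η / 2 := by
      have : s * (b + 1) = η / 4 := by rw [hs]; field_simp
      nlinarith
    rw [e]
    linarith

theorem norm_eval_sub_eval_le {w : J → ℝ} {x x' : α} (hw : ∀ j, ‖S.left j x - S.left j x'‖ ≤ w j)
    (hs : Summable fun j => w j * S.br j) (y : β) :
    ‖S.eval (x, y) - S.eval (x', y)‖ ≤ ∑' j, w j * S.br j := by
  have h := (S.hasSum_eval (x, y)).sub (S.hasSum_eval (x', y))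
  rw [← h.tsum_eq]
  refine tsum_of_norm_bounded hs.hasSum fun j => ?_
  rw [← sub_mul, norm_mul]
  exact mul_le_mul (hw j) (S.norm_right_le j y) (norm_nonneg _) ((norm_nonneg _).trans (hw j))

/-- The set of `y` for which the symbol becomes small somewhere on `s × {y}`, up to a factor `2`
which makes it possible to choose the set measurable. -/
theorem exists_measurableSet_small (s : Set α) {d : ℝ} (hd : 0 < d) :
    ∃ γ : Set β, MeasurableSet γ ∧ (∀ y ∈ γ, ∃ x ∈ s, ‖S.eval (x, y)‖ < d) ∧
      ∀ y ∉ γ, ∀ x ∈ s, d / 2 ≤ ‖S.eval (x, y)‖ := by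
  obtain ⟨π, -, w, -, hw, hs, hle⟩ := S.exists_partition (half_pos hd)
  refine ⟨⋃ (i : ℕ) (h : (s ∩ π ⁻¹' {i}).Nonempty), {y | ‖S.eval (h.some, y)‖ < d}, ?_, ?_, ?_⟩
  · refine MeasurableSet.iUnion fun i => MeasurableSet.iUnion fun h => ?_
    exact measurableSet_lt (S.bddMeas_eval.1.comp measurable_prodMk_left).norm measurable_const
  · intro y hy
    simp only [Set.mem_iUnion, Set.mem_ofPred_eq] at hy
    obtain ⟨i, h, hy⟩ := hy
    exact ⟨h.some, h.some_mem.1, hy⟩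
  · intro y hy x hx
    simp only [Set.mem_iUnion, Set.mem_ofPred_eq, not_exists, not_lt] at hy
    have hne : (s ∩ π ⁻¹' {π x}).Nonempty := ⟨x, hx, rfl⟩
    have h1 := hy _ hne
    have h2 := S.norm_eval_sub_eval_le (hw _ _ hne.some_mem.2) hs y
    have h3 := norm_sub_norm_le (S.eval (hne.some, y)) (S.eval (x, y))
    linarith

section mult

variable {μ : Measure α} {ν : Measure β}

theorem norm_sandwich_term_le (j : J) :
    ‖sandwich (mulL (S.right j) : Lp ℂ 2 ν →L[ℂ] Lp ℂ 2 ν)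
      (mulL (S.left j) : Lp ℂ 2 μ →L[ℂ] Lp ℂ 2 μ)‖ ≤ S.bl j * S.br j := by
  refine (norm_sandwich_le _ _).trans ?_
  rw [mul_comm]
  exact mul_le_mul (norm_mulL_le (S.measurable_left j) (S.bl_nonneg j) (S.norm_left_le j))
    (norm_mulL_le (S.measurable_right j) (S.br_nonneg j) (S.norm_right_le j)) (norm_nonneg _)
    (S.bl_nonneg j)

/-- The multiplier `R ↦ ∑ⱼ rightⱼ R leftⱼ` of the symbol on operators `L²(μ) → L²(ν)`. -/
def mult : (Lp ℂ 2 μ →L[ℂ] Lp ℂ 2 ν) →L[ℂ] (Lp ℂ 2 μ →L[ℂ] Lp ℂ 2 ν) :=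
  ∑' j, sandwich (mulL (S.right j)) (mulL (S.left j))

theorem hasSum_mult (R : Lp ℂ 2 μ →L[ℂ] Lp ℂ 2 ν) :
    HasSum (fun j => mulL (S.right j) ∘L R ∘L mulL (S.left j)) (S.mult R) :=
  hasSum_sandwich (G := fun j => mulL (S.right j)) (T := fun j => mulL (S.left j)) S.summable
    S.norm_sandwich_term_le R

theorem hasSum_mult_apply (R : Lp ℂ 2 μ →L[ℂ] Lp ℂ 2 ν) (p : Lp ℂ 2 μ) :
    HasSum (fun j => mulL (S.right j) (R (mulL (S.left j) p))) (S.mult R p) :=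
  hasSum_clm_apply (S.hasSum_mult R) p

theorem mult_mulL_comp {f : α → ℂ} {g : β → ℂ} (hf : BddMeas f) (hg : BddMeas g)
    (R : Lp ℂ 2 μ →L[ℂ] Lp ℂ 2 ν) :
    S.mult (mulL g ∘L R ∘L mulL f) = mulL g ∘L S.mult R ∘L mulL f := by
  have h := (S.hasSum_mult R).mapL (sandwich (mulL g) (mulL f))
  refine (S.hasSum_mult _).unique (h.congr_fun fun j => ?_)
  ext1 p
  simp only [sandwich_apply, ContinuousLinearMap.comp_apply]
  rw [mulL_comm hg (S.bddMeas_right j), mulL_comm (S.bddMeas_left j) hf]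

theorem mult_comm (S' : ProjSymbol J' α β) (R : Lp ℂ 2 μ →L[ℂ] Lp ℂ 2 ν) :
    S.mult (S'.mult R) = S'.mult (S.mult R) := by
  refine ((S'.hasSum_mult R).mapL S.mult).unique ?_
  simp_rw [S.mult_mulL_comp (S'.bddMeas_left _) (S'.bddMeas_right _)]
  exact S'.hasSum_mult _

/-- The multiplier of a symbol multiplies kernels by the symbol. -/
theorem hasKernel_mult [IsFiniteMeasure μ] [IsFiniteMeasure ν] {T : Lp ℂ 2 μ →L[ℂ] Lp ℂ 2 ν}
    {k : Lp ℂ 2 (μ.prod ν)} (h : HasKernel T k) : HasKernel (S.mult T) (mulL S.eval k) := by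
  intro p q
  have h1 := (S.hasSum_mult_apply T p).mapL (innerSL ℂ q)
  have h2 := (hasSum_mulL S.measurable_term S.summable S.norm_term_le k).mapL
    (innerSL ℂ (tens p q))
  simp only [innerSL_apply_apply] at h1 h2
  refine h1.unique (h2.congr_fun fun j => ?_)
  exact (h.mulL_comp (S.bddMeas_left j) (S.bddMeas_right j) p q)

/-- Multipliers are continuous for dominated strong convergence. -/
theorem tendsto_inner_mult {ι : Type*} {l : Filter ι} {P : ι → Lp ℂ 2 μ →L[ℂ] Lp ℂ 2 μ}
    (hP : ∀ i p, ‖P i p‖ ≤ ‖p‖) (hlim : ∀ p, Tendsto (fun i => P i p) l (𝓝 p))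
    (R : Lp ℂ 2 μ →L[ℂ] Lp ℂ 2 ν) (p : Lp ℂ 2 μ) (q : Lp ℂ 2 ν) :
    Tendsto (fun i => inner ℂ q (S.mult (R ∘L P i) p)) l (𝓝 (inner ℂ q (S.mult R p))) := by
  have h1 : ∀ T : Lp ℂ 2 μ →L[ℂ] Lp ℂ 2 ν, inner ℂ q (S.mult T p)
      = ∑' j, inner ℂ q (mulL (S.right j) (T (mulL (S.left j) p))) := fun T =>
    ((S.hasSum_mult_apply T p).mapL (innerSL ℂ q)).tsum_eq.symm
  simp_rw [h1]
  refine tendsto_tsum_of_dominated_convergence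
    (bound := fun j => ‖q‖ * ‖R‖ * ‖p‖ * (S.bl j * S.br j)) (S.summable.mul_left _) (fun j => ?_)
    (Eventually.of_forall fun i j => ?_)
  · have hc : Continuous fun x => inner ℂ q (mulL (S.right j) (R x)) := by fun_prop
    exact (hc.tendsto _).comp (hlim _)
  · refine (norm_inner_le_norm _ _).trans ?_
    have e1 := norm_mulL_apply_le_of_forall (S.measurable_right j) (S.norm_right_le j)
      ((R ∘L P i) (mulL (S.left j) p))
    have e2 := R.le_opNorm (P i (mulL (S.left j) p))
    have e3 := hP i (mulL (S.left j) p)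
    have e4 := norm_mulL_apply_le_of_forall (S.measurable_left j) (S.norm_left_le j) p
    have e5 : ‖R (P i (mulL (S.left j) p))‖ ≤ ‖R‖ * (S.bl j * ‖p‖) :=
      e2.trans (mul_le_mul_of_nonneg_left (e3.trans e4) (norm_nonneg _))
    calc _ ≤ ‖q‖ * (S.br j * (‖R‖ * (S.bl j * ‖p‖))) :=
          mul_le_mul_of_nonneg_left
            (e1.trans (mul_le_mul_of_nonneg_left e5 (S.br_nonneg j))) (norm_nonneg _)
      _ = _ := by ring

/-- Row-column estimate: `‖(∑ⱼ rⱼ R aⱼ) p‖ ≤ (sup ∑ |aⱼ|²)^½ (sup ∑ |rⱼ|²)^½ ‖R‖ ‖p‖`, where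
the first supremum is over the support of `p`. -/
theorem norm_mult_apply_le {C G : ℝ} (hC0 : 0 ≤ C) (hG0 : 0 ≤ G) (p : Lp ℂ 2 μ)
    (hC : ∀ᵐ x ∂μ, p x ≠ 0 → ∀ F : Finset J, ∑ j ∈ F, ‖S.left j x‖ ^ 2 ≤ C ^ 2)
    (hG : ∀ (F : Finset J) y, ∑ j ∈ F, ‖S.right j y‖ ^ 2 ≤ G ^ 2)
    (R : Lp ℂ 2 μ →L[ℂ] Lp ℂ 2 ν) : ‖S.mult R p‖ ≤ C * G * ‖R‖ * ‖p‖ := by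
  have key : ∀ (q : Lp ℂ 2 ν) (F : Finset J),
      ‖∑ j ∈ F, inner ℂ q (mulL (S.right j) (R (mulL (S.left j) p)))‖
        ≤ C * G * ‖R‖ * ‖p‖ * ‖q‖ := by
    intro q F
    have h1 : ∀ j, ‖(inner ℂ q (mulL (S.right j) (R (mulL (S.left j) p))) : ℂ)‖
        ≤ ‖R‖ * (‖mulL (fun y => starRingEnd ℂ (S.right j y)) q‖ * ‖mulL (S.left j) p‖) :=
      fun j => by
        rw [inner_mulL_right (S.bddMeas_right j)]
        refine (norm_inner_le_norm _ _).trans ?_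
        calc _ ≤ ‖mulL (fun y => starRingEnd ℂ (S.right j y)) q‖ * (‖R‖ * ‖mulL (S.left j) p‖) :=
              mul_le_mul_of_nonneg_left (R.le_opNorm _) (norm_nonneg _)
          _ = _ := by ring
    refine (norm_sum_le_of_le _ fun j _ => h1 j).trans ?_
    rw [← Finset.mul_sum]
    have h2 := Finset.sum_mul_sq_le_sq_mul_sq F
      (fun j => ‖mulL (fun y => starRingEnd ℂ (S.right j y)) q‖) (fun j => ‖mulL (S.left j) p‖)
    have h3 := sum_norm_sq_mulL_le F S.bddMeas_left p (hC.mono fun x hx hp => hx hp F)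
    have h4 := sum_norm_sq_mulL_le (C := G) F (fun j => (S.bddMeas_right j).conj) q
      (Eventually.of_forall fun y _ => by simpa using hG F y)
    have h5 : ∑ j ∈ F, ‖mulL (fun y => starRingEnd ℂ (S.right j y)) q‖ * ‖mulL (S.left j) p‖
        ≤ (G * ‖q‖) * (C * ‖p‖) := by
      refine le_of_sq_le_sq (h2.trans ?_) (by positivity)
      rw [mul_pow, mul_pow, mul_pow]
      exact mul_le_mul h4 h3 (Finset.sum_nonneg fun _ _ => by positivity) (by positivity)
    calc _ ≤ ‖R‖ * ((G * ‖q‖) * (C * ‖p‖)) := mul_le_mul_of_nonneg_left h5 (norm_nonneg _)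
      _ = _ := by ring
  have h : ∀ q : Lp ℂ 2 ν, ‖(inner ℂ q (S.mult R p) : ℂ)‖ ≤ C * G * ‖R‖ * ‖p‖ * ‖q‖ := fun q => by
    have h1 := (S.hasSum_mult_apply R p).mapL (innerSL ℂ q)
    rw [HasSum, SummationFilter.unconditional_filter] at h1
    exact le_of_tendsto' h1.norm (key q)
  have h0 := h (S.mult R p)
  rw [inner_self_eq_norm_sq_to_K, norm_pow, RCLike.norm_ofReal, abs_norm] at h0
  rcases eq_or_ne ‖S.mult R p‖ 0 with hz | hz
  · rw [hz]; positivity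
  · have hpos : 0 < ‖S.mult R p‖ := lt_of_le_of_ne (norm_nonneg _) (Ne.symm hz)
    nlinarith

end mult

end ProjSymbol

end

noncomputable section

/-! ### Operators annihilated by a multiplier -/

section localization

variable {α β : Type*} [MeasurableSpace α] [MeasurableSpace β] {μ : Measure α} {ν : Measure β}

theorem norm_mulL_sub_mulL_le {f g : α → ℂ} (hf : BddMeas f) (hg : BddMeas g) {s : Set α}
    (hs : MeasurableSet s) {w : ℝ} (hw : 0 ≤ w) (hfg : ∀ x ∈ s, ‖f x - g x‖ ≤ w) {q : Lp ℂ 2 μ}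
    (hq : mulL (ind s) q = q) : ‖mulL f q - mulL g q‖ ≤ w * ‖q‖ := by
  rw [← mulL_sub hf hg]
  conv_lhs => rw [← hq]
  rw [mulL_mulL (hf.sub hg) (bddMeas_ind hs)]
  refine norm_mulL_apply_le_of_forall ((hf.sub hg).mul (bddMeas_ind hs)).1 (fun x => ?_) q
  by_cases hx : x ∈ s
  · simpa [ind_of_mem hx] using hfg x hx
  · simpa [ind_of_notMem hx] using hw

theorem inner_eq_zero_of_disjoint {s t : Set α} (hs : MeasurableSet s) (ht : MeasurableSet t)
    (hst : Disjoint s t) {p q : Lp ℂ 2 μ} (hp : mulL (ind s) p = p) (hq : mulL (ind t) q = q) :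
    inner ℂ p q = 0 := by
  have h : mulL (ind s) q = 0 := by
    rw [← hq, mulL_mulL (bddMeas_ind hs) (bddMeas_ind ht), ← zero_smul ℂ q, ← mulL_const]
    congr 1
    congr 1
    funext x
    by_cases hx : x ∈ s
    · rw [ind_of_notMem (Set.disjoint_left.mp hst hx), mul_zero]
    · rw [ind_of_notMem hx, zero_mul]
  rw [← hp, inner_mulL_left (bddMeas_ind hs)]
  simp_rw [conj_ind]
  rw [h, inner_zero_right]

theorem mulL_ind_idem {s : Set α} (hs : MeasurableSet s) (p : Lp ℂ 2 μ) :
    mulL (ind s) (mulL (ind s) p) = mulL (ind s) p := by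
  rw [mulL_mulL (bddMeas_ind hs) (bddMeas_ind hs)]
  simp_rw [ind_mul_self]

theorem ind_mul_ind (s t : Set α) (x : α) : ind s x * ind t x = ind (s ∩ t) x := by
  by_cases h : x ∈ s <;> by_cases h' : x ∈ t <;> simp [ind, h, h']

theorem mulL_ind_inter {s t : Set α} (hs : MeasurableSet s) (ht : MeasurableSet t)
    (p : Lp ℂ 2 μ) : mulL (ind (s ∩ t)) p = mulL (ind s) (mulL (ind t) p) := by
  rw [mulL_mulL (bddMeas_ind hs) (bddMeas_ind ht)]
  simp_rw [ind_mul_ind]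

/-- A function vanishing on each cell of a countable partition vanishes. -/
theorem eq_zero_of_forall_mulL_preimage {π : α → ℕ} (hπ : Measurable π) {q : Lp ℂ 2 μ}
    (h : ∀ i, mulL (ind (π ⁻¹' {i})) q = 0) : q = 0 := by
  have hm : ∀ i, MeasurableSet (π ⁻¹' {i}) := fun i => hπ (measurableSet_singleton i)
  have h1 : ∀ᵐ x ∂μ, ∀ i, ind (π ⁻¹' {i}) x * q x = 0 := ae_all_iff.mpr fun i => by
    have h2 := coeFn_mulL (bddMeas_ind (hm i)) q
    rw [h i] at h2
    filter_upwards [h2, Lp.coeFn_zero ℂ 2 μ] with x hx h0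
    rw [← hx, h0, Pi.zero_apply]
  refine Lp.ext ?_
  filter_upwards [h1, Lp.coeFn_zero ℂ 2 μ] with x hx h0
  rw [h0, Pi.zero_apply, ← hx (π x), ind_of_mem (show x ∈ π ⁻¹' {π x} from rfl), one_mul]

/-- An operator vanishing on functions supported in any cell of a countable partition vanishes. -/
theorem clm_eq_zero_of_forall_mulL_preimage {π : α → ℕ} (hπ : Measurable π)
    {T : Lp ℂ 2 μ →L[ℂ] Lp ℂ 2 ν} (h : ∀ i p, T (mulL (ind (π ⁻¹' {i})) p) = 0) : T = 0 := by
  have h1 : ∀ q, ContinuousLinearMap.adjoint T q = 0 := fun q =>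
    eq_zero_of_forall_mulL_preimage hπ fun i => ext_inner_left ℂ fun p => by
      have hb : BddMeas (ind (π ⁻¹' {i})) := bddMeas_ind (hπ (measurableSet_singleton i))
      rw [inner_mulL_right hb]
      simp_rw [conj_ind]
      rw [ContinuousLinearMap.adjoint_inner_right]
      have := h i p
      rw [show (fun x => ind (π ⁻¹' {i}) x) = ind (π ⁻¹' {i}) from rfl, this, inner_zero_left,
        inner_zero_right]
  refine ContinuousLinearMap.ext fun p => ext_inner_right ℂ fun q => ?_
  rw [← ContinuousLinearMap.adjoint_inner_right, h1]
  simp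

namespace ProjSymbol

variable {J : Type*} (S : ProjSymbol J α β)

/-- On a rectangle where the symbol is close to a nonzero constant in the projective norm, its
multiplier is a small perturbation of a nonzero scalar, hence injective. -/
theorem eq_zero_of_mult_eq_zero {a : Set α} {b : Set β} (ha : MeasurableSet a)
    (hb : MeasurableSet b) {D : Lp ℂ 2 μ →L[ℂ] Lp ℂ 2 ν}
    (hDa : ∀ p, D (mulL (ind a) p) = D p) (hDb : ∀ p, mulL (ind b) (D p) = D p)
    (hD : S.mult D = 0) {x₀ : α} {y₀ : β} {w w' : J → ℝ} (hw0 : ∀ j, 0 ≤ w j)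
    (hw0' : ∀ j, 0 ≤ w' j) (hw : ∀ x ∈ a, ∀ j, ‖S.left j x - S.left j x₀‖ ≤ w j)
    (hw' : ∀ y ∈ b, ∀ j, ‖S.right j y - S.right j y₀‖ ≤ w' j)
    (hs : Summable fun j => w j * S.br j) (hs' : Summable fun j => S.bl j * w' j)
    (hlt : ∑' j, w j * S.br j + ∑' j, S.bl j * w' j < ‖S.eval (x₀, y₀)‖) : D = 0 := by
  have hbound : ∀ p, ‖D p‖ * ‖S.eval (x₀, y₀)‖
      ≤ (∑' j, w j * S.br j + ∑' j, S.bl j * w' j) * (‖D‖ * ‖p‖) := by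
    intro p
    have h1 := ((S.hasSum_eval (x₀, y₀)).smul_const (D p)).sub (S.hasSum_mult_apply D p)
    rw [hD, zero_apply, sub_zero] at h1
    rw [mul_comm, ← norm_smul, ← h1.tsum_eq]
    refine tsum_of_norm_bounded ((hs.hasSum.add hs'.hasSum).mul_right (‖D‖ * ‖p‖)) fun j => ?_
    have e : (S.left j x₀ * S.right j y₀) • D p - mulL (S.right j) (D (mulL (S.left j) p))
        = S.left j x₀ • (mulL (fun _ => S.right j y₀) (D p) - mulL (S.right j) (D p))
          - mulL (S.right j) (D (mulL (S.left j) (mulL (ind a) p)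
            - mulL (fun _ => S.left j x₀) (mulL (ind a) p))) := by
      rw [mulL_const, mulL_const, map_sub, map_sub, map_smul, map_smul, hDa,
        mulL_comm (S.bddMeas_left j) (bddMeas_ind ha), hDa, smul_sub, mul_smul]
      abel
    rw [e]
    refine (norm_sub_le _ _).trans ?_
    have hp : ‖mulL (ind a) p‖ ≤ ‖p‖ := norm_mulL_ind_apply_le ha p
    have e1 : ‖mulL (fun _ => S.right j y₀) (D p) - mulL (S.right j) (D p)‖ ≤ w' j * ‖D p‖ :=
      norm_mulL_sub_mulL_le (BddMeas.const _) (S.bddMeas_right j) hb (hw0' j)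
        (fun y hy => by rw [norm_sub_rev]; exact hw' y hy j) (hDb p)
    have e2 : ‖mulL (S.left j) (mulL (ind a) p) - mulL (fun _ => S.left j x₀) (mulL (ind a) p)‖
        ≤ w j * ‖mulL (ind a) p‖ :=
      norm_mulL_sub_mulL_le (S.bddMeas_left j) (BddMeas.const _) ha (hw0 j)
        (fun x hx => hw x hx j) (mulL_ind_idem ha p)
    have e3 := norm_mulL_apply_le_of_forall (S.measurable_right j) (S.norm_right_le j)
      (D (mulL (S.left j) (mulL (ind a) p) - mulL (fun _ => S.left j x₀) (mulL (ind a) p)))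
    have e4 := D.le_opNorm
      (mulL (S.left j) (mulL (ind a) p) - mulL (fun _ => S.left j x₀) (mulL (ind a) p))
    have e5 : ‖mulL (S.left j) (mulL (ind a) p) - mulL (fun _ => S.left j x₀) (mulL (ind a) p)‖
        ≤ w j * ‖p‖ := e2.trans (mul_le_mul_of_nonneg_left hp (hw0 j))
    have e6 := e3.trans (mul_le_mul_of_nonneg_left
      (e4.trans (mul_le_mul_of_nonneg_left e5 (norm_nonneg D))) (S.br_nonneg j))
    have e7 : ‖S.left j x₀ • (mulL (fun _ => S.right j y₀) (D p) - mulL (S.right j) (D p))‖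
        ≤ S.bl j * (w' j * (‖D‖ * ‖p‖)) := by
      rw [norm_smul]
      exact mul_le_mul (S.norm_left_le j _)
        (e1.trans (mul_le_mul_of_nonneg_left (D.le_opNorm p) (hw0' j))) (norm_nonneg _)
        (S.bl_nonneg j)
    calc _ ≤ S.bl j * (w' j * (‖D‖ * ‖p‖)) + S.br j * (‖D‖ * (w j * ‖p‖)) := add_le_add e7 e6
      _ = _ := by ring
  set η := ∑' j, w j * S.br j + ∑' j, S.bl j * w' j with hη
  have hη0 : 0 ≤ η := add_nonneg
    (tsum_nonneg fun j => mul_nonneg (hw0 j) (S.br_nonneg j))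
    (tsum_nonneg fun j => mul_nonneg (S.bl_nonneg j) (hw0' j))
  have hc : 0 < ‖S.eval (x₀, y₀)‖ := hη0.trans_lt hlt
  have h2 : ‖D‖ ≤ η / ‖S.eval (x₀, y₀)‖ * ‖D‖ :=
    ContinuousLinearMap.opNorm_le_bound _ (by positivity) fun p => by
      have := hbound p
      rw [← le_div_iff₀ hc] at this
      refine this.trans_eq ?_
      ring
  have h3 : η / ‖S.eval (x₀, y₀)‖ < 1 := (div_lt_one hc).mpr hlt
  rw [← norm_eq_zero]
  nlinarith [norm_nonneg D]

/-- An operator annihilated by the multiplier of a symbol vanishes on every rectangle on which the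
symbol is bounded away from zero. -/
theorem mulL_ind_apply_eq_zero {a : Set α} {b : Set β} (ha : MeasurableSet a)
    (hb : MeasurableSet b) {D : Lp ℂ 2 μ →L[ℂ] Lp ℂ 2 ν} (hD : S.mult D = 0) {d : ℝ} (hd : 0 < d)
    (hφ : ∀ x ∈ a, ∀ y ∈ b, d ≤ ‖S.eval (x, y)‖) (p : Lp ℂ 2 μ) :
    mulL (ind b) (D (mulL (ind a) p)) = 0 := by
  have hd3 : 0 < d / 3 := by positivity
  obtain ⟨π, hπ, w, hw0, hw, hs, hle⟩ := S.exists_partition hd3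
  obtain ⟨ρ, hρ, w', hw0', hw', hs', hle'⟩ := S.swap.exists_partition hd3
  have hπm : ∀ i, MeasurableSet (π ⁻¹' {i}) := fun i => hπ (measurableSet_singleton i)
  have hρm : ∀ i, MeasurableSet (ρ ⁻¹' {i}) := fun i => hρ (measurableSet_singleton i)
  have hs'' : Summable fun j => S.bl j * w' j := by
    simpa only [mul_comm, swap] using hs'
  have hle'' : ∑' j, S.bl j * w' j ≤ d / 3 := by
    simpa only [mul_comm, swap] using hle'
  have hcell : ∀ i l p, mulL (ind (b ∩ ρ ⁻¹' {l})) (D (mulL (ind (a ∩ π ⁻¹' {i})) p)) = 0 := by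
    intro i l
    have ham : MeasurableSet (a ∩ π ⁻¹' {i}) := ha.inter (hπm i)
    have hbm : MeasurableSet (b ∩ ρ ⁻¹' {l}) := hb.inter (hρm l)
    rcases Set.eq_empty_or_nonempty (a ∩ π ⁻¹' {i}) with h0 | ⟨x₀, hx₀⟩
    · intro p
      rw [h0, show ind (∅ : Set α) = fun _ => 0 from Set.indicator_empty _, mulL_const, zero_smul,
        map_zero, map_zero]
    rcases Set.eq_empty_or_nonempty (b ∩ ρ ⁻¹' {l}) with h0 | ⟨y₀, hy₀⟩
    · intro p
      rw [h0, show ind (∅ : Set β) = fun _ => 0 from Set.indicator_empty _, mulL_const, zero_smul]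
    have h1 : mulL (ind (b ∩ ρ ⁻¹' {l})) ∘L D ∘L mulL (ind (a ∩ π ⁻¹' {i})) = 0 := by
      refine S.eq_zero_of_mult_eq_zero ham hbm (x₀ := x₀) (y₀ := y₀) (w := w) (w' := w')
        (fun p => ?_) (fun p => ?_) ?_ hw0 hw0' (fun x hx => hw _ _ (hx.2.trans hx₀.2.symm))
        (fun y hy => hw' _ _ (hy.2.trans hy₀.2.symm)) hs hs'' ?_
      · simp only [ContinuousLinearMap.comp_apply, mulL_ind_idem ham]
      · simp only [ContinuousLinearMap.comp_apply, mulL_ind_idem hbm]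
      · rw [S.mult_mulL_comp (bddMeas_ind ham) (bddMeas_ind hbm), hD]
        ext1 p
        simp
      · have := hφ x₀ hx₀.1 y₀ hy₀.1
        linarith
    exact fun p => congrArg (fun T : Lp ℂ 2 μ →L[ℂ] Lp ℂ 2 ν => T p) h1
  have h0 : mulL (ind b) ∘L D ∘L mulL (ind a) = 0 := by
    refine clm_eq_zero_of_forall_mulL_preimage hπ fun i p => ?_
    refine eq_zero_of_forall_mulL_preimage hρ fun l => ?_
    have := hcell i l p
    rw [mulL_ind_inter ha (hπm i), Set.inter_comm b, mulL_ind_inter (hρm l) hb] at this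
    exact this
  exact congrArg (fun T : Lp ℂ 2 μ →L[ℂ] Lp ℂ 2 ν => T p) h0

/-- The symbol `∑ⱼ (leftⱼ(x) - leftⱼ(x₀)) rightⱼ(y)`. -/
def subAt (x₀ : α) : ProjSymbol J α β where
  left j x := S.left j x - S.left j x₀
  right := S.right
  bl j := 2 * S.bl j
  br := S.br
  bl_nonneg j := by have := S.bl_nonneg j; positivity
  br_nonneg := S.br_nonneg
  measurable_left j := (S.measurable_left j).sub_const _
  measurable_right := S.measurable_right
  norm_left_le j x := by
    have := norm_sub_le (S.left j x) (S.left j x₀)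
    have h2 := S.norm_left_le j x
    have h3 := S.norm_left_le j x₀
    linarith
  norm_right_le := S.norm_right_le
  summable := by simpa only [mul_assoc] using S.summable.mul_left 2

theorem bddMeas_eval_right (x₀ : α) : BddMeas fun y => S.eval (x₀, y) :=
  S.bddMeas_eval.comp measurable_prodMk_left

theorem mult_subAt_apply (x₀ : α) (R : Lp ℂ 2 μ →L[ℂ] Lp ℂ 2 ν) (p : Lp ℂ 2 μ) :
    (S.subAt x₀).mult R p = S.mult R p - mulL (fun y => S.eval (x₀, y)) (R p) := by
  have h2 := hasSum_mulL (fun j => (S.measurable_term j).comp (measurable_prodMk_left (x := x₀)))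
    S.summable (fun j y => S.norm_term_le j (x₀, y)) (R p)
  refine ((S.subAt x₀).hasSum_mult_apply R p).unique
    (((S.hasSum_mult_apply R p).sub h2).congr_fun fun j => ?_)
  simp only [subAt]
  rw [mulL_sub (S.bddMeas_left j) (BddMeas.const _), mulL_const, map_sub, map_sub, map_smul,
    map_smul]
  congr 1
  have : (fun y => S.left j x₀ * S.right j y) = fun y => (fun _ => S.left j x₀) y * S.right j y :=
    rfl
  simp only [Function.comp_def]
  rw [this, ← mulL_mulL (BddMeas.const _) (S.bddMeas_right j), mulL_const]

end ProjSymbol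

end localization

/-! ### Weak limits and orthogonal sums -/

section weak

variable {E : Type*} [NormedAddCommGroup E] [InnerProductSpace ℂ E]

/-- Bounded sequences in a Hilbert space have weak limits along some filter. -/
theorem exists_weak_limit [CompleteSpace E] {x : ℕ → E} {C : ℝ} (hx : ∀ i, ‖x i‖ ≤ C) :
    ∃ l : Filter ℕ, l.NeBot ∧ l ≤ atTop ∧
      ∃ k : E, ∀ z, Tendsto (fun i => inner ℂ z (x i)) l (𝓝 (inner ℂ z k)) := by
  let y : ℕ → WeakDual ℂ E := fun i => StrongDual.toWeakDual (InnerProductSpace.toDual ℂ E (x i))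
  obtain ⟨k, -, hk⟩ := (WeakDual.isCompact_closedBall (𝕜 := ℂ) (0 : StrongDual ℂ E)
    C).ultrafilter_le_nhds ((hyperfilter ℕ).map y) (by
      rw [Ultrafilter.coe_map, le_principal_iff, mem_map]
      refine Eventually.of_forall fun i => ?_
      change InnerProductSpace.toDual ℂ E (x i) ∈ Metric.closedBall _ C
      rw [mem_closedBall_zero_iff, LinearIsometryEquiv.norm_map]
      exact hx i)
  refine ⟨hyperfilter ℕ, inferInstance, ?_,
    (InnerProductSpace.toDual ℂ E).symm (WeakDual.toStrongDual k), fun z => ?_⟩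
  · rw [← Nat.cofinite_eq_atTop]
    exact hyperfilter_le_cofinite
  · have h1 : Tendsto (fun i => y i z) (hyperfilter ℕ) (𝓝 (k z)) :=
      ((WeakDual.eval_continuous z).tendsto k).comp hk
    have h2 := (Complex.continuous_conj.tendsto _).comp h1
    have e : k z = inner ℂ ((InnerProductSpace.toDual ℂ E).symm (WeakDual.toStrongDual k)) z := by
      rw [InnerProductSpace.toDual_symm_apply]; rfl
    rw [e, inner_conj_symm] at h2
    refine h2.congr fun i => ?_
    simp only [Function.comp_apply]
    rw [← inner_conj_symm z (x i)]
    rfl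

theorem norm_sum_sq_of_orthogonal {ι : Type*} (s : Finset ι) {v : ι → E}
    (hv : ∀ i j, i ≠ j → inner ℂ (v i) (v j) = 0) : ‖∑ i ∈ s, v i‖ ^ 2 = ∑ i ∈ s, ‖v i‖ ^ 2 := by
  classical
  induction s using Finset.induction_on with
  | empty => simp
  | insert a s ha ih =>
    rw [Finset.sum_insert ha, Finset.sum_insert ha, ← ih, sq, sq, sq,
      norm_add_sq_eq_norm_sq_add_norm_sq_of_inner_eq_zero (𝕜 := ℂ)]
    rw [inner_sum]
    exact Finset.sum_eq_zero fun j hj => hv a j (by rintro rfl; exact ha hj)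

end weak

/-! ### Conditional expectations on fine partitions -/

section cells

variable {α : Type*} [MeasurableSpace α] {μ : Measure α} [IsFiniteMeasure μ]

/-- The indicator function of `s` in `L²(μ)`, normalized; it is `0` if `μ s = 0`. -/
def cellVec (μ : Measure α) [IsFiniteMeasure μ] (s : Set α) : Lp ℂ 2 μ :=
  (((√(μ.real s))⁻¹ : ℝ) : ℂ) • mulL (ind s) ((memLp_const (1 : ℂ)).toLp)

theorem coeFn_mulL_ind_one {s : Set α} (hs : MeasurableSet s) :
    mulL (ind s) ((memLp_const (1 : ℂ)).toLp (μ := μ) (p := 2)) =ᵐ[μ] ind s := by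
  filter_upwards [coeFn_mulL (bddMeas_ind hs) ((memLp_const (1 : ℂ)).toLp (μ := μ) (p := 2)),
    (memLp_const (1 : ℂ)).coeFn_toLp (μ := μ) (p := 2)] with x h1 h2
  rw [h1, h2, mul_one]

theorem norm_sq_mulL_ind_one {s : Set α} (hs : MeasurableSet s) :
    ‖mulL (ind s) ((memLp_const (1 : ℂ)).toLp (μ := μ) (p := 2))‖ ^ 2 = μ.real s := by
  rw [norm_sq_eq_integral, ← integral_indicator_one hs]
  refine integral_congr_ae ?_
  filter_upwards [coeFn_mulL_ind_one (μ := μ) hs] with x hx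
  rw [hx]
  by_cases h : x ∈ s <;> simp [ind, h]

theorem mulL_ind_cellVec {s : Set α} (hs : MeasurableSet s) :
    mulL (ind s) (cellVec μ s) = cellVec μ s := by
  rw [cellVec, map_smul, mulL_ind_idem hs]

theorem norm_cellVec_sq {s : Set α} (hs : MeasurableSet s) :
    ‖cellVec μ s‖ ^ 2 = (√(μ.real s))⁻¹ ^ 2 * μ.real s := by
  rw [cellVec, norm_smul, mul_pow, norm_sq_mulL_ind_one hs, Complex.norm_real, norm_inv,
    Real.norm_of_nonneg (Real.sqrt_nonneg _)]

theorem norm_cellVec_le {s : Set α} (hs : MeasurableSet s) : ‖cellVec μ s‖ ≤ 1 := by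
  rw [← sq_le_one_iff₀ (norm_nonneg _), norm_cellVec_sq hs, inv_pow,
    Real.sq_sqrt measureReal_nonneg]
  exact inv_mul_le_one

theorem inner_cellVec_smul {s : Set α} (hs : MeasurableSet s) :
    inner ℂ (cellVec μ s) (mulL (ind s) ((memLp_const (1 : ℂ)).toLp)) • cellVec μ s
      = mulL (ind s) ((memLp_const (1 : ℂ)).toLp (μ := μ) (p := 2)) := by
  set v := mulL (ind s) ((memLp_const (1 : ℂ)).toLp (μ := μ) (p := 2)) with hv
  have hn : ‖v‖ ^ 2 = μ.real s := norm_sq_mulL_ind_one hs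
  rcases eq_or_ne (μ.real s) 0 with h0 | h0
  · have : v = 0 := by rw [h0] at hn; exact norm_eq_zero.mp (pow_eq_zero_iff two_ne_zero |>.mp hn)
    rw [this, inner_zero_right, zero_smul]
  · rw [cellVec, ← hv, inner_smul_left, inner_self_eq_norm_sq_to_K, smul_smul,
      Complex.conj_ofReal]
    conv_rhs => rw [← one_smul ℂ v]
    congr 1
    have e : (√(μ.real s))⁻¹ * ‖v‖ ^ 2 * (√(μ.real s))⁻¹ = 1 := by
      have h1 : √(μ.real s) ≠ 0 := (Real.sqrt_ne_zero measureReal_nonneg).mpr h0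
      rw [hn]
      field_simp
      rw [Real.sq_sqrt measureReal_nonneg]
    have e' : (((√(μ.real s))⁻¹ * ‖v‖ ^ 2 * (√(μ.real s))⁻¹ : ℝ) : ℂ) = 1 := by
      rw [e, Complex.ofReal_one]
    rw [← e']
    push_cast
    rfl

/-- The projection onto functions that are constant on the first `m` cells and vanish outside
them. -/
def cellProj (μ : Measure α) [IsFiniteMeasure μ] (b : ℕ → Set α) (m : ℕ) :
    Lp ℂ 2 μ →L[ℂ] Lp ℂ 2 μ :=
  ∑ n ∈ Finset.range m, (innerSL ℂ (cellVec μ (b n))).smulRight (cellVec μ (b n))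

theorem cellProj_apply (b : ℕ → Set α) (m : ℕ) (p : Lp ℂ 2 μ) :
    cellProj μ b m p = ∑ n ∈ Finset.range m, inner ℂ (cellVec μ (b n)) p • cellVec μ (b n) := by
  simp [cellProj]

variable {b : ℕ → Set α} (hb : ∀ n, MeasurableSet (b n))
  (hd : Pairwise (Function.onFun Disjoint b))

include hb hd

theorem inner_cellVec_cellVec {i j : ℕ} (hij : i ≠ j) :
    inner ℂ (cellVec μ (b i)) (cellVec μ (b j)) = 0 :=
  inner_eq_zero_of_disjoint (hb i) (hb j) (hd hij) (mulL_ind_cellVec (hb i))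
    (mulL_ind_cellVec (hb j))

theorem norm_cellProj_apply_le (m : ℕ) (p : Lp ℂ 2 μ) : ‖cellProj μ b m p‖ ≤ ‖p‖ := by
  set e := fun n => cellVec μ (b n) with he
  have h1 : ‖cellProj μ b m p‖ ^ 2 ≤ ∑ n ∈ Finset.range m, ‖(inner ℂ (e n) p : ℂ)‖ ^ 2 := by
    rw [cellProj_apply, norm_sum_sq_of_orthogonal]
    · refine Finset.sum_le_sum fun n _ => ?_
      rw [norm_smul]
      exact pow_le_pow_left₀ (by positivity)
        (mul_le_of_le_one_right (norm_nonneg _) (norm_cellVec_le (hb n))) 2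
    · intro i j hij
      rw [inner_smul_left, inner_smul_right, inner_cellVec_cellVec hb hd hij, mul_zero, mul_zero]
  have h2 : ((∑ n ∈ Finset.range m, ‖(inner ℂ (e n) p : ℂ)‖ ^ 2 : ℝ) : ℂ)
      = inner ℂ p (cellProj μ b m p) := by
    rw [cellProj_apply, inner_sum]
    push_cast
    refine Finset.sum_congr rfl fun n _ => ?_
    rw [inner_smul_right, ← inner_conj_symm p, Complex.mul_conj, Complex.normSq_eq_norm_sq]
    push_cast
    rfl
  have h3 : ∑ n ∈ Finset.range m, ‖(inner ℂ (e n) p : ℂ)‖ ^ 2 ≤ ‖p‖ * ‖cellProj μ b m p‖ := by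
    have := norm_inner_le_norm (𝕜 := ℂ) p (cellProj μ b m p)
    rw [← h2, Complex.norm_real, Real.norm_of_nonneg
      (Finset.sum_nonneg fun _ _ => by positivity)] at this
    exact this
  rcases eq_or_ne ‖cellProj μ b m p‖ 0 with h0 | h0
  · rw [h0]; positivity
  · have := lt_of_le_of_ne (norm_nonneg (cellProj μ b m p)) (Ne.symm h0)
    nlinarith

theorem cellProj_mulL_ind_one {m n : ℕ} (hn : n < m) :
    cellProj μ b m (mulL (ind (b n)) ((memLp_const (1 : ℂ)).toLp))
      = mulL (ind (b n)) ((memLp_const (1 : ℂ)).toLp) := by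
  rw [cellProj_apply, Finset.sum_eq_single_of_mem n (Finset.mem_range.mpr hn),
    inner_cellVec_smul (hb n)]
  intro i _ hi
  rw [inner_eq_zero_of_disjoint (hb i) (hb n) (hd hi) (mulL_ind_cellVec (hb i))
    (mulL_ind_idem (hb n) _), zero_smul]

/-- A function nearly constant on the cells is nearly fixed by the cell projection. -/
theorem norm_cellProj_sub_sq_le {p : Lp ℂ 2 μ} {F : α → ℂ} (hF : p =ᵐ[μ] F) {B δ : ℝ}
    (hB : ∀ x, ‖F x‖ ≤ B) (hosc : ∀ n, ∀ x ∈ b n, ∀ y ∈ b n, ‖F x - F y‖ ≤ δ)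
    (m : ℕ) : ‖cellProj μ b m p - p‖ ^ 2
      ≤ 4 * (δ ^ 2 * μ.real Set.univ + B ^ 2 * μ.real (⋃ n ∈ Finset.range m, b n)ᶜ) := by
  classical
  let c : ℕ → ℂ := fun n => if h : (b n).Nonempty then F h.some else 0
  let s : Lp ℂ 2 μ := ∑ n ∈ Finset.range m, c n • mulL (ind (b n)) ((memLp_const (1 : ℂ)).toLp)
  have hs : cellProj μ b m s = s := by
    simp only [s, map_sum, map_smul]
    exact Finset.sum_congr rfl fun n hn => by
      rw [cellProj_mulL_ind_one hb hd (Finset.mem_range.mp hn)]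
  have hUm : MeasurableSet (⋃ n ∈ Finset.range m, b n)ᶜ :=
    (Finset.measurableSet_biUnion _ fun n _ => hb n).compl
  have h1 : ‖p - s‖ ^ 2 ≤ δ ^ 2 * μ.real Set.univ
      + B ^ 2 * μ.real (⋃ n ∈ Finset.range m, b n)ᶜ := by
    have hi2 : Integrable ((⋃ n ∈ Finset.range m, b n)ᶜ.indicator (1 : α → ℝ)) μ :=
      (integrable_const (1 : ℝ)).indicator hUm
    have hint : ∫ x, (δ ^ 2 + B ^ 2 * (⋃ n ∈ Finset.range m, b n)ᶜ.indicator (1 : α → ℝ) x) ∂μ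
        = δ ^ 2 * μ.real Set.univ + B ^ 2 * μ.real (⋃ n ∈ Finset.range m, b n)ᶜ := by
      rw [integral_add (integrable_const _) (hi2.const_mul _), integral_const_mul,
        integral_indicator_one hUm, integral_const, smul_eq_mul, mul_comm (δ ^ 2)]
    rw [norm_sq_eq_integral, ← hint]
    refine integral_mono_ae (integrable_norm_sq _)
      ((integrable_const _).add (hi2.const_mul _)) ?_
    have hterm : ∀ᵐ x ∂μ, ∀ n, (c n • mulL (ind (b n))
        ((memLp_const (1 : ℂ)).toLp (μ := μ) (p := 2)) : Lp ℂ 2 μ) x = c n * ind (b n) x :=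
      ae_all_iff.mpr fun n => by
        filter_upwards [Lp.coeFn_smul (c n) (mulL (ind (b n))
          ((memLp_const (1 : ℂ)).toLp (μ := μ) (p := 2))), coeFn_mulL_ind_one (μ := μ) (hb n)]
          with x h1 h2
        rw [h1, Pi.smul_apply, h2, smul_eq_mul]
    filter_upwards [hF, Lp.coeFn_sub p s, hterm, Lp.coeFn_finsetSum (Finset.range m) fun n =>
      (c n • mulL (ind (b n)) ((memLp_const (1 : ℂ)).toLp (μ := μ) (p := 2)) : Lp ℂ 2 μ)]
      with x hx1 hx2 hx3 hx4
    rw [hx2, Pi.sub_apply, hx1, hx4, Finset.sum_apply, Finset.sum_congr rfl fun n _ => hx3 n]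
    by_cases hx : x ∈ ⋃ n ∈ Finset.range m, b n
    · rw [Set.indicator_of_notMem (by simpa using hx), mul_zero, add_zero]
      simp only [Set.mem_iUnion] at hx
      obtain ⟨n, hn, hxn⟩ := hx
      rw [Finset.sum_eq_single_of_mem n hn, ind_of_mem hxn, mul_one]
      · have hne : (b n).Nonempty := ⟨x, hxn⟩
        simp only [c, dif_pos hne]
        exact pow_le_pow_left₀ (norm_nonneg _) (hosc n x hxn _ hne.some_mem) 2
      · intro i _ hi
        rw [ind_of_notMem (Set.disjoint_left.mp (hd hi.symm) hxn), mul_zero]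
    · rw [Set.indicator_of_mem hx, Finset.sum_eq_zero, sub_zero]
      · have := pow_le_pow_left₀ (norm_nonneg _) (hB x) 2
        simp only [Pi.one_apply, mul_one]
        nlinarith [sq_nonneg δ]
      · intro n hn
        rw [ind_of_notMem (fun h => hx (Set.mem_biUnion hn h)), mul_zero]
  have h2 : ‖cellProj μ b m p - p‖ ≤ 2 * ‖p - s‖ := by
    have e : cellProj μ b m p - p = cellProj μ b m (p - s) - (p - s) := by
      rw [map_sub, hs]; abel
    rw [e]
    have := norm_sub_le (cellProj μ b m (p - s)) (p - s)
    have := norm_cellProj_apply_le hb hd m (p - s)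
    linarith
  calc _ ≤ (2 * ‖p - s‖) ^ 2 := pow_le_pow_left₀ (norm_nonneg _) h2 2
    _ = 4 * ‖p - s‖ ^ 2 := by ring
    _ ≤ _ := by gcongr

end cells

end

noncomputable section

/-! ### Comparison of multipliers over a space of dimension at most two -/

section dim

variable {M : Type*} [MetricSpace M] [MeasurableSpace M] {μ : Measure M} [IsFiniteMeasure μ]

/-- Finitely many cells of small diameter, with a uniform bound for the sum of the squares of the
diameters, that cover all but a set of small measure. -/
theorem exists_cells {D : Set M} (hdim : NormalFamily.DimLE D 2) (hD : μ Dᶜ = 0) :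
    ∃ C : ℝ, 0 ≤ C ∧ ∀ ε : ℝ, 0 < ε → ∃ (m : ℕ) (b : ℕ → Set M) (r : ℕ → ℝ),
      (∀ n, MeasurableSet (b n)) ∧ Pairwise (Function.onFun Disjoint b) ∧
      (∀ n, 0 ≤ r n ∧ r n < ε ∧ ∀ x ∈ b n, ∀ y ∈ b n, dist x y ≤ r n) ∧
      ∑ n ∈ Finset.range m, r n ^ 2 ≤ C ∧ μ.real (⋃ n ∈ Finset.range m, b n)ᶜ < ε := by
  obtain ⟨C, hC⟩ := hdim
  refine ⟨(C : ℝ) ^ 2, by positivity, fun ε hε => ?_⟩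
  obtain ⟨b, hbm, hbd, hcov, hdiam, hsum⟩ := hC (ENNReal.ofReal ε) (ENNReal.ofReal_pos.mpr hε)
  have hfin : ∀ n, Metric.ediam (b n) ≠ ∞ := fun n => ((hdiam n).trans ENNReal.ofReal_lt_top).ne
  have hlim : Tendsto (fun m => μ.real (⋃ n ∈ Finset.range m, b n)ᶜ) atTop (𝓝 0) := by
    have h1 : Tendsto (fun m => μ (⋃ n ∈ Finset.range m, b n)ᶜ) atTop
        (𝓝 (μ (⋂ m : ℕ, (⋃ n ∈ Finset.range m, b n)ᶜ))) := by
      refine tendsto_measure_iInter_atTop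
        (fun m => (Finset.measurableSet_biUnion _ fun n _ => hbm n).compl.nullMeasurableSet)
        (fun m m' hmm => ?_) ⟨0, measure_ne_top _ _⟩
      exact Set.compl_subset_compl.mpr
        (Set.biUnion_subset_biUnion_left (Finset.range_mono hmm))
    have h2 : μ (⋂ m : ℕ, (⋃ n ∈ Finset.range m, b n)ᶜ) = 0 := by
      refine measure_mono_null (show _ ⊆ Dᶜ from fun x hx hxD => ?_) hD
      obtain ⟨n, hn⟩ := Set.mem_iUnion.mp (hcov hxD)
      exact Set.mem_iInter.mp hx (n + 1)
        (Set.mem_biUnion (Finset.mem_range.mpr (Nat.lt_succ_self n)) hn)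
    rw [h2] at h1
    exact (ENNReal.tendsto_toReal ENNReal.zero_ne_top).comp h1
  obtain ⟨m, hm⟩ := (hlim.eventually (gt_mem_nhds hε)).exists
  refine ⟨m, b, fun n => (Metric.ediam (b n)).toReal, hbm, hbd, fun n => ⟨ENNReal.toReal_nonneg,
    ?_, fun x hx y hy => ?_⟩, ?_, hm⟩
  · rw [← ENNReal.toReal_ofReal hε.le]
    exact ENNReal.toReal_strict_mono ENNReal.ofReal_ne_top (hdiam n)
  · rw [dist_edist]
    exact ENNReal.toReal_mono (hfin n) (Metric.edist_le_ediam_of_mem hx hy)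
  · have h1 : ∑' n, Metric.ediam (b n) ^ (2 : ℝ) ≤ (C : ℝ≥0∞) ^ (2 : ℝ) := by
      have := ENNReal.rpow_le_rpow hsum (show (0 : ℝ) ≤ 2 by norm_num)
      rwa [← ENNReal.rpow_mul, show (1 / 2 : ℝ) * 2 = 1 by norm_num, ENNReal.rpow_one] at this
    have h2 := (ENNReal.sum_le_tsum (Finset.range m)).trans h1
    have h3 := ENNReal.toReal_mono (ENNReal.rpow_ne_top_of_nonneg (by norm_num)
      ENNReal.coe_ne_top) h2
    rw [ENNReal.toReal_sum fun n _ => ENNReal.rpow_ne_top_of_nonneg (by norm_num) (hfin n)] at h3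
    simpa [← ENNReal.toReal_rpow] using h3

variable [CompactSpace M] [BorelSpace M]

/-- Cell projections converge strongly to the identity as the diameters of the cells and the
measure of the uncovered set tend to zero. -/
theorem tendsto_cellProj {m : ℕ → ℕ} {b : ℕ → ℕ → Set M} {ε : ℕ → ℝ}
    (hε : Tendsto ε atTop (𝓝 0)) (hb : ∀ i n, MeasurableSet (b i n))
    (hd : ∀ i, Pairwise (Function.onFun Disjoint (b i)))
    (hdiam : ∀ i n, ∀ x ∈ b i n, ∀ y ∈ b i n, dist x y < ε i)
    (hμ : ∀ i, μ.real (⋃ n ∈ Finset.range (m i), b i n)ᶜ < ε i) (p : Lp ℂ 2 μ) :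
    Tendsto (fun i => cellProj μ (b i) (m i) p) atTop (𝓝 p) := by
  have hcont : ∀ F : C(M, ℂ), Tendsto
      (fun i => cellProj μ (b i) (m i) (ContinuousMap.toLp 2 μ ℂ F)) atTop
      (𝓝 (ContinuousMap.toLp 2 μ ℂ F)) := by
    intro F
    rw [tendsto_iff_norm_sub_tendsto_zero]
    have huc := CompactSpace.uniformContinuous_of_continuous F.continuous
    have hsq : Tendsto (fun i => ‖cellProj μ (b i) (m i) (ContinuousMap.toLp 2 μ ℂ F)
        - ContinuousMap.toLp 2 μ ℂ F‖ ^ 2) atTop (𝓝 0) := by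
      rw [Metric.tendsto_atTop]
      intro η hη
      set V : ℝ := μ.real Set.univ with hV
      have hV0 : 0 ≤ V := measureReal_nonneg
      set δ : ℝ := √(η / (16 * (V + 1))) with hδ
      have hδ0 : 0 < δ := Real.sqrt_pos.mpr (by positivity)
      have hδ2 : δ ^ 2 * (V + 1) = η / 16 := by
        rw [hδ, Real.sq_sqrt (by positivity)]; field_simp
      obtain ⟨t, ht, hFt⟩ := Metric.uniformContinuous_iff.mp huc δ hδ0
      have hlt : ∀ᶠ i in atTop, ε i < min t (η / (16 * (‖F‖ ^ 2 + 1))) :=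
        hε.eventually (gt_mem_nhds (lt_min ht (by positivity)))
      obtain ⟨i₀, hi₀⟩ := eventually_atTop.mp hlt
      refine ⟨i₀, fun i hi => ?_⟩
      have h1 := hi₀ i hi
      have h2 := norm_cellProj_sub_sq_le (hb i) (hd i)
        (ContinuousMap.coeFn_toLp (p := 2) (𝕜 := ℂ) μ F) (B := ‖F‖) (δ := δ)
        (fun x => F.norm_coe_le_norm x) (fun n x hx y hy => by
          rw [← dist_eq_norm]
          exact (hFt ((hdiam i n x hx y hy).trans (h1.trans_le (min_le_left _ _)))).le) (m i)
      have h3 : ‖F‖ ^ 2 * μ.real (⋃ n ∈ Finset.range (m i), b i n)ᶜ ≤ η / 16 := by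
        have h4 : μ.real (⋃ n ∈ Finset.range (m i), b i n)ᶜ ≤ η / (16 * (‖F‖ ^ 2 + 1)) :=
          ((hμ i).trans (h1.trans_le (min_le_right _ _))).le
        calc _ ≤ (‖F‖ ^ 2 + 1) * (η / (16 * (‖F‖ ^ 2 + 1))) := by gcongr; linarith
          _ = _ := by field_simp
      rw [dist_zero_right, Real.norm_of_nonneg (by positivity)]
      have : δ ^ 2 * V ≤ η / 16 := by nlinarith [sq_nonneg δ]
      linarith
    have := (Real.continuous_sqrt.tendsto 0).comp hsq
    simpa [Function.comp_def, Real.sqrt_sq (norm_nonneg _)] using this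
  have hdense := ContinuousMap.toLp_denseRange ℂ μ ℂ (p := 2) (by norm_num)
  rw [Metric.tendsto_atTop]
  intro η hη
  obtain ⟨F, hF⟩ := hdense.exists_dist_lt p (show (0 : ℝ) < η / 3 by positivity)
  obtain ⟨i₀, hi₀⟩ := Metric.tendsto_atTop.mp (hcont F) (η / 3) (by positivity)
  refine ⟨i₀, fun i hi => ?_⟩
  have h1 := hi₀ i hi
  have h2 := norm_cellProj_apply_le (hb i) (hd i) (m i) (p - ContinuousMap.toLp 2 μ ℂ F)
  rw [map_sub, ← dist_eq_norm, ← dist_eq_norm] at h2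
  have h3 := dist_triangle4 (cellProj μ (b i) (m i) p)
    (cellProj μ (b i) (m i) (ContinuousMap.toLp 2 μ ℂ F)) (ContinuousMap.toLp 2 μ ℂ F) p
  rw [dist_comm (ContinuousMap.toLp 2 μ ℂ F) p] at h3
  linarith

end dim

section core

variable {M N : Type*} [MetricSpace M] [MeasurableSpace M] [MeasurableSpace N]
  {μ : Measure M} {ν : Measure N} [IsFiniteMeasure μ] [IsFiniteMeasure ν]
  {J J' : Type*}

/-- The symbol is Lipschitz in the first variable, in the `ℓ²` sense in which `L` bounds the
left factors and `G` the right ones. -/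
structure ProjSymbol.IsLip (S : ProjSymbol J M N) (L G : ℝ) : Prop where
  left_nonneg : 0 ≤ L
  right_nonneg : 0 ≤ G
  left_le : ∀ (F : Finset J) x x',
    ∑ j ∈ F, ‖S.left j x - S.left j x'‖ ^ 2 ≤ (L * dist x x') ^ 2
  right_le : ∀ (F : Finset J) y, ∑ j ∈ F, ‖S.right j y‖ ^ 2 ≤ G ^ 2

namespace ProjSymbol

theorem IsLip.norm_eval_sub_le {S : ProjSymbol J M N} {L G : ℝ} (h : S.IsLip L G) (x x' : M)
    (y : N) : ‖S.eval (x, y) - S.eval (x', y)‖ ≤ L * G * dist x x' := by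
  have h1 := ((S.hasSum_eval (x, y)).sub (S.hasSum_eval (x', y))).norm
  rw [SummationFilter.unconditional_filter] at h1
  refine le_of_tendsto' h1 fun F => ?_
  refine (norm_sum_le _ _).trans ?_
  have h2 := Finset.sum_mul_sq_le_sq_mul_sq F (fun j => ‖S.left j x - S.left j x'‖)
    (fun j => ‖S.right j y‖)
  have hL := h.left_nonneg
  have hG := h.right_nonneg
  have e : ∑ j ∈ F, ‖S.left j x * S.right j y - S.left j x' * S.right j y‖
      = ∑ j ∈ F, ‖S.left j x - S.left j x'‖ * ‖S.right j y‖ :=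
    Finset.sum_congr rfl fun j _ => by rw [← sub_mul, norm_mul]
  dsimp only
  rw [e]
  refine le_of_sq_le_sq (h2.trans ?_) (by positivity)
  calc _ ≤ (L * dist x x') ^ 2 * G ^ 2 :=
        mul_le_mul (h.left_le F x x') (h.right_le F y)
          (Finset.sum_nonneg fun _ _ => by positivity) (by positivity)
    _ = _ := by ring

/-- Freezing the first variable of a Lipschitz symbol at a point of a small cell. -/
theorem IsLip.norm_mult_sub_le {S : ProjSymbol J M N} {L G : ℝ} (h : S.IsLip L G)
    {s : Set M} (hs : MeasurableSet s) {r : ℝ} (hr : 0 ≤ r)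
    {x₀ : M} (hx₀ : ∀ x ∈ s, dist x x₀ ≤ r) {e : Lp ℂ 2 μ} (he : mulL (ind s) e = e)
    (R : Lp ℂ 2 μ →L[ℂ] Lp ℂ 2 ν) :
    ‖S.mult R e - mulL (fun y => S.eval (x₀, y)) (R e)‖ ≤ L * G * r * ‖R‖ * ‖e‖ := by
  have hL := h.left_nonneg
  rw [← mult_subAt_apply]
  refine ((S.subAt x₀).norm_mult_apply_le (C := L * r) (G := G) (by positivity) h.right_nonneg e ?_
    h.right_le R).trans_eq (by ring)
  have h1 := coeFn_mulL (bddMeas_ind hs) e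
  rw [he] at h1
  filter_upwards [h1] with x hx hne F
  have hxs : x ∈ s := by
    by_contra hxs
    rw [ind_of_notMem hxs, zero_mul] at hx
    exact hne hx
  refine (h.left_le F x x₀).trans (pow_le_pow_left₀ (by positivity) ?_ 2)
  exact mul_le_mul_of_nonneg_left (hx₀ x hxs) hL

/-- The ratio is `0` where `U` vanishes, by the convention for division by zero. -/
theorem bddMeas_ratio {S : ProjSymbol J M N} {U : ProjSymbol J' M N}
    (hle : ∀ z, ‖S.eval z‖ ≤ ‖U.eval z‖) : BddMeas fun z => S.eval z / U.eval z :=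
  ⟨S.bddMeas_eval.1.div U.bddMeas_eval.1, 1, fun z => by
    rw [norm_div]; exact div_le_one_of_le₀ (hle z) (norm_nonneg _)⟩

theorem eval_mul_ratio {S : ProjSymbol J M N} {U : ProjSymbol J' M N}
    (hle : ∀ z, ‖S.eval z‖ ≤ ‖U.eval z‖) (z : M × N) :
    U.eval z * (S.eval z / U.eval z) = S.eval z := by
  rcases eq_or_ne (U.eval z) 0 with h0 | h0
  · have := hle z
    rw [h0, norm_zero, norm_le_zero_iff] at this
    rw [h0, zero_mul, this]
  · field_simp

/-- If `U.mult R` has kernel `k`, then `S.mult R` differs from the operator with kernel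
`(S / U) k` by an operator annihilated by the multiplier of `U`. -/
theorem mult_sub_eq_zero {S : ProjSymbol J M N} {U : ProjSymbol J' M N}
    (hle : ∀ z, ‖S.eval z‖ ≤ ‖U.eval z‖) {R T : Lp ℂ 2 μ →L[ℂ] Lp ℂ 2 ν}
    {k : Lp ℂ 2 (μ.prod ν)} (hk : HasKernel (U.mult R) k)
    (hT : HasKernel T (mulL (fun z => S.eval z / U.eval z) k)) :
    U.mult (S.mult R - T) = 0 := by
  have h1 := U.hasKernel_mult hT
  rw [mulL_mulL U.bddMeas_eval (bddMeas_ratio hle)] at h1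
  simp_rw [eval_mul_ratio hle] at h1
  have h2 := (S.hasKernel_mult hk).sub h1
  rw [mult_comm, ← map_sub, sub_self] at h2
  exact h2.eq_zero

/-- The key estimate: on a cell `s` of diameter `r`, multiplication by `S` sends the kernel of the
rank-one truncation `R |e⟩⟨e|` to a function whose norm is controlled by `r` and by the part over
`s` of the candidate kernel `(S / U) k` of `S.mult R`. Over those `y` for which `U` becomes small
on `s × {y}`, the symbol `S` is small on `s × {y}`; over the other `y`, the operators `S.mult R`
and `T` coincide. -/
theorem norm_mulL_eval_tens_le {S : ProjSymbol J M N} {U : ProjSymbol J' M N}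
    (hle : ∀ z, ‖S.eval z‖ ≤ ‖U.eval z‖) {L G : ℝ} (hS : S.IsLip L G)
    {R T : Lp ℂ 2 μ →L[ℂ] Lp ℂ 2 ν} {kT : Lp ℂ 2 (μ.prod ν)} (hT : HasKernel T kT)
    (hU : U.mult (S.mult R - T) = 0) {s : Set M} (hs : MeasurableSet s) {r : ℝ} (hr : 0 ≤ r)
    (hdiam : ∀ x ∈ s, ∀ y ∈ s, dist x y ≤ r) {e : Lp ℂ 2 μ} (he : mulL (ind s) e = e)
    (he1 : ‖e‖ ≤ 1) {δ : ℝ} (hδ : 0 < δ) :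
    ‖mulL S.eval (tens e (R e))‖
      ≤ (δ + 3 * (L * G) * r) * ‖R‖ + ‖mulL (fun z : M × N => ind s z.1) kT‖ := by
  have hΛ : 0 ≤ L * G := mul_nonneg hS.left_nonneg hS.right_nonneg
  rcases Set.eq_empty_or_nonempty s with h0 | ⟨x₀, hx₀⟩
  · have : e = 0 := by
      rw [← he, h0, show ind (∅ : Set M) = fun _ => 0 from Set.indicator_empty _, mulL_const,
        zero_smul]
    rw [this, map_zero, ← tensL_apply, map_zero, map_zero, norm_zero]
    positivity
  set ψ : N → ℂ := fun y => S.eval (x₀, y) with hψ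
  have hbψ : BddMeas ψ := S.bddMeas_eval_right x₀
  have hRe : ‖R e‖ ≤ ‖R‖ := (R.le_opNorm e).trans (mul_le_of_le_one_right (norm_nonneg _) he1)
  have hsM : MeasurableSet (s ×ˢ (Set.univ : Set N)) := hs.prod MeasurableSet.univ
  have htens : mulL (ind (s ×ˢ (Set.univ : Set N))) (tens e (R e)) = tens e (R e) := by
    have h1 := tens_mulL (bddMeas_ind hs) (BddMeas.const (α := N) 1) e (R e)
    rw [he, mulL_const, one_smul] at h1
    rw [h1, mulL_mulL (bddMeas_ind hsM)
      (((bddMeas_ind hs).conj.comp measurable_fst).mul (BddMeas.const 1))]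
    congr 2
    funext z
    by_cases hz : z.1 ∈ s <;> simp [ind, hz]
  -- freeze the first variable of the symbol
  have hA : ‖mulL S.eval (tens e (R e)) - mulL (fun z : M × N => ψ z.2) (tens e (R e))‖
      ≤ L * G * r * ‖R‖ := by
    refine (norm_mulL_sub_mulL_le S.bddMeas_eval (hbψ.comp measurable_snd) hsM
      (w := L * G * r) (by positivity) (fun z hz => ?_) htens).trans ?_
    · exact (hS.norm_eval_sub_le z.1 x₀ z.2).trans
        (mul_le_mul_of_nonneg_left (hdiam _ hz.1 _ hx₀) hΛ)
    · rw [norm_tens]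
      refine mul_le_mul_of_nonneg_left ?_ (by positivity)
      exact (mul_le_of_le_one_left (norm_nonneg _) he1).trans hRe
  have hB : ‖mulL (fun z : M × N => ψ z.2) (tens e (R e))‖ ≤ ‖mulL ψ (R e)‖ := by
    have h1 := tens_mulL (BddMeas.const (α := M) 1) hbψ e (R e)
    rw [mulL_const, one_smul] at h1
    simp only [map_one, one_mul] at h1
    rw [← h1, norm_tens]
    exact mul_le_of_le_one_left (norm_nonneg _) he1
  obtain ⟨γ, hγm, hγ, hγc⟩ := U.exists_measurableSet_small s hδ
  -- where `U` becomes small, so does `S`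
  have hC : ‖mulL (ind γ) (mulL ψ (R e))‖ ≤ (δ + L * G * r) * ‖R‖ := by
    rw [mulL_mulL (bddMeas_ind hγm) hbψ]
    refine (norm_mulL_apply_le_of_forall ((bddMeas_ind hγm).mul hbψ).1 (C := δ + L * G * r)
      (fun y => ?_) _).trans (mul_le_mul_of_nonneg_left hRe (by positivity))
    by_cases hy : y ∈ γ
    · obtain ⟨x, hx, hxy⟩ := hγ y hy
      rw [ind_of_mem hy, one_mul]
      have h1 := hS.norm_eval_sub_le x₀ x y
      have h2 := mul_le_mul_of_nonneg_left (hdiam _ hx₀ _ hx) hΛ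
      have h3 := norm_sub_norm_le (S.eval (x₀, y)) (S.eval (x, y))
      have h4 := hle (x, y)
      linarith
    · rw [ind_of_notMem hy, zero_mul, norm_zero]
      positivity
  -- elsewhere, `S.mult R` agrees with the operator `T`
  have hDT : mulL (ind γᶜ) (S.mult R e) = mulL (ind γᶜ) (T e) := by
    have h1 := U.mulL_ind_apply_eq_zero hs hγm.compl hU (half_pos hδ)
      (fun x hx y hy => hγc y hy x hx) e
    rwa [he, sub_apply, map_sub, sub_eq_zero] at h1
  have hE : ‖mulL (ind γᶜ) (S.mult R e)‖ ≤ ‖mulL (fun z : M × N => ind s z.1) kT‖ := by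
    rw [hDT]
    refine (norm_mulL_ind_apply_le hγm.compl _).trans ?_
    have h1 := (hT.mulL_comp (bddMeas_ind hs) (BddMeas.const (α := N) 1)).norm_apply_le e
    simp only [ContinuousLinearMap.comp_apply, he, mulL_const, one_smul, mul_one] at h1
    exact h1.trans (mul_le_of_le_one_right (norm_nonneg _) he1)
  have hF : ‖mulL (ind γᶜ) (mulL ψ (R e))‖
      ≤ L * G * r * ‖R‖ + ‖mulL (fun z : M × N => ind s z.1) kT‖ := by
    have h1 := hS.norm_mult_sub_le hs hr (fun x hx => hdiam x hx x₀ hx₀) he R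
    have h2 : ‖S.mult R e - mulL ψ (R e)‖ ≤ L * G * r * ‖R‖ :=
      h1.trans (mul_le_of_le_one_right (by positivity) he1)
    have h3 := norm_mulL_ind_apply_le hγm.compl (S.mult R e - mulL ψ (R e))
    rw [map_sub] at h3
    have h4 := norm_sub_norm_le (mulL (ind γᶜ) (mulL ψ (R e))) (mulL (ind γᶜ) (S.mult R e))
    rw [norm_sub_rev] at h4
    linarith
  have hG : ‖mulL ψ (R e)‖ ≤ ‖mulL (ind γ) (mulL ψ (R e))‖ + ‖mulL (ind γᶜ) (mulL ψ (R e))‖ := by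
    conv_lhs => rw [← mulL_ind_add_compl hγm (mulL ψ (R e))]
    exact norm_add_le _ _
  have hH := norm_sub_norm_le (mulL S.eval (tens e (R e)))
    (mulL (fun z : M × N => ψ z.2) (tens e (R e)))
  linarith

theorem hasKernel_comp_cellProj (R : Lp ℂ 2 μ →L[ℂ] Lp ℂ 2 ν) (b : ℕ → Set M) (m : ℕ) :
    HasKernel (R ∘L cellProj μ b m)
      (∑ n ∈ Finset.range m, tens (cellVec μ (b n)) (R (cellVec μ (b n)))) := by
  intro p q
  rw [ContinuousLinearMap.comp_apply, cellProj_apply, map_sum, inner_sum, inner_sum]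
  refine Finset.sum_congr rfl fun n _ => ?_
  rw [map_smul, inner_smul_right, inner_tens_tens]

/-- The kernels of `S.mult (R P)`, for cell projections `P`, are bounded in `L²`. -/
theorem norm_sq_mulL_eval_sum_le {S : ProjSymbol J M N} {U : ProjSymbol J' M N}
    (hle : ∀ z, ‖S.eval z‖ ≤ ‖U.eval z‖) {L G : ℝ} (hS : S.IsLip L G)
    {R T : Lp ℂ 2 μ →L[ℂ] Lp ℂ 2 ν} {kT : Lp ℂ 2 (μ.prod ν)} (hT : HasKernel T kT)
    (hU : U.mult (S.mult R - T) = 0) {m : ℕ} {b : ℕ → Set M} {r : ℕ → ℝ} {C : ℝ}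
    (hb : ∀ n, MeasurableSet (b n)) (hd : Pairwise (Function.onFun Disjoint b))
    (hr : ∀ n, 0 ≤ r n) (hdiam : ∀ n, ∀ x ∈ b n, ∀ y ∈ b n, dist x y ≤ r n)
    (hC : ∑ n ∈ Finset.range m, r n ^ 2 ≤ C) :
    ‖mulL S.eval (∑ n ∈ Finset.range m, tens (cellVec μ (b n)) (R (cellVec μ (b n))))‖ ^ 2
      ≤ 4 * (1 + 9 * (L * G) ^ 2 * C) * ‖R‖ ^ 2 + 2 * ‖kT‖ ^ 2 := by
  set e := fun n => cellVec μ (b n) with he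
  have hbM : ∀ n, MeasurableSet (b n ×ˢ (Set.univ : Set N)) := fun n =>
    (hb n).prod MeasurableSet.univ
  have htens : ∀ n, mulL (ind (b n ×ˢ (Set.univ : Set N))) (tens (e n) (R (e n)))
      = tens (e n) (R (e n)) := fun n => by
    have h1 := tens_mulL (bddMeas_ind (hb n)) (BddMeas.const (α := N) 1) (e n) (R (e n))
    rw [mulL_ind_cellVec (hb n), mulL_const, one_smul] at h1
    rw [h1, mulL_mulL (bddMeas_ind (hbM n))
      (((bddMeas_ind (hb n)).conj.comp measurable_fst).mul (BddMeas.const 1))]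
    congr 2
    funext z
    by_cases hz : z.1 ∈ b n <;> simp [ind, hz]
  have hind : (fun (n : ℕ) (z : M × N) => ind (b n) z.1)
      = fun n => ind (b n ×ˢ (Set.univ : Set N)) := by
    funext n z
    by_cases hz : z.1 ∈ b n <;> simp [ind, hz]
  rw [map_sum, norm_sum_sq_of_orthogonal]
  swap
  · intro i j hij
    refine inner_eq_zero_of_disjoint (hbM i) (hbM j)
      (Set.disjoint_prod.mpr (Or.inl (hd hij))) ?_ ?_ <;>
    rw [mulL_comm (bddMeas_ind (hbM _)) S.bddMeas_eval, htens]
  -- the threshold for `U`; the sum of its squares over the `m` cells is at most one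
  have hδ : (0 : ℝ) < 1 / (m + 1) := by positivity
  have hterm : ∀ n, ‖mulL S.eval (tens (e n) (R (e n)))‖ ^ 2
      ≤ 4 * ((1 / (m + 1) : ℝ) ^ 2 + 9 * (L * G) ^ 2 * r n ^ 2) * ‖R‖ ^ 2
        + 2 * ‖mulL (fun z : M × N => ind (b n) z.1) kT‖ ^ 2 := fun n => by
    have h1 := norm_mulL_eval_tens_le hle hS hT hU (hb n) (hr n) (hdiam n)
      (mulL_ind_cellVec (hb n)) (norm_cellVec_le (μ := μ) (hb n)) hδ
    refine (pow_le_pow_left₀ (norm_nonneg _) h1 2).trans ?_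
    set A : ℝ := 1 / (m + 1)
    set B := L * G * r n
    have e1 : (A + 3 * (L * G) * r n) = A + 3 * B := by simp only [B]; ring
    have e2 : 9 * (L * G) ^ 2 * r n ^ 2 = (3 * B) ^ 2 := by simp only [B]; ring
    rw [e1, e2]
    nlinarith [sq_nonneg ((A + 3 * B) * ‖R‖ - ‖mulL (fun z : M × N => ind (b n) z.1) kT‖),
      sq_nonneg ((A - 3 * B) * ‖R‖)]
  refine (Finset.sum_le_sum fun n _ => hterm n).trans ?_
  rw [Finset.sum_add_distrib, ← Finset.sum_mul, ← Finset.mul_sum, Finset.sum_add_distrib,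
    ← Finset.mul_sum, ← Finset.mul_sum, Finset.sum_const, Finset.card_range, nsmul_eq_mul]
  have h1 : ∑ n ∈ Finset.range m, ‖mulL (fun z : M × N => ind (b n) z.1) kT‖ ^ 2
      ≤ ‖kT‖ ^ 2 := by
    have := sum_norm_sq_mulL_le (μ := μ.prod ν) (C := 1) (Finset.range m)
      (a := fun n z => ind (b n) z.1) (fun n => (bddMeas_ind (hb n)).comp measurable_fst) kT
      (Eventually.of_forall fun z _ => ?_)
    · simpa using this
    · by_cases hz : ∃ i ∈ Finset.range m, z.1 ∈ b i
      · obtain ⟨i, hi, hzi⟩ := hz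
        rw [Finset.sum_eq_single_of_mem i hi, ind_of_mem hzi, norm_one]
        intro j _ hj
        rw [ind_of_notMem (Set.disjoint_left.mp (hd hj.symm) hzi), norm_zero]
        norm_num
      · push Not at hz
        rw [Finset.sum_eq_zero fun i hi => by rw [ind_of_notMem (hz i hi)]; norm_num]
        norm_num
  have h2 : (m : ℝ) * (1 / (m + 1) : ℝ) ^ 2 ≤ 1 := by
    rw [div_pow, one_pow, mul_one_div, div_le_one (by positivity)]
    nlinarith [(Nat.cast_nonneg m : (0 : ℝ) ≤ m)]
  gcongr

variable [CompactSpace M] [BorelSpace M]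

/-- If the first space has dimension at most two and `S` is Lipschitz in the first variable, then
`|S| ≤ |U|` forces the kernel of `S.mult R` to be dominated by the kernel of `U.mult R`. -/
theorem exists_hasKernel_mult {S : ProjSymbol J M N} {U : ProjSymbol J' M N}
    (hle : ∀ z, ‖S.eval z‖ ≤ ‖U.eval z‖) {L G : ℝ} (hS : S.IsLip L G) {D : Set M}
    (hdim : NormalFamily.DimLE D 2) (hD : μ Dᶜ = 0) {R : Lp ℂ 2 μ →L[ℂ] Lp ℂ 2 ν}
    {k : Lp ℂ 2 (μ.prod ν)} (hk : HasKernel (U.mult R) k) :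
    ∃ k', HasKernel (S.mult R) k' ∧ ‖k'‖ ≤ ‖k‖ := by
  obtain ⟨C, hC0, hcells⟩ := exists_cells hdim hD
  choose m b r hb hd hr hC hμ using fun i : ℕ =>
    hcells (1 / ((i : ℝ) + 1)) Nat.one_div_pos_of_nat
  obtain ⟨T, hT⟩ := exists_hasKernel (mulL (fun z => S.eval z / U.eval z) k)
  have hU := mult_sub_eq_zero hle hk hT
  let ρ : ℕ → Lp ℂ 2 (μ.prod ν) := fun i =>
    mulL S.eval (∑ n ∈ Finset.range (m i), tens (cellVec μ (b i n)) (R (cellVec μ (b i n))))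
  have hρk : ∀ i, HasKernel (S.mult (R ∘L cellProj μ (b i) (m i))) (ρ i) := fun i =>
    S.hasKernel_mult (hasKernel_comp_cellProj R (b i) (m i))
  have hbound := fun i => norm_sq_mulL_eval_sum_le hle hS hT hU (hb i) (hd i)
    (fun n => (hr i n).1) (fun n => (hr i n).2.2) (hC i)
  obtain ⟨l, hl, hltop, k', hk'⟩ := exists_weak_limit (x := ρ) fun i =>
    Real.le_sqrt_of_sq_le (hbound i)
  have hP : ∀ p, Tendsto (fun i => cellProj μ (b i) (m i) p) l (𝓝 p) := fun p =>
    (tendsto_cellProj tendsto_one_div_add_atTop_nhds_zero_nat hb hd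
      (fun i n x hx y hy => ((hr i n).2.2 x hx y hy).trans_lt (hr i n).2.1) hμ p).mono_left hltop
  have hker : HasKernel (S.mult R) k' := fun p q => by
    refine tendsto_nhds_unique (S.tendsto_inner_mult
      (fun i p => norm_cellProj_apply_le (hb i) (hd i) (m i) p) hP R p q) ?_
    refine (hk' (tens p q)).congr fun i => ?_
    rw [hρk i p q]
  -- the weak limit vanishes where `U` does, since `S` vanishes there
  let Z : Set (M × N) := {z | U.eval z = 0}
  have hZ : MeasurableSet Z := U.bddMeas_eval.1 (measurableSet_singleton 0)
  have hSZ : ∀ z ∈ Z, S.eval z = 0 := fun z hz => by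
    have h0 : U.eval z = 0 := hz
    have := hle z
    rwa [h0, norm_zero, norm_le_zero_iff] at this
  have hkZ : mulL (ind Z) k' = 0 := by
    have h1 := hk' (mulL (ind Z) k')
    have h2 : ∀ i, inner ℂ (mulL (ind Z) k') (ρ i) = 0 := fun i => by
      rw [inner_mulL_left (bddMeas_ind hZ)]
      simp_rw [conj_ind]
      simp only [ρ]
      rw [mulL_mulL (bddMeas_ind hZ) S.bddMeas_eval]
      have h3 : (fun z => ind Z z * S.eval z) = fun _ => 0 := by
        funext z
        by_cases hz : z ∈ Z
        · rw [hSZ z hz, mul_zero]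
        · rw [ind_of_notMem hz, zero_mul]
      rw [h3, mulL_const, zero_smul, inner_zero_right]
    simp_rw [h2] at h1
    have h3 := tendsto_nhds_unique h1 tendsto_const_nhds
    rw [← inner_self_eq_zero (𝕜 := ℂ)]
    rw [inner_mulL_right (bddMeas_ind hZ)]
    simp_rw [conj_ind]
    rw [show (fun z => ind Z z) = ind Z from rfl, mulL_ind_idem hZ]
    exact h3
  -- elsewhere it is determined by `U k' = S k`
  have hprod : mulL U.eval k' = mulL S.eval k :=
    (U.hasKernel_mult hker).unique (by rw [mult_comm]; exact S.hasKernel_mult hk)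
  refine ⟨k', hker, ?_⟩
  rw [← one_mul ‖k‖]
  refine Lp.norm_le_mul_norm_of_ae_le_mul ?_
  have e1 := coeFn_mulL U.bddMeas_eval k'
  rw [hprod] at e1
  have e2 := coeFn_mulL (bddMeas_ind hZ) k'
  rw [hkZ] at e2
  filter_upwards [e1, e2, coeFn_mulL S.bddMeas_eval k, Lp.coeFn_zero ℂ 2 (μ.prod ν)]
    with z h1 h2 h3 h4
  by_cases hz : z ∈ Z
  · rw [h4, ind_of_mem hz, one_mul, Pi.zero_apply] at h2
    rw [← h2, norm_zero]
    positivity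
  · have hpos : 0 < ‖U.eval z‖ := norm_pos_iff.mpr hz
    have h5 : ‖U.eval z‖ * ‖k' z‖ ≤ ‖U.eval z‖ * ‖k z‖ := by
      rw [← norm_mul, ← h1, h3, norm_mul]
      exact mul_le_mul_of_nonneg_right (hle z) (norm_nonneg _)
    rw [one_mul]
    exact le_of_mul_le_mul_left h5 hpos

end ProjSymbol

end core

end

noncomputable section

/-! ### Hilbert–Schmidt sums and kernels -/

section hilbertSchmidt

variable {α β : Type*} [MeasurableSpace α] [MeasurableSpace β] {μ : Measure α} {ν : Measure β}
  [IsFiniteMeasure μ] [IsFiniteMeasure ν] {ι κ : Type*}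

theorem orthonormal_tens {e : ι → Lp ℂ 2 μ} {c : κ → Lp ℂ 2 ν} (he : Orthonormal ℂ e)
    (hc : Orthonormal ℂ c) : Orthonormal ℂ fun z : ι × κ => tens (e z.1) (c z.2) := by
  refine ⟨fun z => by rw [norm_tens, he.1, hc.1, one_mul], fun z z' hz => ?_⟩
  change inner ℂ (tens (e z.1) (c z.2)) (tens (e z'.1) (c z'.2)) = 0
  rw [inner_tens_tens]
  by_cases h : z.1 = z'.1
  · rw [hc.2 fun h' => hz (Prod.ext h h'), mul_zero]
  · rw [he.2 (Ne.symm h), zero_mul]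

theorem tsum_enorm_sq_eq_ofReal {ι : Type*} {a : ι → ℂ} (ha : Summable fun i => ‖a i‖ ^ 2) :
    ∑' i, ‖a i‖ₑ ^ 2 = ENNReal.ofReal (∑' i, ‖a i‖ ^ 2) := by
  rw [ENNReal.ofReal_tsum_of_nonneg (fun i => by positivity) ha]
  exact tsum_congr fun i => by rw [ENNReal.ofReal_pow (norm_nonneg _), ofReal_norm]

/-- The Hilbert–Schmidt norm of an operator is at most the norm of its kernel. -/
theorem HasKernel.tsum_le {T : Lp ℂ 2 μ →L[ℂ] Lp ℂ 2 ν} {k : Lp ℂ 2 (μ.prod ν)}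
    (h : HasKernel T k) {e : ι → Lp ℂ 2 μ} {c : κ → Lp ℂ 2 ν} (he : Orthonormal ℂ e)
    (hc : Orthonormal ℂ c) :
    ∑' i, ∑' l, ‖(inner ℂ (c l) (T (e i)) : ℂ)‖ₑ ^ 2 ≤ ‖k‖ₑ ^ 2 := by
  have ho := orthonormal_tens he hc
  rw [← ENNReal.tsum_prod (f := fun i l => ‖(inner ℂ (c l) (T (e i)) : ℂ)‖ₑ ^ 2)]
  simp_rw [h _ _]
  rw [tsum_enorm_sq_eq_ofReal (ho.inner_products_summable k), ← ofReal_norm,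
    ← ENNReal.ofReal_pow (norm_nonneg _)]
  exact ENNReal.ofReal_le_ofReal (ho.tsum_inner_products_le k)

/-- A Hilbert–Schmidt operator between `L²` spaces has a kernel, of the same norm. -/
theorem exists_hasKernel_of_tsum_ne_top {T : Lp ℂ 2 μ →L[ℂ] Lp ℂ 2 ν}
    (e : HilbertBasis ι ℂ (Lp ℂ 2 μ)) (c : HilbertBasis κ ℂ (Lp ℂ 2 ν))
    (hT : ∑' i, ∑' l, ‖(inner ℂ (c l) (T (e i)) : ℂ)‖ₑ ^ 2 ≠ ∞) :
    ∃ k, HasKernel T k ∧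
      ‖k‖ₑ ^ 2 ≤ ∑' i, ∑' l, ‖(inner ℂ (c l) (T (e i)) : ℂ)‖ₑ ^ 2 := by
  have ho := orthonormal_tens e.orthonormal c.orthonormal
  set a : ι × κ → ℂ := fun z => inner ℂ (c z.2) (T (e z.1)) with ha
  rw [← ENNReal.tsum_prod (f := fun i l => ‖(inner ℂ (c l) (T (e i)) : ℂ)‖ₑ ^ 2)] at hT ⊢
  have hs : Summable fun z => ‖a z‖ ^ 2 := by
    have := ENNReal.summable_toReal hT
    simpa [ha] using this
  have hs2 : Summable fun z : ι × κ => a z • tens (e z.1) (c z.2) :=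
    (ho.orthogonalFamily.summable_iff_norm_sq_summable (fun z => a z)).mpr hs
  obtain ⟨k, hk⟩ := hs2
  have hinner : ∀ z : ι × κ, inner ℂ (tens (e z.1) (c z.2)) k = a z := by
    intro z
    refine (hk.mapL (innerSL ℂ (tens (e z.1) (c z.2)))).unique ?_
    convert hasSum_single z fun z' hz' => ?_ using 1
    · rw [innerSL_apply_apply, inner_smul_right, inner_self_eq_norm_sq_to_K, ho.1 z]
      simp
    · rw [innerSL_apply_apply, inner_smul_right, ho.2 (Ne.symm hz'), mul_zero]
  refine ⟨k, ?_, ?_⟩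
  · obtain ⟨T', hT'⟩ := exists_hasKernel k
    have h1 : T' = T := by
      refine ContinuousLinearMap.ext_on (Submodule.dense_iff_topologicalClosure_eq_top.mpr
        e.dense_span) ?_
      rintro _ ⟨i, rfl⟩
      refine c.repr.injective (lp.ext (funext fun l => ?_))
      rw [c.repr_apply_apply, c.repr_apply_apply, hT']
      exact hinner (i, l)
    rwa [← h1]
  · change _ ≤ ∑' z, ‖a z‖ₑ ^ 2
    rw [tsum_enorm_sq_eq_ofReal hs, ← ofReal_norm, ← ENNReal.ofReal_pow (norm_nonneg _)]
    refine ENNReal.ofReal_le_ofReal ?_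
    rw [HasSum, SummationFilter.unconditional_filter] at hk
    refine le_of_tendsto' (hk.norm.pow 2) fun F => ?_
    have h1 := ho.orthogonalFamily.norm_sum a F
    simp only [LinearIsometry.toSpanSingleton_apply] at h1
    rw [h1]
    exact hs.sum_le_tsum F fun _ _ => by positivity

/-- Domination of kernels gives domination of Hilbert–Schmidt norms. -/
theorem tsum_le_tsum_of_hasKernel {T Y : Lp ℂ 2 μ →L[ℂ] Lp ℂ 2 ν}
    (h : ∀ k, HasKernel Y k → ∃ k', HasKernel T k' ∧ ‖k'‖ ≤ ‖k‖)
    (e : HilbertBasis ι ℂ (Lp ℂ 2 μ)) (c : HilbertBasis κ ℂ (Lp ℂ 2 ν)) :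
    ∑' i, ∑' l, ‖(inner ℂ (c l) (T (e i)) : ℂ)‖ₑ ^ 2
      ≤ ∑' i, ∑' l, ‖(inner ℂ (c l) (Y (e i)) : ℂ)‖ₑ ^ 2 := by
  by_cases hY : ∑' i, ∑' l, ‖(inner ℂ (c l) (Y (e i)) : ℂ)‖ₑ ^ 2 = ∞
  · rw [hY]; exact le_top
  obtain ⟨k, hk, hle⟩ := exists_hasKernel_of_tsum_ne_top e c hY
  obtain ⟨k', hk', hkk⟩ := h k hk
  refine (hk'.tsum_le e.orthonormal c.orthonormal).trans (le_trans ?_ hle)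
  gcongr
  exact enorm_le_iff_norm_le.mpr hkk

end hilbertSchmidt

end

noncomputable section

/-! ### Orthonormal bases adapted to orthogonal families -/

section families

variable {H : Type u} [NormedAddCommGroup H] [InnerProductSpace ℂ H] [CompleteSpace H]

/-- Orthonormal bases of the members of a total orthogonal family form an orthonormal basis. -/
theorem OrthogonalFamily.exists_hilbertBasis_sigma {X : Type*} {G : X → Type*}
    [∀ x, NormedAddCommGroup (G x)] [∀ x, InnerProductSpace ℂ (G x)] [∀ x, CompleteSpace (G x)]
    {V : ∀ x, G x →ₗᵢ[ℂ] H} (hV : OrthogonalFamily ℂ G V)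
    (htot : ∀ z : H, (∀ x p, inner ℂ (V x p) z = 0) → z = 0) {ι : X → Type*}
    (b : ∀ x, HilbertBasis (ι x) ℂ (G x)) :
    ∃ c : HilbertBasis (Σ x, ι x) ℂ H, ∀ i, c i = V i.1 (b i.1 i.2) := by
  have ho : Orthonormal ℂ fun i : Σ x, ι x => V i.1 (b i.1 i.2) :=
    hV.orthonormal_sigma_orthonormal fun x => (b x).orthonormal
  refine ⟨HilbertBasis.mkOfOrthogonalEqBot ho ?_, fun i => by
    rw [HilbertBasis.coe_mkOfOrthogonalEqBot]⟩
  rw [Submodule.eq_bot_iff]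
  refine fun z hz => htot z fun x p => ?_
  have h2 : ContinuousLinearMap.adjoint (V x).toContinuousLinearMap z = 0 := by
    refine (b x).repr.injective (lp.ext (funext fun i => ?_))
    rw [HilbertBasis.repr_apply_apply, ContinuousLinearMap.adjoint_inner_right, map_zero]
    exact (Submodule.mem_orthogonal _ _).mp hz _ (Submodule.subset_span ⟨⟨x, i⟩, rfl⟩)
  have h3 := ContinuousLinearMap.adjoint_inner_right (V x).toContinuousLinearMap p z
  rw [h2, inner_zero_right] at h3
  exact h3.symm

/-- Hilbert–Schmidt norms may be compared block by block with respect to two orthogonal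
decompositions of the space. -/
theorem hsNorm_le_of_forall_blocks {X Y : Type*} {G : X → Type*} {G' : Y → Type*}
    [∀ x, NormedAddCommGroup (G x)] [∀ x, InnerProductSpace ℂ (G x)] [∀ x, CompleteSpace (G x)]
    [∀ y, NormedAddCommGroup (G' y)] [∀ y, InnerProductSpace ℂ (G' y)]
    [∀ y, CompleteSpace (G' y)] {V : ∀ x, G x →ₗᵢ[ℂ] H} {W : ∀ y, G' y →ₗᵢ[ℂ] H}
    (hV : OrthogonalFamily ℂ G V) (hVtot : ∀ z : H, (∀ x p, inner ℂ (V x p) z = 0) → z = 0)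
    (hW : OrthogonalFamily ℂ G' W) (hWtot : ∀ z : H, (∀ y q, inner ℂ (W y q) z = 0) → z = 0)
    {ι : X → Type*} (b : ∀ x, HilbertBasis (ι x) ℂ (G x)) {κ : Y → Type*}
    (c : ∀ y, HilbertBasis (κ y) ℂ (G' y)) {T R : H →L[ℂ] H}
    (h : ∀ x y, ∑' i, ∑' l, ‖(inner ℂ (W y (c y l)) (T (V x (b x i))) : ℂ)‖ₑ ^ 2
      ≤ ∑' i, ∑' l, ‖(inner ℂ (W y (c y l)) (R (V x (b x i))) : ℂ)‖ₑ ^ 2) :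
    hsNorm T ≤ hsNorm R := by
  obtain ⟨b', hb'⟩ := hV.exists_hilbertBasis_sigma hVtot b
  obtain ⟨c', hc'⟩ := hW.exists_hilbertBasis_sigma hWtot c
  have key : ∀ Z : H →L[ℂ] H, ∑' i, ‖Z (b' i)‖ₑ ^ 2 = ∑' (x) (y), ∑' i, ∑' l,
      ‖(inner ℂ (W y (c y l)) (Z (V x (b x i))) : ℂ)‖ₑ ^ 2 := by
    intro Z
    rw [ENNReal.tsum_sigma']
    refine tsum_congr fun x => ?_
    rw [ENNReal.tsum_comm]
    refine tsum_congr fun i => ?_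
    rw [← tsum_enorm_sq_basis c', ENNReal.tsum_sigma']
    refine tsum_congr fun y => tsum_congr fun l => ?_
    rw [hb', hc']
  rw [hsNorm_eq b', hsNorm_eq b', key, key]
  refine ENNReal.rpow_le_rpow ?_ (by norm_num)
  exact ENNReal.tsum_le_tsum fun x => ENNReal.tsum_le_tsum fun y => h x y

end families

/-! ### Cyclic subspaces of a normal family -/

namespace NormalFamily

variable {K : Type w} {H : Type u} [NormedAddCommGroup H] [InnerProductSpace ℂ H]
  [CompleteSpace H] (A : NormalFamily K H)

instance instCompactSpaceJointSpectrum : CompactSpace A.jointSpectrum :=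
  isCompact_iff_compactSpace.mp (isCompact_range A.continuous_coord)

instance instIsFiniteMeasureVecMeasure (x : H) : IsFiniteMeasure (A.vecMeasure x) := by
  unfold vecMeasure; infer_instance

/-- The operator `F(A)` for a continuous function `F` on the joint spectrum. -/
def specCalc (F : C(A.jointSpectrum, ℂ)) : H →L[ℂ] H :=
  A.contCalc (F.comp ⟨A.toSpectrum, A.continuous_toSpectrum⟩)

theorem specCalc_add (F G : C(A.jointSpectrum, ℂ)) :
    A.specCalc (F + G) = A.specCalc F + A.specCalc G := by
  simp [specCalc, contCalc, ContinuousMap.add_comp, map_add]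

theorem specCalc_smul (c : ℂ) (F : C(A.jointSpectrum, ℂ)) :
    A.specCalc (c • F) = c • A.specCalc F := by
  simp [specCalc, contCalc, ContinuousMap.smul_comp, map_smul]

theorem specCalc_mul_apply (F G : C(A.jointSpectrum, ℂ)) (x : H) :
    A.specCalc (F * G) x = A.specCalc F (A.specCalc G x) := by
  simp only [specCalc, contCalc, ContinuousMap.mul_comp, map_mul]
  rfl

theorem specCalc_one : A.specCalc 1 = 1 := by
  simp [specCalc, contCalc, ContinuousMap.one_comp]

theorem specCalc_star (F : C(A.jointSpectrum, ℂ)) :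
    A.specCalc (star F) = ContinuousLinearMap.adjoint (A.specCalc F) := by
  rw [← ContinuousLinearMap.star_eq_adjoint]
  have : (star F).comp ⟨A.toSpectrum, A.continuous_toSpectrum⟩
      = star (F.comp ⟨A.toSpectrum, A.continuous_toSpectrum⟩) := rfl
  simp only [specCalc, contCalc, this, map_star]
  rfl

theorem inner_specCalc_right (F : C(A.jointSpectrum, ℂ)) (x y : H) :
    inner ℂ x (A.specCalc F y) = inner ℂ (A.specCalc (star F) x) y := by
  rw [specCalc_star, ContinuousLinearMap.adjoint_inner_left]

theorem integral_vecMeasure (F : C(A.jointSpectrum, ℂ)) (x : H) :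
    ∫ l, F l ∂(A.vecMeasure x) = inner ℂ x (A.specCalc F x) := by
  rw [vecMeasure, integral_map A.continuous_toSpectrum.measurable.aemeasurable
    F.continuous.measurable.aestronglyMeasurable]
  exact A.integral_vecMeasureMax (F.comp ⟨A.toSpectrum, A.continuous_toSpectrum⟩) x

theorem norm_specCalc_apply (F : C(A.jointSpectrum, ℂ)) (x : H) :
    ‖A.specCalc F x‖ = ‖ContinuousMap.toLp 2 (A.vecMeasure x) ℂ F‖ := by
  have h1 : inner ℂ (A.specCalc F x) (A.specCalc F x)
      = inner ℂ (ContinuousMap.toLp 2 (A.vecMeasure x) ℂ F)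
        (ContinuousMap.toLp 2 (A.vecMeasure x) ℂ F) := by
    rw [inner_specCalc_right, ← specCalc_mul_apply, ContinuousMap.inner_toLp,
      ← inner_conj_symm, ← integral_vecMeasure, ← integral_conj]
    refine integral_congr_ae (Eventually.of_forall fun l => ?_)
    simp
  rw [inner_self_eq_norm_sq_to_K, inner_self_eq_norm_sq_to_K] at h1
  have h2 : ‖A.specCalc F x‖ ^ 2 = ‖ContinuousMap.toLp 2 (A.vecMeasure x) ℂ F‖ ^ 2 := by
    exact_mod_cast h1
  exact (pow_left_inj₀ (norm_nonneg _) (norm_nonneg _) two_ne_zero).mp h2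

theorem denseRange_toLp (x : H) :
    DenseRange (ContinuousMap.toLp 2 (A.vecMeasure x) ℂ :
      C(A.jointSpectrum, ℂ) → Lp ℂ 2 (A.vecMeasure x)) :=
  ContinuousMap.toLp_denseRange ℂ _ ℂ (by norm_num)

/-- The map `F ↦ F(A) x`. -/
def orbitMap (x : H) : C(A.jointSpectrum, ℂ) →ₗ[ℂ] H where
  toFun F := A.specCalc F x
  map_add' F G := by rw [specCalc_add]; rfl
  map_smul' c F := by rw [specCalc_smul]; rfl

/-- The extension of `F ↦ F(A) x` to `L²(μ_x)`, an isometry onto the cyclic subspace of `x`. -/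
def cyclicCLM (x : H) : Lp ℂ 2 (A.vecMeasure x) →L[ℂ] H :=
  (A.orbitMap x).extendOfNorm
    ((ContinuousMap.toLp 2 (A.vecMeasure x) ℂ : C(A.jointSpectrum, ℂ) →L[ℂ] _) :
      C(A.jointSpectrum, ℂ) →ₗ[ℂ] Lp ℂ 2 (A.vecMeasure x))

theorem cyclicCLM_toLp (x : H) (F : C(A.jointSpectrum, ℂ)) :
    A.cyclicCLM x (ContinuousMap.toLp 2 (A.vecMeasure x) ℂ F) = A.specCalc F x :=
  LinearMap.extendOfNorm_eq (A.denseRange_toLp x)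
    ⟨1, fun F => by rw [one_mul]; exact (A.norm_specCalc_apply F x).le⟩ F

/-- The isometry `L²(μ_x) → H` onto the cyclic subspace of `x`. -/
def cyclicMap (x : H) : Lp ℂ 2 (A.vecMeasure x) →ₗᵢ[ℂ] H where
  toLinearMap := A.cyclicCLM x
  norm_map' p := by
    refine (A.denseRange_toLp x).induction_on (p := fun p => ‖A.cyclicCLM x p‖ = ‖p‖) p
      (isClosed_eq (by fun_prop) (by fun_prop)) fun F => ?_
    rw [cyclicCLM_toLp, norm_specCalc_apply]

theorem cyclicMap_toLp (x : H) (F : C(A.jointSpectrum, ℂ)) :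
    A.cyclicMap x (ContinuousMap.toLp 2 (A.vecMeasure x) ℂ F) = A.specCalc F x :=
  A.cyclicCLM_toLp x F

theorem cyclicMap_one (x : H) : A.cyclicMap x (ContinuousMap.toLp 2 (A.vecMeasure x) ℂ 1) = x := by
  rw [cyclicMap_toLp, specCalc_one]; rfl

theorem bddMeas_continuousMap (F : C(A.jointSpectrum, ℂ)) : BddMeas F :=
  ⟨F.continuous.measurable, ‖F‖, F.norm_coe_le_norm⟩

theorem specCalc_cyclicMap (x : H) (F : C(A.jointSpectrum, ℂ)) (p : Lp ℂ 2 (A.vecMeasure x)) :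
    A.specCalc F (A.cyclicMap x p) = A.cyclicMap x (mulL F p) := by
  refine (A.denseRange_toLp x).induction_on
    (p := fun p => A.specCalc F (A.cyclicMap x p) = A.cyclicMap x (mulL F p)) p
    (isClosed_eq ((A.specCalc F).continuous.comp (A.cyclicMap x).continuous)
      ((A.cyclicMap x).continuous.comp (mulL F).continuous)) fun G => ?_
  have : mulL F (ContinuousMap.toLp 2 (A.vecMeasure x) ℂ G)
      = ContinuousMap.toLp 2 (A.vecMeasure x) ℂ (F * G) := by
    refine Lp.ext ?_
    filter_upwards [coeFn_mulL (A.bddMeas_continuousMap F)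
      (ContinuousMap.toLp 2 (A.vecMeasure x) ℂ G),
      ContinuousMap.coeFn_toLp (p := 2) (𝕜 := ℂ) (A.vecMeasure x) G,
      ContinuousMap.coeFn_toLp (p := 2) (𝕜 := ℂ) (A.vecMeasure x) (F * G)] with l h1 h2 h3
    rw [h1, h2, h3, ContinuousMap.mul_apply]
  rw [this, cyclicMap_toLp, cyclicMap_toLp, specCalc_mul_apply]

theorem inner_mulL_self {μ : Measure A.jointSpectrum} {f : A.jointSpectrum → ℂ} (hf : BddMeas f)
    (p : Lp ℂ 2 μ) : inner ℂ p (mulL f p) = ∫ l, (‖p l‖₊ ^ 2) • f l ∂μ := by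
  rw [L2.inner_def]
  refine integral_congr_ae ?_
  filter_upwards [coeFn_mulL hf p] with l hl
  rw [hl, RCLike.inner_apply, mul_assoc, Complex.mul_conj, Complex.normSq_eq_norm_sq, NNReal.smul_def,
    Complex.real_smul, mul_comm]
  push_cast
  rfl

/-- The scalar spectral measure of `V p + x'`, where `V` is the isometry onto the cyclic subspace
of `x` and `x'` is orthogonal to that subspace, is `|p|² μ_x + μ_{x'}`. -/
theorem vecMeasure_add (x : H) (p : Lp ℂ 2 (A.vecMeasure x)) (x' : H)
    (hx' : ∀ q, inner ℂ (A.cyclicMap x q) x' = 0) :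
    A.vecMeasure (A.cyclicMap x p + x')
      = (A.vecMeasure x).withDensity (fun l => ((‖p l‖₊ ^ 2 : ℝ≥0) : ℝ≥0∞)) + A.vecMeasure x' := by
  have hdens : AEMeasurable (fun l => ‖p l‖₊ ^ 2) (A.vecMeasure x) :=
    (Lp.aestronglyMeasurable p).aemeasurable.nnnorm.pow_const 2
  have hfin : IsFiniteMeasure
      ((A.vecMeasure x).withDensity fun l => ((‖p l‖₊ ^ 2 : ℝ≥0) : ℝ≥0∞)) := by
    refine isFiniteMeasure_withDensity ?_
    have := (integrable_norm_sq p).2.ne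
    simpa [enorm_pow, enorm_eq_nnnorm] using this
  refine ext_of_forall_integral_eq_of_IsFiniteMeasure fun F => ?_
  let Fc : C(A.jointSpectrum, ℂ) := ⟨fun l => (F l : ℂ), by fun_prop⟩
  have key : ∫ l, Fc l ∂(A.vecMeasure (A.cyclicMap x p + x'))
      = inner ℂ p (mulL Fc p) + ∫ l, Fc l ∂(A.vecMeasure x') := by
    rw [integral_vecMeasure, integral_vecMeasure, map_add, inner_add_left, inner_add_right,
      inner_add_right, specCalc_cyclicMap, LinearIsometry.inner_map_map, A.inner_specCalc_right Fc
      (A.cyclicMap x p) x', specCalc_cyclicMap, hx', ← inner_conj_symm x', hx', map_zero]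
    ring
  rw [A.inner_mulL_self (A.bddMeas_continuousMap Fc),
    ← integral_withDensity_eq_integral_smul₀ hdens] at key
  simp only [Fc, ContinuousMap.coe_mk, integral_complex_ofReal] at key
  rw [integral_add_measure (F.integrable _) (F.integrable _)]
  exact_mod_cast key

/-- On a cyclic subspace, the Borel functional calculus acts by multiplication. The operator which
acts as multiplication by `f` on the cyclic subspace and as the compression of `f(A)` on its
orthogonal complement has the quadratic form `z ↦ ∫ f dμ_z`, because `μ_z` splits accordingly;
by uniqueness it is `f(A)`. -/
theorem borelCalc_cyclicMap {f : A.jointSpectrum → ℂ} (hf : BddMeas f) (x : H)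
    (p : Lp ℂ 2 (A.vecMeasure x)) :
    A.borelCalc f (A.cyclicMap x p) = A.cyclicMap x (mulL f p) := by
  set V : Lp ℂ 2 (A.vecMeasure x) →L[ℂ] H := (A.cyclicMap x).toContinuousLinearMap with hV
  have hVV : ∀ q, ContinuousLinearMap.adjoint V (V q) = q := fun q =>
    ext_inner_left ℂ fun q' => by
      rw [ContinuousLinearMap.adjoint_inner_right]
      exact (A.cyclicMap x).inner_map_map q' q
  -- the orthogonal projection onto the complement of the cyclic subspace
  set Q : H →L[ℂ] H := 1 - V ∘L ContinuousLinearMap.adjoint V with hQ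
  have hQV : ∀ q, Q (V q) = 0 := fun q => by
    simp [hQ, hVV]
  have hVQ : ∀ q z, inner ℂ (V q) (Q z) = 0 := fun q z => by
    rw [hQ, sub_apply, inner_sub_right, ContinuousLinearMap.comp_apply,
      ← ContinuousLinearMap.adjoint_inner_left V, hVV, ContinuousLinearMap.adjoint_inner_right]
    simp
  have hdec : ∀ z, z = V (ContinuousLinearMap.adjoint V z) + Q z := fun z => by
    simp [hQ]
  have hQs : ∀ z z', inner ℂ z (Q z') = inner ℂ (Q z) (Q z') := fun z z' => by
    conv_lhs => rw [hdec z]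
    rw [inner_add_left, hVQ, zero_add]
  obtain ⟨hfm, C, hC⟩ := hf
  have hfi : ∀ (m : Measure A.jointSpectrum) [IsFiniteMeasure m], Integrable f m := fun m _ =>
    Integrable.of_bound hfm.aestronglyMeasurable C (Eventually.of_forall hC)
  have hG := A.borelCalc_eq (f := f)
    (T := V ∘L mulL f ∘L ContinuousLinearMap.adjoint V + Q ∘L A.borelCalc f ∘L Q) fun z => by
      have hdens : AEMeasurable (fun l => ‖ContinuousLinearMap.adjoint V z l‖₊ ^ 2)
          (A.vecMeasure x) :=
        (Lp.aestronglyMeasurable _).aemeasurable.nnnorm.pow_const 2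
      have hm := A.vecMeasure_add x (ContinuousLinearMap.adjoint V z) (Q z) fun q => hVQ q z
      rw [show A.cyclicMap x (ContinuousLinearMap.adjoint V z) + Q z = z from (hdec z).symm] at hm
      have hfin : IsFiniteMeasure ((A.vecMeasure x).withDensity
          fun l => ((‖ContinuousLinearMap.adjoint V z l‖₊ ^ 2 : ℝ≥0) : ℝ≥0∞)) := by
        refine isFiniteMeasure_of_le (A.vecMeasure z) ?_
        rw [hm]
        exact Measure.le_add_right le_rfl
      rw [hm, integral_add_measure (hfi _) (hfi _),
        integral_withDensity_eq_integral_smul₀ hdens, ← A.inner_mulL_self ⟨hfm, C, hC⟩,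
        ← A.inner_borelCalc hfm hC, add_apply, inner_add_right]
      simp only [ContinuousLinearMap.comp_apply]
      rw [hQs, ← hQs, ← ContinuousLinearMap.adjoint_inner_left V]
      congr 1
      conv_lhs => rw [hQs]
      have h1 : ∀ y, inner ℂ (Q z) (Q y) = inner ℂ (Q z) y := fun y => by
        conv_rhs => rw [hdec y]
        rw [inner_add_right, ← inner_conj_symm (Q z) (V _), hVQ, map_zero, zero_add]
      rw [h1]
  change A.borelCalc f (V p) = V (mulL f p)
  rw [hG, add_apply]
  simp only [ContinuousLinearMap.comp_apply]
  rw [hQV, hVV, map_zero, map_zero, add_zero]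

theorem norm_borelCalc_le {f : A.jointSpectrum → ℂ} (hf : Measurable f) {C : ℝ} (hC0 : 0 ≤ C)
    (hC : ∀ l, ‖f l‖ ≤ C) : ‖A.borelCalc f‖ ≤ C := by
  refine ContinuousLinearMap.opNorm_le_bound _ hC0 fun x => ?_
  have h1 := A.borelCalc_cyclicMap ⟨hf, C, hC⟩ x (ContinuousMap.toLp 2 (A.vecMeasure x) ℂ 1)
  have h2 := norm_mulL_apply_le_of_forall hf hC (ContinuousMap.toLp 2 (A.vecMeasure x) ℂ 1)
  have h3 := (A.cyclicMap x).norm_map (ContinuousMap.toLp 2 (A.vecMeasure x) ℂ 1)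
  rw [cyclicMap_one] at h1 h3
  rw [h1, LinearIsometry.norm_map, h3]
  exact h2

/-! ### Decomposition into cyclic subspaces -/

/-- The set `s` consists of vectors generating mutually orthogonal cyclic subspaces. -/
def IsCyclicOrthogonal (s : Set H) : Prop :=
  s.Pairwise fun x y => ∀ F : C(A.jointSpectrum, ℂ), inner ℂ x (A.specCalc F y) = 0

theorem exists_maximal_isCyclicOrthogonal :
    ∃ s : Set H, Maximal A.IsCyclicOrthogonal s := by
  refine zorn_subset {s | A.IsCyclicOrthogonal s} fun c hc hchain => ⟨⋃₀ c, ?_, fun s hs =>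
    Set.subset_sUnion_of_mem hs⟩
  exact (Set.pairwise_sUnion hchain.directedOn).mpr fun s hs => hc hs

theorem IsCyclicOrthogonal.orthogonalFamily {s : Set H} (hs : A.IsCyclicOrthogonal s) :
    OrthogonalFamily ℂ (fun x : s => Lp ℂ 2 (A.vecMeasure x)) fun x => A.cyclicMap x := by
  intro x y hxy p q
  have hne : (x : H) ≠ y := fun h => hxy (Subtype.ext h)
  refine (A.denseRange_toLp x).induction_on
    (p := fun p => inner ℂ (A.cyclicMap x p) (A.cyclicMap y q) = 0) p
    (isClosed_eq ((A.cyclicMap x).continuous.inner continuous_const) continuous_const) fun F => ?_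
  refine (A.denseRange_toLp y).induction_on
    (p := fun q => inner ℂ (A.cyclicMap x (ContinuousMap.toLp 2 (A.vecMeasure x) ℂ F))
      (A.cyclicMap y q) = 0) q
    (isClosed_eq (continuous_const.inner (A.cyclicMap y).continuous) continuous_const) fun G => ?_
  rw [cyclicMap_toLp, cyclicMap_toLp, ← star_star F, ← inner_specCalc_right,
    ← specCalc_mul_apply]
  exact hs x.2 y.2 hne _

/-- The space is the orthogonal sum of cyclic subspaces. -/
theorem exists_cyclic_decomposition : ∃ s : Set H,
    OrthogonalFamily ℂ (fun x : s => Lp ℂ 2 (A.vecMeasure x)) (fun x => A.cyclicMap x) ∧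
      ∀ z, (∀ (x : s) p, inner ℂ (A.cyclicMap x p) z = 0) → z = 0 := by
  obtain ⟨s, hs⟩ := A.exists_maximal_isCyclicOrthogonal
  refine ⟨s, IsCyclicOrthogonal.orthogonalFamily A hs.prop, fun z h1 => ?_⟩
  have h4 : ∀ x ∈ s, ∀ F, inner ℂ (A.specCalc F x) z = 0 := fun x hx F => by
    rw [← cyclicMap_toLp]; exact h1 ⟨x, hx⟩ _
  have h5 : A.IsCyclicOrthogonal (insert z s) := by
    refine hs.prop.insert fun x hx _ => ⟨fun F => ?_, fun F => ?_⟩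
    · rw [← inner_conj_symm, h4 x hx, map_zero]
    · rw [inner_specCalc_right, h4 x hx]
  have h6 : z ∈ s := hs.le_of_ge h5 (Set.subset_insert z s) (Set.mem_insert z s)
  have h7 := h4 z h6 1
  rw [specCalc_one] at h7
  exact inner_self_eq_zero.mp h7

theorem vecMeasure_eq_zero_of_spectralProj {D : Set A.jointSpectrum} (hD : MeasurableSet D)
    (h : A.spectralProj D = 0) (x : H) : A.vecMeasure x D = 0 := by
  have h1 := A.inner_borelCalc (f := D.indicator fun _ => 1) (measurable_const.indicator hD)
    (C := 1) (norm_ind_le D) x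
  rw [show A.borelCalc (D.indicator fun _ => 1) = 0 from h, zero_apply, inner_zero_right,
    integral_indicator hD, setIntegral_const, Complex.real_smul, mul_one] at h1
  have h2 : (A.vecMeasure x).real D = 0 := by exact_mod_cast h1.symm
  exact (measureReal_eq_zero_iff).mp h2

end NormalFamily

/-! ### Multiplication operators -/

section multOp

variable {K : Type w} {H : Type u} [NormedAddCommGroup H] [InnerProductSpace ℂ H]
  [CompleteSpace H] (A B : NormalFamily K H) {J J' : Type*}

theorem summable_borelCalc_comp (S : ProjSymbol J A.jointSpectrum B.jointSpectrum)
    (X : H →L[ℂ] H) :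
    Summable fun j => B.borelCalc (S.right j) ∘L X ∘L A.borelCalc (S.left j) := by
  refine Summable.of_norm_bounded (S.summable.mul_left ‖X‖) fun j => ?_
  have h1 := A.norm_borelCalc_le (S.measurable_left j) (S.bl_nonneg j) (S.norm_left_le j)
  have h2 := B.norm_borelCalc_le (S.measurable_right j) (S.br_nonneg j) (S.norm_right_le j)
  refine (ContinuousLinearMap.opNorm_comp_le _ _).trans ?_
  refine (mul_le_mul h2 ((ContinuousLinearMap.opNorm_comp_le _ _).trans
    (mul_le_mul_of_nonneg_left h1 (norm_nonneg _))) (norm_nonneg _) (S.br_nonneg j)).trans_eq ?_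
  ring

/-- The block of `X` between two cyclic subspaces. -/
def cyclicBlock (X : H →L[ℂ] H) (x y : H) :
    Lp ℂ 2 (A.vecMeasure x) →L[ℂ] Lp ℂ 2 (B.vecMeasure y) :=
  ContinuousLinearMap.adjoint (B.cyclicMap y).toContinuousLinearMap ∘L X ∘L
    (A.cyclicMap x).toContinuousLinearMap

theorem inner_cyclicBlock (X : H →L[ℂ] H) (x y : H) (p : Lp ℂ 2 (A.vecMeasure x))
    (q : Lp ℂ 2 (B.vecMeasure y)) :
    inner ℂ q (cyclicBlock A B X x y p) = inner ℂ (B.cyclicMap y q) (X (A.cyclicMap x p)) := by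
  rw [cyclicBlock, ContinuousLinearMap.comp_apply, ContinuousLinearMap.adjoint_inner_right]
  rfl

theorem NormalFamily.adjoint_borelCalc {f : B.jointSpectrum → ℂ} (hf : BddMeas f) :
    ContinuousLinearMap.adjoint (B.borelCalc f) = B.borelCalc fun l => starRingEnd ℂ (f l) := by
  obtain ⟨hfm, C, hC⟩ := hf
  refine (B.borelCalc_eq fun x => ?_).symm
  rw [ContinuousLinearMap.adjoint_inner_right, ← inner_conj_symm, B.inner_borelCalc hfm hC,
    ← integral_conj]

theorem inner_borelCalc_left {f : B.jointSpectrum → ℂ} (hf : BddMeas f) (y z : H)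
    (q : Lp ℂ 2 (B.vecMeasure y)) : inner ℂ (B.cyclicMap y q) (B.borelCalc f z)
      = inner ℂ (B.cyclicMap y (mulL (fun l => starRingEnd ℂ (f l)) q)) z := by
  rw [← ContinuousLinearMap.adjoint_inner_left, B.adjoint_borelCalc hf, B.borelCalc_cyclicMap hf.conj]

/-- On blocks, multiplication operators are multipliers of symbols. -/
theorem cyclicBlock_multOp (S : ProjSymbol J A.jointSpectrum B.jointSpectrum) (X : H →L[ℂ] H)
    (x y : H) :
    cyclicBlock A B (multOp (fun j => B.borelCalc (S.right j)) (fun j => A.borelCalc (S.left j)) X)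
      x y = S.mult (cyclicBlock A B X x y) := by
  refine ContinuousLinearMap.ext fun p => ext_inner_left ℂ fun q => ?_
  rw [inner_cyclicBlock]
  have h1 := (hasSum_clm_apply (summable_borelCalc_comp A B S X).hasSum
    (A.cyclicMap x p)).mapL (innerSL ℂ (B.cyclicMap y q))
  have h2 := (S.hasSum_mult_apply (cyclicBlock A B X x y) p).mapL (innerSL ℂ q)
  refine h1.unique (h2.congr_fun fun j => ?_)
  simp only [innerSL_apply_apply, ContinuousLinearMap.comp_apply]
  rw [inner_borelCalc_left B (S.bddMeas_right j), A.borelCalc_cyclicMap (S.bddMeas_left j),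
    inner_mulL_right (S.bddMeas_right j), inner_cyclicBlock]

/-- The comparison theorem for multiplication operators: `|S| ≤ |U|` on the product of the joint
spectra gives the inequality of the Hilbert–Schmidt norms, if `S` is Lipschitz in the first
variable and the essential dimension of the first family is at most two. -/
theorem hsNorm_multOp_le (hA : A.EssDimLE 2)
    {S : ProjSymbol J A.jointSpectrum B.jointSpectrum}
    {U : ProjSymbol J' A.jointSpectrum B.jointSpectrum}
    (hle : ∀ z, ‖S.eval z‖ ≤ ‖U.eval z‖) {L G : ℝ} (hS : S.IsLip L G) (X : H →L[ℂ] H) :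
    hsNorm (multOp (fun j => B.borelCalc (S.right j)) (fun j => A.borelCalc (S.left j)) X)
      ≤ hsNorm (multOp (fun j => B.borelCalc (U.right j)) (fun j => A.borelCalc (U.left j)) X) := by
  obtain ⟨D, hDm, hD, hdim⟩ := hA
  obtain ⟨s, hs, hstot⟩ := A.exists_cyclic_decomposition
  obtain ⟨t, ht, httot⟩ := B.exists_cyclic_decomposition
  refine hsNorm_le_of_forall_blocks hs hstot ht httot
    (fun x => stdBasis (Lp ℂ 2 (A.vecMeasure x))) (fun y => stdBasis (Lp ℂ 2 (B.vecMeasure y)))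
    fun x y => ?_
  have h1 := tsum_le_tsum_of_hasKernel (T := S.mult (cyclicBlock A B X x y))
    (Y := U.mult (cyclicBlock A B X x y))
    (fun k hk => ProjSymbol.exists_hasKernel_mult hle hS hdim
      (A.vecMeasure_eq_zero_of_spectralProj hDm.compl hD x) hk)
    (stdBasis (Lp ℂ 2 (A.vecMeasure x))) (stdBasis (Lp ℂ 2 (B.vecMeasure y)))
  simp_rw [← cyclicBlock_multOp, inner_cyclicBlock] at h1
  exact h1

end multOp

end

noncomputable section

/-! ### The coordinate symbol -/

/-- The symbol with complex conjugate factors. -/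
def ProjSymbol.conj {J α β : Type*} [MeasurableSpace α] [MeasurableSpace β]
    (S : ProjSymbol J α β) : ProjSymbol J α β where
  left j x := starRingEnd ℂ (S.left j x)
  right j y := starRingEnd ℂ (S.right j y)
  bl := S.bl
  br := S.br
  bl_nonneg := S.bl_nonneg
  br_nonneg := S.br_nonneg
  measurable_left j := Complex.continuous_conj.measurable.comp (S.measurable_left j)
  measurable_right j := Complex.continuous_conj.measurable.comp (S.measurable_right j)
  norm_left_le j x := by simpa using S.norm_left_le j x
  norm_right_le j y := by simpa using S.norm_right_le j y
  summable := S.summable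

theorem ProjSymbol.norm_eval_conj {J α β : Type*} [MeasurableSpace α] [MeasurableSpace β]
    (S : ProjSymbol J α β) (z : α × β) : ‖S.conj.eval z‖ = ‖S.eval z‖ := by
  have h : S.conj.eval z = starRingEnd ℂ (S.eval z) := by
    refine (S.conj.hasSum_eval z).unique ?_
    simpa [ProjSymbol.conj, Function.comp_def] using
      (S.hasSum_eval z).map (starRingEnd ℂ) Complex.continuous_conj
  rw [h, RCLike.norm_conj]

theorem ProjSymbol.IsLip.conj {J M N : Type*} [MetricSpace M] [MeasurableSpace M]
    [MeasurableSpace N] {S : ProjSymbol J M N} {L G : ℝ} (h : S.IsLip L G) :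
    S.conj.IsLip L G where
  left_nonneg := h.left_nonneg
  right_nonneg := h.right_nonneg
  left_le F x x' := by simpa [ProjSymbol.conj, ← map_sub] using h.left_le F x x'
  right_le F y := by simpa [ProjSymbol.conj] using h.right_le F y

namespace NormalFamily

variable {K : Type w} {H : Type u} [NormedAddCommGroup H] [InnerProductSpace ℂ H]
  [CompleteSpace H] (A B : NormalFamily K H)

/-- The coordinate function on the joint spectrum. -/
def coordFn (k : K) : C(A.jointSpectrum, ℂ) where
  toFun l := (l : EllTwo K) k
  continuous_toFun := by
    have h1 : LipschitzWith 1 fun l : EllTwo K => (l : K → ℂ) k :=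
      LipschitzWith.of_dist_le_mul fun l l' => by
        rw [dist_eq_norm, dist_eq_norm, NNReal.coe_one, one_mul]
        exact lp.norm_apply_le_norm (by norm_num) (l - l') k
    exact h1.continuous.comp continuous_subtype_val

theorem specCalc_coordFn (k : K) : A.specCalc (A.coordFn k) = A.op k := by
  have h : (A.coordFn k).comp ⟨A.toSpectrum, A.continuous_toSpectrum⟩
      = gelfandStarTransform A.cstar (A.gen k) := by
    ext t; rfl
  rw [specCalc, contCalc, h, StarAlgEquiv.symm_apply_apply]
  rfl

theorem borelCalc_coordFn (k : K) : A.borelCalc (A.coordFn k) = A.op k :=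
  A.borelCalc_eq fun x => by rw [integral_vecMeasure, specCalc_coordFn]

theorem norm_coordFn_le (k : K) (l : A.jointSpectrum) : ‖A.coordFn k l‖ ≤ ‖A.op k‖ := by
  obtain ⟨-, t, rfl⟩ := l
  exact A.norm_char_le t k

/-- The symbol `∑ₖ xₖ yₖ` of the operator `X ↦ ∑ₖ Bₖ X Aₖ`. -/
def coordSymbol : ProjSymbol K A.jointSpectrum B.jointSpectrum where
  left k := A.coordFn k
  right k := B.coordFn k
  bl k := ‖A.op k‖
  br k := ‖B.op k‖
  bl_nonneg _ := norm_nonneg _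
  br_nonneg _ := norm_nonneg _
  measurable_left k := (A.coordFn k).continuous.measurable
  measurable_right k := (B.coordFn k).continuous.measurable
  norm_left_le := A.norm_coordFn_le
  norm_right_le := B.norm_coordFn_le
  summable := Summable.of_nonneg_of_le (fun _ => by positivity)
    (fun k => by
      have h := two_mul_le_add_sq (‖A.op k‖) (‖B.op k‖)
      have h' := mul_nonneg (norm_nonneg (A.op k)) (norm_nonneg (B.op k))
      linarith) (A.summable_sq.add B.summable_sq)

theorem isLip_coordSymbol : (coordSymbol A B).IsLip 1 (√(∑' k, ‖B.op k‖ ^ 2)) where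
  left_nonneg := zero_le_one
  right_nonneg := Real.sqrt_nonneg _
  left_le F l l' := by
    have h := lp.sum_rpow_le_norm_rpow (p := 2) (by norm_num) ((l : EllTwo K) - (l' : EllTwo K)) F
    simp only [ENNReal.toReal_ofNat, Real.rpow_two] at h
    rw [one_mul, Subtype.dist_eq, dist_eq_norm]
    exact h
  right_le F m := by
    rw [Real.sq_sqrt (tsum_nonneg fun _ => by positivity)]
    exact (Finset.sum_le_sum fun k _ => pow_le_pow_left₀ (norm_nonneg _)
      (B.norm_coordFn_le k m) 2).trans (B.summable_sq.sum_le_tsum F fun _ _ => by positivity)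

end NormalFamily

/-! ### Symbols built from functions of finite norm -/

theorem norm_le_toReal_supNorm {M : Type*} {f : M → ℂ} (hf : supNorm f ≠ ∞) (x : M) :
    ‖f x‖ ≤ (supNorm f).toReal := by
  rw [← toReal_enorm]
  exact ENNReal.toReal_mono hf (le_iSup (fun x => ‖f x‖ₑ) x)

theorem norm_sub_le_toReal_lipNorm {M : Type*} [MetricSpace M] {f : M → ℂ} (hf : lipNorm f ≠ ∞)
    (x y : M) : ‖f x - f y‖ ≤ (lipNorm f).toReal * dist x y := by
  rcases eq_or_ne x y with rfl | hxy
  · simp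
  have h1 : edist (f x) (f y) / edist x y ≤ lipNorm f :=
    (le_iSup₂ (f := fun x y => edist (f x) (f y) / edist x y) x y).trans le_add_self
  rw [ENNReal.div_le_iff (edist_pos.mpr hxy).ne' (edist_ne_top x y)] at h1
  have h2 := ENNReal.toReal_mono (ENNReal.mul_ne_top hf (edist_ne_top x y)) h1
  rwa [ENNReal.toReal_mul, ← dist_edist, ← dist_edist, dist_eq_norm] at h2

theorem summable_sq_toReal {J : Type*} {a : J → ℝ≥0∞} (ha : ∑' j, a j ^ 2 < ∞) :
    Summable fun j => (a j).toReal ^ 2 := by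
  simpa using ENNReal.summable_toReal ha.ne

theorem ne_top_of_tsum_sq_lt_top {J : Type*} {a : J → ℝ≥0∞} (ha : ∑' j, a j ^ 2 < ∞) (j : J) :
    a j ≠ ∞ := by
  intro h
  have := ENNReal.ne_top_of_tsum_ne_top ha.ne j
  rw [h] at this
  exact this (by simp)

/-- The symbol of functions with summable products of supremum norms. -/
def ProjSymbol.ofSupNorm {J α β : Type*} [MeasurableSpace α] [MeasurableSpace β]
    (f : J → α → ℂ) (g : J → β → ℂ) (hf : ∀ j, Measurable (f j)) (hg : ∀ j, Measurable (g j))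
    (hf' : ∀ j, supNorm (f j) ≠ ∞) (hg' : ∀ j, supNorm (g j) ≠ ∞)
    (hs : Summable fun j => (supNorm (f j)).toReal * (supNorm (g j)).toReal) :
    ProjSymbol J α β where
  left := f
  right := g
  bl j := (supNorm (f j)).toReal
  br j := (supNorm (g j)).toReal
  bl_nonneg _ := ENNReal.toReal_nonneg
  br_nonneg _ := ENNReal.toReal_nonneg
  measurable_left := hf
  measurable_right := hg
  norm_left_le j := norm_le_toReal_supNorm (hf' j)
  norm_right_le j := norm_le_toReal_supNorm (hg' j)
  summable := hs

theorem supNorm_le_lipNorm {M : Type*} [MetricSpace M] (f : M → ℂ) : supNorm f ≤ lipNorm f :=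
  le_self_add

theorem measurable_of_lipNorm_ne_top {M : Type*} [MetricSpace M] [MeasurableSpace M]
    [BorelSpace M] {f : M → ℂ} (hf : lipNorm f ≠ ∞) : Measurable f := by
  have : LipschitzWith (lipNorm f).toNNReal f := LipschitzWith.of_dist_le_mul fun x y => by
    rw [dist_eq_norm]; exact norm_sub_le_toReal_lipNorm hf x y
  exact this.continuous.measurable

theorem ProjSymbol.isLip_ofSupNorm {J M N : Type*} [MetricSpace M] [MeasurableSpace M]
    [MeasurableSpace N] {f : J → M → ℂ} {g : J → N → ℂ}
    {hf : ∀ j, Measurable (f j)} {hg : ∀ j, Measurable (g j)}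
    {hf' : ∀ j, supNorm (f j) ≠ ∞} {hg' : ∀ j, supNorm (g j) ≠ ∞}
    {hs : Summable fun j => (supNorm (f j)).toReal * (supNorm (g j)).toReal}
    (hL : ∑' j, lipNorm (f j) ^ 2 < ∞) (hG : ∑' j, supNorm (g j) ^ 2 < ∞) :
    (ProjSymbol.ofSupNorm f g hf hg hf' hg' hs).IsLip
      (√(∑' j, (lipNorm (f j)).toReal ^ 2)) (√(∑' j, (supNorm (g j)).toReal ^ 2)) where
  left_nonneg := Real.sqrt_nonneg _
  right_nonneg := Real.sqrt_nonneg _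
  left_le F x x' := by
    rw [mul_pow, Real.sq_sqrt (tsum_nonneg fun _ => by positivity)]
    calc _ ≤ ∑ j ∈ F, (lipNorm (f j)).toReal ^ 2 * dist x x' ^ 2 := by
          refine Finset.sum_le_sum fun j _ => ?_
          rw [← mul_pow]
          exact pow_le_pow_left₀ (norm_nonneg _)
            (norm_sub_le_toReal_lipNorm (ne_top_of_tsum_sq_lt_top hL j) x x') 2
      _ ≤ _ := by
          rw [← Finset.sum_mul]
          exact mul_le_mul_of_nonneg_right
            ((summable_sq_toReal hL).sum_le_tsum F fun _ _ => by positivity) (by positivity)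
  right_le F y := by
    rw [Real.sq_sqrt (tsum_nonneg fun _ => by positivity)]
    exact (Finset.sum_le_sum fun j _ => pow_le_pow_left₀ (norm_nonneg _)
      (norm_le_toReal_supNorm (hg' j) y) 2).trans
      ((summable_sq_toReal hG).sum_le_tsum F fun _ _ => by positivity)

end


theorem corollary9p2 {H : Type u} [NormedAddCommGroup H] [InnerProductSpace ℂ H]
    [CompleteSpace H] {K : Type w} (A B : NormalFamily K H) (hA : A.EssDimLE 2) :
    (∀ X : H →L[ℂ] H,
      Summable (fun k => B.op k ∘L X ∘L A.op k) ∧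
      Summable (fun k => (B.op k).adjoint ∘L X ∘L (A.op k).adjoint) ∧
      hsNorm (multOp B.op A.op X) =
        hsNorm (multOp (fun k => (B.op k).adjoint) (fun k => (A.op k).adjoint) X)) ∧
    (∀ (J : Type v) (f u : J → A.jointSpectrum → ℂ) (g v : J → B.jointSpectrum → ℂ),
      ∑' j, lipNorm (f j) ^ 2 < ∞ →
      (∀ j, Measurable (g j)) → ∑' j, supNorm (g j) ^ 2 < ∞ →
      (∀ j, Measurable (u j) ∧ supNorm (u j) < ∞) →
      (∀ j, Measurable (v j) ∧ supNorm (v j) < ∞) →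
      ∑' j, supNorm (u j) * supNorm (v j) < ∞ →
      (∀ x y, ‖∑' j, f j x * g j y‖ ≤ ‖∑' j, u j x * v j y‖) →
      ∀ X : H →L[ℂ] H,
        Summable (fun j => B.borelCalc (g j) ∘L X ∘L A.borelCalc (f j)) ∧
        Summable (fun j => B.borelCalc (v j) ∘L X ∘L A.borelCalc (u j)) ∧
        hsNorm (multOp (fun j => B.borelCalc (g j)) (fun j => A.borelCalc (f j)) X) ≤
          hsNorm (multOp (fun j => B.borelCalc (v j)) (fun j => A.borelCalc (u j)) X)) := by
  have hopA : (fun k => A.op k) = fun k => A.borelCalc (A.coordFn k) :=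
    funext fun k => (A.borelCalc_coordFn k).symm
  have hopB : (fun k => B.op k) = fun k => B.borelCalc (B.coordFn k) :=
    funext fun k => (B.borelCalc_coordFn k).symm
  have hadjA : (fun k => (A.op k).adjoint)
      = fun k => A.borelCalc ((NormalFamily.coordSymbol A B).conj.left k) := funext fun k => by
    rw [← A.borelCalc_coordFn k, A.adjoint_borelCalc (A.bddMeas_continuousMap _)]
    rfl
  have hadjB : (fun k => (B.op k).adjoint)
      = fun k => B.borelCalc ((NormalFamily.coordSymbol A B).conj.right k) := funext fun k => by
    rw [← B.borelCalc_coordFn k, B.adjoint_borelCalc (B.bddMeas_continuousMap _)]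
    rfl
  refine ⟨fun X => ⟨?_, ?_, ?_⟩, fun J f u g v hf hgm hg hu hv huv hle X => ?_⟩
  · simpa only [NormalFamily.coordSymbol, A.borelCalc_coordFn, B.borelCalc_coordFn] using
      summable_borelCalc_comp A B (NormalFamily.coordSymbol A B) X
  · have h := summable_borelCalc_comp A B (NormalFamily.coordSymbol A B).conj X
    simp_rw [← congrFun hadjA, ← congrFun hadjB] at h
    exact h
  · rw [hadjA, hadjB, show A.op = _ from hopA, show B.op = _ from hopB]
    refine le_antisymm ?_ ?_
    · exact hsNorm_multOp_le A B hA (fun z => (ProjSymbol.norm_eval_conj _ z).ge)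
        (NormalFamily.isLip_coordSymbol A B) X
    · exact hsNorm_multOp_le A B hA (fun z => (ProjSymbol.norm_eval_conj _ z).le)
        (NormalFamily.isLip_coordSymbol A B).conj X
  · have hf' : ∀ j, lipNorm (f j) ≠ ∞ := ne_top_of_tsum_sq_lt_top hf
    have hf'' : ∀ j, supNorm (f j) ≠ ∞ := fun j =>
      ne_top_of_le_ne_top (hf' j) (supNorm_le_lipNorm _)
    have hg' : ∀ j, supNorm (g j) ≠ ∞ := ne_top_of_tsum_sq_lt_top hg
    have hsfg : Summable fun j => (supNorm (f j)).toReal * (supNorm (g j)).toReal := by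
      refine Summable.of_nonneg_of_le (fun _ => by positivity) (fun j => ?_)
        ((summable_sq_toReal hf).add (summable_sq_toReal hg))
      have h1 := ENNReal.toReal_mono (hf' j) (supNorm_le_lipNorm (f j))
      have h2 : 0 ≤ (supNorm (g j)).toReal := ENNReal.toReal_nonneg
      have h3 := mul_le_mul_of_nonneg_right h1 h2
      nlinarith [sq_nonneg ((lipNorm (f j)).toReal - (supNorm (g j)).toReal),
        sq_nonneg (lipNorm (f j)).toReal, sq_nonneg (supNorm (g j)).toReal]
    have hsuv : Summable fun j => (supNorm (u j)).toReal * (supNorm (v j)).toReal := by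
      simpa using ENNReal.summable_toReal huv.ne
    let S := ProjSymbol.ofSupNorm f g (fun j => measurable_of_lipNorm_ne_top (hf' j)) hgm hf'' hg'
      hsfg
    let U := ProjSymbol.ofSupNorm u v (fun j => (hu j).1) (fun j => (hv j).1)
      (fun j => (hu j).2.ne) (fun j => (hv j).2.ne) hsuv
    exact ⟨summable_borelCalc_comp A B S X, summable_borelCalc_comp A B U X,
      hsNorm_multOp_le A B hA (S := S) (U := U) (fun z => hle z.1 z.2)
        (ProjSymbol.isLip_ofSupNorm hf hg) X⟩
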